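/- Let $\ell>0$ be an integer, and let $L_\ell$ be the right-handed $(2,2\ell)$-torus link, viewed as the ordered oriented two-component (2-coloured) link that is the closure of the two-strand braid $\sigma_1^{2\ell}$ coloured by $(1,2)$. Let $(\alpha_1,\alpha_2)\in(0,\pi)^2$ be such that $$\alpha_1+\alpha_2\neq\frac{\pi m}{\ell}\quad\text{and}\quad \alpha_1-\alpha_2+\pi\neq\frac{\pi m}{\ell}\qquad\text{for all integers } m \text{ with } 0<m<\ell \text{ or } \ell<m<2\ell .$$ For a $\mu$-coloured link $L$, a parameter $\alpha\in(0,\pi)^\mu$ and a coloured braid $\beta$ on $n$ strands with colouring $c$ and closure $L$, let $R_n^{\alpha,c}$ be the space of $n$-tuples $(X_1,\dots,X_n)$ in $\mathrm{SU}(2)$ with $\operatorname{tr}X_i=2\cos\alpha_{c_i}$, on which $\beta$ acts through $(X_1,\dots,X_n)\sigma_i=(\dots,X_iX_{i+1}X_i^{-1},X_i,\dots)$. Let $\widehat H_n^{\alpha,c}$ be the space of irreducible pairs $(X,Y)\in R_n^{\alpha,c}\times R_n^{\alpha,c}$ with $X_1\cdots X_n=Y_1\cdots Y_n$, modulo simultaneous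 conjugation, and let $\widehat\Lambda_n^{\alpha,c}$ and $\widehat\Gamma_\beta^{\alpha,c}$ be its subspaces given by the diagonal $Y=X$ and by the graph $Y=X\beta$. The spheres forming $R_n^{\alpha,c}$ are given an arbitrary orientation of $S^2$, $R_n^{\alpha,c}$, the diagonal and the graph the product orientation, the set $\{X_1\cdots X_n(Y_1\cdots Y_n)^{-1}=1\}$ the base-first preimage orientation (with $\mathrm{SU}(2)$ oriented by $i,j,k$), and all three spaces the quotient orientations. The Bénard–Conway invariant is the intersection number $h_L(\alpha)=\langle\widehat\Lambda_n^{\alpha,c},\widehat\Gamma_\beta^{\alpha,c}\rangle_{\widehat H_n^{\alpha,c}}$. Then $h_{L_\ell}(\alpha_1,\alpha_2)$ is well defined: the multivariable Alexander polynomial of $L_\ell$ satisfies $\Delta_{L_\ell}(e^{2\epsilon_1 i\alpha_1},e^{2\epsilon_2 i\alpha_2})\neq0$ for all $\epsilon_1,\epsilon_2=\pm1$, and for every coloured braid whose closure is $L_\ell$ the intersection $\widehat\Lambda_n^{\alpha,c}\cap\widehat\Gamma_\beta^{\alpha,c}$ is compact, transverse and finite (so that no perturbation is needed), with an intersection number that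 does not depend on the braid. Moreover $h_{L_\ell}(\alpha_1,\alpha_2)$ is equal to the number of integers $m\in\{1,\dots,\ell-1\}$ such that $$\cos(\pi m/\ell)\in[\cos(\alpha_1+\alpha_2),\,\cos(\alpha_1-\alpha_2)].$$ -/

import Mathlib

open scoped Quaternion

noncomputable section

namespace BenardConway

/-! ### Braid groups and their actions -/

/-- The Artin relations between the generators `σ 0, …, σ (n - 1)` of the braid group on
`n + 1` strands. -/
def braidRels (n : ℕ) : Set (FreeGroup (Fin n)) :=
  {r | ∃ i j : Fin n, (i : ℕ) + 1 = j ∧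
      r = FreeGroup.of i * FreeGroup.of j * FreeGroup.of i *
        (FreeGroup.of j * FreeGroup.of i * FreeGroup.of j)⁻¹} ∪
  {r | ∃ i j : Fin n, (i : ℕ) + 1 < j ∧
      r = FreeGroup.of i * FreeGroup.of j * (FreeGroup.of j * FreeGroup.of i)⁻¹}

/-- The Artin braid group on `n + 1` strands. -/
abbrev Braid (n : ℕ) : Type := PresentedGroup (braidRels n)

/-- The Artin generator `σ i`, involving the strands `i` and `i + 1` (counted from `0`). -/
def σ {n : ℕ} (i : Fin n) : Braid n := PresentedGroup.of i

/-- A map on generators that respects the Artin relations defines a homomorphism. -/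
def braidLift {n : ℕ} {H : Type*} [Group H] (f : Fin n → H)
    (h₁ : ∀ i j : Fin n, (i : ℕ) + 1 = j → f i * f j * f i = f j * f i * f j)
    (h₂ : ∀ i j : Fin n, (i : ℕ) + 1 < j → f i * f j = f j * f i) : Braid n →* H :=
  PresentedGroup.toGroup (f := f) (by
    rintro r (⟨i, j, hij, rfl⟩ | ⟨i, j, hij, rfl⟩)
    · simp only [map_mul, map_inv, FreeGroup.lift_apply_of]
      exact mul_inv_eq_one.2 (h₁ i j hij)
    · simp only [map_mul, map_inv, FreeGroup.lift_apply_of]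
      exact mul_inv_eq_one.2 (h₂ i j hij))

/-- The action of `σ i` on `(n + 1)`-tuples of elements of a group:
`(…, Xᵢ, Xᵢ₊₁, …) ↦ (…, Xᵢ Xᵢ₊₁ Xᵢ⁻¹, Xᵢ, …)`. -/
def sigmaAct (G : Type*) [Group G] {n : ℕ} (i : Fin n) : Equiv.Perm (Fin (n + 1) → G) where
  toFun X j :=
    if j = i.castSucc then X i.castSucc * X i.succ * (X i.castSucc)⁻¹
    else if j = i.succ then X i.castSucc else X j
  invFun Y j :=
    if j = i.castSucc then Y i.succ
    else if j = i.succ then (Y i.succ)⁻¹ * Y i.castSucc * Y i.succ else Y j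
  left_inv X := by
    funext j
    have h : i.succ ≠ i.castSucc := (Fin.castSucc_lt_succ).ne'
    by_cases h1 : j = i.castSucc
    · simp [h1, h]
    · by_cases h2 : j = i.succ
      · simp [h2, h, mul_assoc]
      · simp [h1, h2]
  right_inv Y := by
    funext j
    have h : i.succ ≠ i.castSucc := (Fin.castSucc_lt_succ).ne'
    by_cases h1 : j = i.castSucc
    · simp [h1, h, mul_assoc]
    · by_cases h2 : j = i.succ
      · simp [h2, h]
      · simp [h1, h2]

/-- The action of the braid group on `(n + 1)`-tuples of elements of a group `G`. For `G` the free
group on `x₀, …, xₙ` and the tuple `(x₀, …, xₙ)` it gives the words `xⱼ β` of the Artin action on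
the free group. For any `G` and any tuple `X`, the entry `j` of `braidAct G β X` is the
word `xⱼ β` evaluated at `X`. -/
def braidAct (G : Type*) [Group G] {n : ℕ} : Braid n →* Equiv.Perm (Fin (n + 1) → G) :=
  braidLift (sigmaAct G)
    (by
      intro i j hij
      have e : i.succ = j.castSucc := Fin.ext (by simpa using hij)
      have h1 : i.castSucc ≠ j.castSucc := fun h => by simp [Fin.ext_iff] at h; omega
      have h2 : i.castSucc ≠ j.succ := fun h => by simp [Fin.ext_iff] at h; omega
      have h3 : j.castSucc ≠ j.succ := (Fin.castSucc_lt_succ).ne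
      ext X k
      simp only [Equiv.Perm.mul_apply, sigmaAct, Equiv.coe_fn_mk, e]
      by_cases k1 : k = i.castSucc
      · subst k1; simp [h1, h2, h1.symm, h2.symm, h3.symm, mul_assoc]
      · by_cases k2 : k = j.castSucc
        · subst k2; simp [h1, h2, h1.symm, h2.symm, h3.symm]
        · by_cases k3 : k = j.succ
          · subst k3; simp [h1, h2, h1.symm, h2.symm, h3.symm]
          · simp [k1, k2, k3])
    (by
      intro i j hij
      have h1 : i.castSucc ≠ j.castSucc := fun h => by simp [Fin.ext_iff] at h; omega
      have h2 : i.castSucc ≠ j.succ := fun h => by simp [Fin.ext_iff] at h; omega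
      have h3 : i.succ ≠ j.castSucc := fun h => by simp [Fin.ext_iff] at h; omega
      have h4 : i.succ ≠ j.succ := fun h => by simp [Fin.ext_iff] at h; omega
      ext X k
      simp only [Equiv.Perm.mul_apply, sigmaAct, Equiv.coe_fn_mk]
      by_cases k1 : k = i.castSucc
      · subst k1; simp [h1, h2, h3, h4]
      · by_cases k2 : k = i.succ
        · subst k2; simp [h1, h2, h3, h4]
        · by_cases k3 : k = j.castSucc
          · subst k3; simp [h1.symm, h2.symm, h3.symm, h4.symm]
          · by_cases k4 : k = j.succ
            · subst k4; simp [h1.symm, h2.symm, h3.symm, h4.symm]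
            · simp [k1, k2, k3, k4])

/-- The permutation of the strands underlying a braid. -/
def braidPerm {n : ℕ} : Braid n →* Equiv.Perm (Fin (n + 1)) :=
  braidLift (fun i => Equiv.swap i.castSucc i.succ)
    (by
      intro i j hij
      have e : i.succ = j.castSucc := Fin.ext (by simpa using hij)
      have h1 : i.castSucc ≠ j.castSucc := fun h => by simp [Fin.ext_iff] at h; omega
      have h2 : i.castSucc ≠ j.succ := fun h => by simp [Fin.ext_iff] at h; omega
      have h3 : j.castSucc ≠ j.succ := (Fin.castSucc_lt_succ).ne
      rw [e, Equiv.swap_mul_swap_mul_swap h1 h2,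
        Equiv.swap_comm i.castSucc, Equiv.swap_comm j.castSucc j.succ,
        Equiv.swap_mul_swap_mul_swap h3.symm h2.symm, Equiv.swap_comm])
    (by
      intro i j hij
      refine (Equiv.Perm.disjoint_swap_swap ?_).commute
      simp [Fin.ext_iff]
      omega)

/-- The inclusion of braid groups that adds one trivial strand on the right. -/
def addStrand {n : ℕ} : Braid n →* Braid (n + 1) :=
  braidLift (fun i => σ i.castSucc)
    (by
      intro i j hij
      have := PresentedGroup.mk_eq_mk_of_mul_inv_mem (rels := braidRels (n + 1))
        (Or.inl ⟨i.castSucc, j.castSucc, by simpa using hij, rfl⟩)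
      rw [map_mul, map_mul, map_mul, map_mul] at this
      exact this)
    (by
      intro i j hij
      have := PresentedGroup.mk_eq_mk_of_mul_inv_mem (rels := braidRels (n + 1))
        (Or.inr ⟨i.castSucc, j.castSucc, by simpa using hij, rfl⟩)
      rw [map_mul, map_mul] at this
      exact this)

/-! ### Coloured braids and coloured links -/

/-- A `μ`-coloured braid on `n + 1` strands whose upper and lower colourings agree, so that its
closure is a `μ`-coloured link. -/
structure ColoredBraid (μ : ℕ) where
  /-- The number of strands is `n + 1`. -/
  n : ℕ
  /-- The colours of the endpoints. -/
  color : Fin (n + 1) → Fin μ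
  surjective : Function.Surjective color
  /-- The underlying braid. -/
  braid : Braid n
  color_perm : color ∘ braidPerm braid = color

/-- The coloured Markov moves: conjugation by a braid (which transports the colouring), and
stabilization by adding a strand, of the colour of the last one, and a crossing of either sign
between the two last strands. -/
inductive MarkovMove {μ : ℕ} : ColoredBraid μ → ColoredBraid μ → Prop
  | conj {n : ℕ} {c c' : Fin (n + 1) → Fin μ} {hs : Function.Surjective c}
      {hs' : Function.Surjective c'} {β β' : Braid n} {h : c ∘ braidPerm β = c}
      {h' : c' ∘ braidPerm β' = c'} (γ : Braid n) (hc : c = c' ∘ braidPerm γ)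
      (hβ : β' = γ * β * γ⁻¹) : MarkovMove ⟨n, c, hs, β, h⟩ ⟨n, c', hs', β', h'⟩
  | stab {n : ℕ} {c : Fin (n + 1) → Fin μ} {c' : Fin (n + 1 + 1) → Fin μ}
      {hs : Function.Surjective c} {hs' : Function.Surjective c'} {β : Braid n}
      {β' : Braid (n + 1)} {h : c ∘ braidPerm β = c} {h' : c' ∘ braidPerm β' = c'}
      (hc : c' = Fin.snoc (α := fun _ => Fin μ) c (c (Fin.last n)))
      (hβ : β' = addStrand β * σ (Fin.last n) ∨ β' = addStrand β * (σ (Fin.last n))⁻¹) :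
      MarkovMove ⟨n, c, hs, β, h⟩ ⟨n + 1, c', hs', β', h'⟩

/-- Isotopy classes of `μ`-coloured oriented links in the 3-sphere, realized (through the coloured
versions of the theorems of Alexander and Markov) as coloured braids up to the equivalence relation
generated by the coloured Markov moves. -/
def ColoredLink (μ : ℕ) : Type := Quot (MarkovMove (μ := μ))

/-- The coloured link obtained by closing a coloured braid. -/
def ColoredBraid.closure {μ : ℕ} (b : ColoredBraid μ) : ColoredLink μ := Quot.mk _ b

/-- The braid `σ₁ ^ (2 ℓ)` on two strands, coloured by `(1, 2)`. -/
def torusBraid (ℓ : ℕ) : ColoredBraid 2 where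
  n := 1
  color := id
  surjective := Function.surjective_id
  braid := σ 0 ^ (2 * ℓ)
  color_perm := by
    have h : braidPerm (σ (0 : Fin 1)) = Equiv.swap (0 : Fin 2) 1 := by
      simp [braidPerm, braidLift, σ]
    have h' : braidPerm (σ (0 : Fin 1) ^ (2 * ℓ)) = 1 := by
      rw [map_pow, h, pow_mul, pow_two, Equiv.swap_mul_self, one_pow]
    rw [h']; rfl

/-- The right-handed `(2, 2 ℓ)`-torus link, with its two components ordered and oriented
as the closure of the braid `σ₁ ^ (2 ℓ)`. -/
def torusLink (ℓ : ℕ) : ColoredLink 2 := (torusBraid ℓ).closure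

/-! ### The multivariable Alexander polynomial -/

/-- The ring of integral Laurent polynomials in `μ` variables. -/
abbrev Laurent (μ : ℕ) : Type := AddMonoidAlgebra ℤ (Fin μ → ℤ)

/-- The affine bijection `x ↦ tₖ x + d` of the Laurent polynomial ring. -/
def affinePerm {μ : ℕ} (k : Fin μ) (d : Laurent μ) : Equiv.Perm (Laurent μ) where
  toFun x := AddMonoidAlgebra.single (Pi.single k 1) 1 * x + d
  invFun y := AddMonoidAlgebra.single (Pi.single k (-1)) 1 * (y - d)
  left_inv x := by
    simp [← mul_assoc, AddMonoidAlgebra.single_mul_single, ← Pi.single_add,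
      ← AddMonoidAlgebra.one_def]
  right_inv y := by
    simp [← mul_assoc, AddMonoidAlgebra.single_mul_single, ← Pi.single_add,
      ← AddMonoidAlgebra.one_def]

/-- The Fox derivative of a word with respect to `x_j`, pushed to Laurent polynomials by sending
each generator `xᵢ` to the variable of its colour `c i`. The word acts on Laurent
polynomials by composing the affine maps `x ↦ φ(xᵢ) x + ∂xᵢ/∂x_j` of its letters, and the
product rule `∂(uv) = ∂u + φ(u) ∂v` says that the derivative is the image of `0`. -/
def foxDeriv {μ N : ℕ} (c : Fin N → Fin μ) (j : Fin N) (w : FreeGroup (Fin N)) : Laurent μ :=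
  FreeGroup.lift (fun i => affinePerm (c i) (if i = j then 1 else 0)) w 0

/-- The Alexander matrix of the presentation `⟨ x₀, …, xₙ ∣ xᵢ = xᵢ β ⟩` of the group of the
closure of a coloured braid. -/
def alexanderMatrix {μ : ℕ} (b : ColoredBraid μ) :
    Matrix (Fin (b.n + 1)) (Fin (b.n + 1)) (Laurent μ) :=
  fun i j => foxDeriv b.color j (braidAct (FreeGroup (Fin (b.n + 1))) b.braid FreeGroup.of i) -
    (if i = j then 1 else 0)

/-- `Δ` is a multivariable Alexander polynomial of the closure of `b`: a greatest common divisor of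
the `n × n` minors of the `(n + 1) × (n + 1)` Alexander matrix. It is unique up to units. -/
def IsAlexanderPolynomial {μ : ℕ} (b : ColoredBraid μ) (Δ : Laurent μ) : Prop :=
  (∀ p q : Fin (b.n + 1), Δ ∣ ((alexanderMatrix b).submatrix p.succAbove q.succAbove).det) ∧
  ∀ d : Laurent μ,
    (∀ p q : Fin (b.n + 1), d ∣ ((alexanderMatrix b).submatrix p.succAbove q.succAbove).det) →
    d ∣ Δ

/-- Evaluation of a Laurent polynomial at a point of the torus. -/
def evalTorus {μ : ℕ} (ω : Fin μ → Circle) : Laurent μ →ₐ[ℤ] ℂ :=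
  AddMonoidAlgebra.lift ℤ ℂ (Fin μ → ℤ)
    (Circle.coeHom.comp
      { toFun := fun k : Multiplicative (Fin μ → ℤ) => ∏ i, ω i ^ (k.toAdd i)
        map_one' := by simp
        map_mul' := by intro x y; simp [zpow_add, Finset.prod_mul_distrib] })

/-! ### Representation spaces -/

/-- The group `SU(2)`, as the group of unit quaternions. -/
abbrev SU2 : Type := unitary ℍ[ℝ]

/-- The space `R_N^{α,c}`: the trace `2 Re (X i)` is equal to `2 cos (α (c i))`. -/
def repSpace {μ N : ℕ} (α : Fin μ → ℝ) (c : Fin N → Fin μ) : Set (Fin N → SU2) :=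
  {X | ∀ i, 2 * (X i : ℍ[ℝ]).re = 2 * Real.cos (α (c i))}

/-- A tuple in `SU(2)` is irreducible (it generates a subgroup with no common eigenline in `ℂ²`) if
and only if not all its entries commute. -/
def Irred {ι : Type*} (X : ι → SU2) : Prop := ∃ i j, X i * X j ≠ X j * X i

/-- The product `X₀ X₁ ⋯` of the entries of a tuple in a monoid, in this order. -/
def tupleProd {M : Type*} [Monoid M] {N : ℕ} (X : Fin N → M) : M := (List.ofFn X).prod

/-- The irreducible part of the space `H_N^{α,c}` of pairs of tuples with equal products. -/
def HIrr {μ N : ℕ} (α : Fin μ → ℝ) (c : Fin N → Fin μ) : Type :=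
  {p : (Fin N → SU2) × (Fin N → SU2) //
    (p.1 ∈ repSpace α c ∧ p.2 ∈ repSpace α c ∧ tupleProd p.1 = tupleProd p.2) ∧
      Irred (Sum.elim p.1 p.2)}

instance {μ N : ℕ} (α : Fin μ → ℝ) (c : Fin N → Fin μ) : TopologicalSpace (HIrr α c) :=
  inferInstanceAs (TopologicalSpace (Subtype _))

/-- Simultaneous conjugation by elements of `SU(2)` (equivalently, the action of `SO(3)`). -/
instance conjSetoid {μ N : ℕ} (α : Fin μ → ℝ) (c : Fin N → Fin μ) : Setoid (HIrr α c) where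
  r p q := ∃ g : SU2, (∀ i, q.1.1 i = g * p.1.1 i * g⁻¹) ∧ ∀ i, q.1.2 i = g * p.1.2 i * g⁻¹
  iseqv :=
    { refl := fun p => ⟨1, by simp, by simp⟩
      symm := by
        rintro p q ⟨g, h1, h2⟩
        exact ⟨g⁻¹, fun i => by simp [h1, mul_assoc], fun i => by simp [h2, mul_assoc]⟩
      trans := by
        rintro p q r ⟨g, h1, h2⟩ ⟨k, k1, k2⟩
        exact ⟨k * g, fun i => by simp [h1, k1, mul_assoc], fun i => by simp [h2, k2, mul_assoc]⟩ }

/-- The quotient `Ĥ_N^{α,c}` (the pillowcase without its reducible points if `N = 2`), with the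
quotient topology. -/
abbrev HHat {μ N : ℕ} (α : Fin μ → ℝ) (c : Fin N → Fin μ) : Type := Quotient (conjSetoid α c)

/-- The class of the diagonal `Λ̂_N^{α,c}` in `Ĥ_N^{α,c}`. -/
def LambdaHat {μ N : ℕ} (α : Fin μ → ℝ) (c : Fin N → Fin μ) : Set (HHat α c) :=
  {P | ∃ p : HIrr α c, ⟦p⟧ = P ∧ p.1.2 = p.1.1}

/-- The class of the graph `Γ̂_β^{α,c}` of a braid in `Ĥ_N^{α,c}`. -/
def GammaHat {μ n : ℕ} (α : Fin μ → ℝ) (c : Fin (n + 1) → Fin μ) (β : Braid n) :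
    Set (HHat α c) :=
  {P | ∃ p : HIrr α c, ⟦p⟧ = P ∧ p.1.2 = braidAct SU2 β p.1.1}

/-! ### Tangent spaces, transversality and signs

All the spaces are regarded as submanifolds of powers of the space of quaternions. -/

/-- The entries of a tuple of unit quaternions, as quaternions. -/
def toH {N : ℕ} (X : Fin N → SU2) : Fin N → ℍ[ℝ] := fun i => (X i : ℍ[ℝ])

open Classical in
/-- A non-zero quaternion as a unit of the ring of quaternions (junk value `1` at `0`). -/
def toUnit (q : ℍ[ℝ]) : ℍ[ℝ]ˣ := if h : q = 0 then 1 else Units.mk0 q h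

/-- The action of a braid on tuples of non-zero quaternions, which extends the action on tuples in
`SU(2)` to an open set and is smooth there. -/
def extAct {n : ℕ} (β : Braid n) (x : Fin (n + 1) → ℍ[ℝ]) : Fin (n + 1) → ℍ[ℝ] :=
  fun j => (braidAct ℍ[ℝ]ˣ β (fun i => toUnit (x i)) j : ℍ[ℝ])

/-- The derivative at `X` of the braid action. -/
def dAct {n : ℕ} (β : Braid n) (X : Fin (n + 1) → SU2) :
    (Fin (n + 1) → ℍ[ℝ]) →L[ℝ] (Fin (n + 1) → ℍ[ℝ]) :=
  fderiv ℝ (extAct β) (toH X)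

/-- The derivative at `(X, X)` of the map `f (X, Y) = X₀ ⋯ Xₙ (Y₀ ⋯ Yₙ)⁻¹`. -/
def dF {N : ℕ} (X : Fin N → SU2) :
    (Fin N → ℍ[ℝ]) × (Fin N → ℍ[ℝ]) →L[ℝ] ℍ[ℝ] :=
  fderiv ℝ (fun p : (Fin N → ℍ[ℝ]) × (Fin N → ℍ[ℝ]) => tupleProd p.1 * (tupleProd p.2)⁻¹)
    (toH X, toH X)

/-- The tangent space at `X` of the space `R_N^{α,c}`, which is a product of spheres, each given by
fixing the norm and the real part of a quaternion. -/
def tangentR {N : ℕ} (X : Fin N → SU2) : Submodule ℝ (Fin N → ℍ[ℝ]) where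
  carrier := {a | ∀ i, (a i).re = 0 ∧ (a i * star (X i : ℍ[ℝ])).re = 0}
  zero_mem' := by intro i; simp
  add_mem' := by
    intro a b ha hb i
    obtain ⟨h1, h2⟩ := ha i
    obtain ⟨h3, h4⟩ := hb i
    exact ⟨by rw [Pi.add_apply, Quaternion.re_add, h1, h3, add_zero],
      by rw [Pi.add_apply, add_mul, Quaternion.re_add, h2, h4, add_zero]⟩
  smul_mem' := by
    intro t a ha i
    obtain ⟨h1, h2⟩ := ha i
    exact ⟨by rw [Pi.smul_apply, Quaternion.re_smul, h1, smul_zero],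
      by rw [Pi.smul_apply, smul_mul_assoc, Quaternion.re_smul, h2, smul_zero]⟩

/-- The tangent space at `(X, X)` of `H_N^{α,c} = f⁻¹(1)`. -/
def tangentH {N : ℕ} (X : Fin N → SU2) :
    Submodule ℝ ((Fin N → ℍ[ℝ]) × (Fin N → ℍ[ℝ])) :=
  (tangentR X).prod (tangentR X) ⊓ LinearMap.ker (dF X).toLinearMap

/-- The tangent space at `(X, X)` of the diagonal. -/
def tangentLambda {N : ℕ} (X : Fin N → SU2) :
    Submodule ℝ ((Fin N → ℍ[ℝ]) × (Fin N → ℍ[ℝ])) :=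
  (tangentR X).map (LinearMap.prod LinearMap.id LinearMap.id)

/-- The tangent space at `(X, X)` of the graph of a braid that fixes `X`. -/
def tangentGamma {n : ℕ} (β : Braid n) (X : Fin (n + 1) → SU2) :
    Submodule ℝ ((Fin (n + 1) → ℍ[ℝ]) × (Fin (n + 1) → ℍ[ℝ])) :=
  (tangentR X).map (LinearMap.prod LinearMap.id (dAct β X).toLinearMap)

/-- Transversality of `Λ̂` and `Γ̂` in `Ĥ` at the class of `(X, X)`. The tangent spaces of the
quotients are those of `Λ`, `Γ` and `H` modulo the tangent space of the orbit, which all of them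
contain. -/
def TransverseAt {n : ℕ} (β : Braid n) (X : Fin (n + 1) → SU2) : Prop :=
  tangentLambda X ⊔ tangentGamma β X = tangentH X

/-- The basis `i, j, k` of the Lie algebra of purely imaginary quaternions, which defines the
canonical orientation of `SU(2)`. -/
def imBasis : Fin 3 → ℍ[ℝ] := ![⟨0, 1, 0, 0⟩, ⟨0, 0, 1, 0⟩, ⟨0, 0, 0, 1⟩]

/-- The vector tangent at `X` to the orbit under conjugation, in the direction of the imaginary
quaternion `e`: the derivative at `t = 0` of `exp (t e) X exp (- t e)`. -/
def orbitVec {N : ℕ} (X : Fin N → SU2) (e : ℍ[ℝ]) : Fin N → ℍ[ℝ] :=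
  fun i => e * (X i : ℍ[ℝ]) - (X i : ℍ[ℝ]) * e

/-- `ε` is the sign of the intersection of `Λ̂` and `Γ̂` (in this order) in `Ĥ` at the class
of `(X, X)`.

Let `v` be the basis of the tangent space of the orbit of `X` given by the basis `i, j, k` of the
Lie algebra, and complete it by vectors `a` to a basis of the tangent space `T` of `R_N^{α,c}`
at `X`. Orient `T` by `(a, v)`. (The orientation of `R_N^{α,c}` is immaterial: reversing it does not
change the product orientation of `T × T`, and it reverses the orientations of `Λ̂` and `Γ̂`
together.) Then `a` represents a positive basis of `T_X R̂`, and the oriented manifolds `Λ̂` and `Γ̂`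
have the positive bases represented by `(a, a)` and `(a, dβ a)`. Let the vectors `w` in `T × T` be
mapped by `df` to the basis `i, j, k`. The orientations of `H = f⁻¹(1)` and of its quotient `Ĥ`
follow the rule of putting the base first and the fibre second. Hence the sign of the intersection is the sign of the
basis `w, (a, a), (a, dβ a), (v, v)` with respect to the product orientation of `T × T`.
The matrix `M` expresses this basis by the basis `(v, 0), (a, 0), (0, a), (0, v)` of `T × T`, and
reordering the latter to the positive basis `(a, 0), (v, 0), (0, a), (0, v)` takes
a permutation of sign `(-1) ^ (3 * m)`, where `m` is the number of the vectors `a`. -/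
def HasSign {n : ℕ} (β : Braid n) (X : Fin (n + 1) → SU2) (ε : SignType) : Prop :=
  ∃ (m : ℕ) (a : Fin m → (Fin (n + 1) → ℍ[ℝ]))
    (w : Fin 3 → (Fin (n + 1) → ℍ[ℝ]) × (Fin (n + 1) → ℍ[ℝ]))
    (M : Matrix ((Fin 3 ⊕ Fin m) ⊕ (Fin m ⊕ Fin 3)) ((Fin 3 ⊕ Fin m) ⊕ (Fin m ⊕ Fin 3)) ℝ),
    let v : Fin 3 → (Fin (n + 1) → ℍ[ℝ]) := fun k => orbitVec X (imBasis k)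
    LinearIndependent ℝ (Sum.elim v a) ∧
    Submodule.span ℝ (Set.range (Sum.elim v a)) = tangentR X ∧
    (∀ k, (w k).1 ∈ tangentR X ∧ (w k).2 ∈ tangentR X ∧ dF X (w k) = imBasis k) ∧
    (∀ s,
      Sum.elim (Sum.elim w (fun i => (a i, a i)))
          (Sum.elim (fun i => (a i, dAct β X (a i))) (fun k => (v k, v k))) s =
        ∑ r, M r s •
          Sum.elim (Sum.elim (fun k => (v k, 0)) (fun i => (a i, 0)))
            (Sum.elim (fun i => (0, a i)) (fun k => (0, v k))) r) ∧
    SignType.sign ((-1) ^ (3 * m) * M.det) = ε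

/-- The intersection points of `Λ̂` and `Γ̂` of sign `ε`. -/
def signedPoints {μ : ℕ} (b : ColoredBraid μ) (α : Fin μ → ℝ) (ε : SignType) :
    Set (HHat α b.color) :=
  {P | P ∈ LambdaHat α b.color ∩ GammaHat α b.color b.braid ∧
    ∃ p : HIrr α b.color, ⟦p⟧ = P ∧ p.1.2 = p.1.1 ∧ HasSign b.braid p.1.1 ε}

/-- The intersection number `⟨Λ̂, Γ̂⟩` in `Ĥ`, for a finite transverse intersection: the number of
the positive intersection points minus the number of the negative ones. -/
def intersectionNumber {μ : ℕ} (b : ColoredBraid μ) (α : Fin μ → ℝ) : ℤ :=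
  ((signedPoints b α 1).ncard : ℤ) - ((signedPoints b α (-1)).ncard : ℤ)

/-! ### The Bénard–Conway invariant -/

/-- The Bénard–Conway invariant `h_L(α)`: the intersection number `⟨Λ̂, Γ̂⟩` in `Ĥ` for some coloured
braid with closure `L`. (No perturbation of `Γ̂` is made, so this is meant for links and parameters
with a transverse intersection; this, and the independence of the braid, is part of
`WellDefined`.) -/
def benardConway {μ : ℕ} (L : ColoredLink μ) (α : Fin μ → ℝ) : ℤ :=
  intersectionNumber (Quot.exists_rep L).choose α

/-- The invariant `h_L(α)` is well defined: for every coloured braid with closure `L`, the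
intersection of `Λ̂` and `Γ̂` in `Ĥ` is compact, transverse and finite, and the intersection number
does not depend on the braid. -/
structure WellDefined {μ : ℕ} (L : ColoredLink μ) (α : Fin μ → ℝ) : Prop where
  isCompact : ∀ b : ColoredBraid μ, b.closure = L →
    IsCompact (LambdaHat α b.color ∩ GammaHat α b.color b.braid)
  transverse : ∀ b : ColoredBraid μ, b.closure = L → ∀ p : HIrr α b.color,
    p.1.2 = p.1.1 → p.1.2 = braidAct SU2 b.braid p.1.1 → TransverseAt b.braid p.1.1
  finite : ∀ b : ColoredBraid μ, b.closure = L →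
    (LambdaHat α b.color ∩ GammaHat α b.color b.braid).Finite
  eq_intersectionNumber : ∀ b : ColoredBraid μ, b.closure = L →
    benardConway L α = intersectionNumber b α

end BenardConway

end

/-! A point of the intersection is a conjugacy class of irreducible tuples X fixed by the braid.
Write T for the tangent space of R at X, v : ℝ³ → T for the derivative of the conjugation action, A
= 1 - dβ, and D : T → ℝ³ for the derivative of the product, translated to the identity. Then A v = 0
and D A = 0, because the braid action commutes with conjugation and preserves the product.
Irreducibility makes v injective and D surjective.

The orientation conventions reduce to a torsion sign: the sign of the point is the sign of det(A + u
L), for any left inverse L of v and right inverse u of D (`hasSign_iff`). This sign does not depend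
on L and u. When it is nonzero the complex is exact in the middle, which is transversality.
Conjugating the braid gives an isomorphic complex, and a stabilization adds a triangular block of
positive determinant. Hence the property that all points are positive and that there are k of them
(`HasPositivePoints`) is invariant under Markov moves (`MarkovMove.hasPositivePoints_iff`), so one
braid decides finiteness, transversality and the value of the invariant for all braids with the same
closure.

For the braid σ^(2ℓ) the action is conjugation by (X₀X₁)^ℓ. An irreducible pair is fixed exactly
when this power is central, that is, when X₀X₁ has real part cos(πm/ℓ) with 0 < m < ℓ (`fixed_iff`).
With the real parts of X₀ and X₁ given, that of X₀X₁ determines the irreducible pair up to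
conjugation. It lies between cos(α₁+α₂) and cos(α₁-α₂), every interior value occurs, and the
hypothesis on the angles keeps the values cos(πm/ℓ) away from the endpoints. The map A has rank one
and is explicit (`dAct_twist`), and with an explicit u the determinant is positive
(`hasSign_twist`).

The Alexander polynomial divides a minor whose value at ω is (1-ω₀)ω₀ ∑_{k<ℓ} (ω₀ω₁)^k. The
hypothesis says that ω₀ω₁ is not a nontrivial ℓ-th root of unity at the four points in question. -/

noncomputable section

namespace BenardConway

section

/-! ### The sign of a torsion -/

section Torsion

variable {E : Type*} [AddCommGroup E] [Module ℝ E]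

/-- The determinant of a unipotent map `1 + N` with `N ^ 2 = 0` is positive. -/
theorem det_id_add_pos [FiniteDimensional ℝ E] (N : E →ₗ[ℝ] E) (hN : N ∘ₗ N = 0) :
    0 < LinearMap.det (LinearMap.id + N) := by
  have hN' : ∀ x, N (N x) = 0 := fun x => LinearMap.congr_fun hN x
  -- Since N² = 0, the map 1 + N is the square of 1 + N/2, so its determinant is nonnegative; the
  -- inverse 1 - N makes it nonzero.
  have h1 : LinearMap.id + N =
      (LinearMap.id + (2⁻¹ : ℝ) • N) ∘ₗ (LinearMap.id + (2⁻¹ : ℝ) • N) := by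
    ext x
    simp [hN']
    rw [add_assoc, ← add_smul]; norm_num
  have h2 : (LinearMap.id - N) ∘ₗ (LinearMap.id + N) = LinearMap.id := by
    ext x
    simp [hN']
  have h3 : LinearMap.det (LinearMap.id + N) ≠ 0 := by
    intro h
    have := congrArg LinearMap.det h2
    rw [LinearMap.det_comp, h, mul_zero, LinearMap.det_id] at this
    exact zero_ne_one this
  have h4 : 0 ≤ LinearMap.det (LinearMap.id + N) := by
    rw [h1, LinearMap.det_comp]; exact mul_self_nonneg _
  exact lt_of_le_of_ne h4 h3.symm

/-- The sign of the torsion of the complex `0 → ℝ³ → E → E → ℝ³ → 0` with the maps `v`, `A`, `D`. -/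
def HasTorsionSign (v : (Fin 3 → ℝ) →ₗ[ℝ] E) (D : E →ₗ[ℝ] (Fin 3 → ℝ)) (A : E →ₗ[ℝ] E)
    (ε : SignType) : Prop :=
  ∃ (L : E →ₗ[ℝ] (Fin 3 → ℝ)) (u : (Fin 3 → ℝ) →ₗ[ℝ] E),
    L ∘ₗ v = LinearMap.id ∧ D ∘ₗ u = LinearMap.id ∧
      SignType.sign (LinearMap.det (A + u ∘ₗ L)) = ε

variable {v : (Fin 3 → ℝ) →ₗ[ℝ] E} {D : E →ₗ[ℝ] (Fin 3 → ℝ)} {A : E →ₗ[ℝ] E}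

/-- The relations give A + u'L' = (1 + (u'-u)D)(A + uL)(1 + v(L'-L)), and both outer factors are
unipotent, hence of positive determinant. -/
theorem HasTorsionSign.unique [FiniteDimensional ℝ E] {ε ε' : SignType} (hv : A ∘ₗ v = 0)
    (hD : D ∘ₗ A = 0) (h : HasTorsionSign v D A ε) (h' : HasTorsionSign v D A ε') : ε = ε' := by
  obtain ⟨L, u, hL, hu, rfl⟩ := h
  obtain ⟨L', u', hL', hu', rfl⟩ := h'
  have hv' : ∀ y, A (v y) = 0 := fun x => LinearMap.congr_fun hv x
  have hD' : ∀ y, D (A y) = 0 := fun x => LinearMap.congr_fun hD x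
  have hL1 : ∀ y, L (v y) = y := fun x => LinearMap.congr_fun hL x
  have hL2 : ∀ y, L' (v y) = y := fun x => LinearMap.congr_fun hL' x
  have hu1 : ∀ y, D (u y) = y := fun x => LinearMap.congr_fun hu x
  have hu2 : ∀ y, D (u' y) = y := fun x => LinearMap.congr_fun hu' x
  have p1 := det_id_add_pos (v ∘ₗ (L' - L)) (by ext x; simp [hL1, hL2])
  have p2 := det_id_add_pos ((u' - u) ∘ₗ D) (by ext x; simp [hu1, hu2])
  have key : A + u' ∘ₗ L' =
      (LinearMap.id + (u' - u) ∘ₗ D) ∘ₗ (A + u ∘ₗ L) ∘ₗ (LinearMap.id + v ∘ₗ (L' - L)) := by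
    ext x
    simp [hL1, hv', hD', hu1]
  rw [key, LinearMap.det_comp, LinearMap.det_comp, sign_mul, sign_mul, sign_pos p1, sign_pos p2]
  simp

theorem exists_hasTorsionSign (A : E →ₗ[ℝ] E) (hv : Function.Injective v)
    (hD : Function.Surjective D) : ∃ ε, HasTorsionSign v D A ε := by
  obtain ⟨L, hL⟩ := v.exists_leftInverse_of_injective (LinearMap.ker_eq_bot.2 hv)
  obtain ⟨u, hu⟩ := D.exists_rightInverse_of_surjective (LinearMap.range_eq_top.2 hD)
  exact ⟨_, L, u, hL, hu, rfl⟩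

/-- When A + uL is invertible, z = Ax + uLx for some x. Applying D leaves Lx = Dz = 0, so z = Ax. -/
theorem HasTorsionSign.exact [FiniteDimensional ℝ E] {ε : SignType} (h : HasTorsionSign v D A ε)
    (hε : ε ≠ 0) (hD : D ∘ₗ A = 0) {z : E} (hz : D z = 0) : ∃ x, A x = z := by
  obtain ⟨L, u, hL, hu, rfl⟩ := h
  have hu1 : ∀ y, D (u y) = y := fun x => LinearMap.congr_fun hu x
  have hD' : ∀ y, D (A y) = 0 := fun x => LinearMap.congr_fun hD x
  have hdet : LinearMap.det (A + u ∘ₗ L) ≠ 0 := fun h0 => hε (by rw [h0, sign_zero])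
  have hs : Function.Surjective (A + u ∘ₗ L) :=
    (LinearMap.equivOfDetNeZero _ hdet).surjective
  obtain ⟨x, rfl⟩ := hs z
  refine ⟨x, ?_⟩
  have : L x = 0 := by simpa [hu1, hD'] using hz
  simp [this]

theorem HasTorsionSign.congr {E' : Type*} [AddCommGroup E'] [Module ℝ E'] (e : E ≃ₗ[ℝ] E')
    {v' : (Fin 3 → ℝ) →ₗ[ℝ] E'} {D' : E' →ₗ[ℝ] (Fin 3 → ℝ)} {A' : E' →ₗ[ℝ] E'}
    (hv : ∀ y, v' y = e (v y)) (hD : ∀ x, D' (e x) = D x) (hA : ∀ x, A' (e x) = e (A x))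
    {ε : SignType} (h : HasTorsionSign v D A ε) : HasTorsionSign v' D' A' ε := by
  obtain ⟨L, u, hL, hu, rfl⟩ := h
  refine ⟨L ∘ₗ e.symm, e ∘ₗ u, ?_, ?_, ?_⟩
  · refine LinearMap.ext fun y => ?_
    simpa [hv] using LinearMap.congr_fun hL y
  · refine LinearMap.ext fun y => ?_
    simpa [hD] using LinearMap.congr_fun hu y
  · rw [← LinearMap.det_conj (A + u ∘ₗ L) e]
    congr 2
    ext x
    simp [← hA]

/-- A triangular map on a product. -/
theorem sign_det_triangular [FiniteDimensional ℝ E] {C : Type*} [AddCommGroup C] [Module ℝ C]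
    [FiniteDimensional ℝ C] (φ : E →ₗ[ℝ] E) (f : C →ₗ[ℝ] E) (κ : C →ₗ[ℝ] C)
    (hκ : 0 < LinearMap.det κ) (Φ : E × C →ₗ[ℝ] E × C)
    (hΦ : ∀ a c, Φ (a, c) = (φ a + f c, κ c)) :
    SignType.sign (LinearMap.det Φ) = SignType.sign (LinearMap.det φ) := by
  have p1 := det_id_add_pos (LinearMap.inl ℝ E C ∘ₗ f ∘ₗ LinearMap.snd ℝ E C) (by ext x <;> simp)
  have key : Φ = (LinearMap.prodMap LinearMap.id κ) ∘ₗ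
      (LinearMap.id + LinearMap.inl ℝ E C ∘ₗ f ∘ₗ LinearMap.snd ℝ E C) ∘ₗ
      (LinearMap.prodMap φ LinearMap.id) := by
    apply LinearMap.ext
    rintro ⟨a, c⟩
    simp [hΦ]
  rw [key, LinearMap.det_comp, LinearMap.det_comp, LinearMap.det_prodMap, LinearMap.det_prodMap,
    sign_mul, sign_mul, sign_mul, sign_mul, sign_pos p1, sign_pos hκ]
  simp

/-- The shear (a, c) ↦ (a, c + lst a) is unipotent and turns A' into a block triangular map with
blocks A and κ. The choices of L and u extend through the first factor alone, so only the block of A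
changes to A + uL. -/
theorem HasTorsionSign.stabilize [FiniteDimensional ℝ E] {E' C : Type*} [AddCommGroup E']
    [Module ℝ E'] [AddCommGroup C] [Module ℝ C] [FiniteDimensional ℝ C] (e : E' ≃ₗ[ℝ] E × C)
    {v' : (Fin 3 → ℝ) →ₗ[ℝ] E'} {D' : E' →ₗ[ℝ] (Fin 3 → ℝ)} {A' : E' →ₗ[ℝ] E'}
    (lst : E →ₗ[ℝ] C) (f : C →ₗ[ℝ] E) (κ : C →ₗ[ℝ] C) (hκ : 0 < LinearMap.det κ)
    (hv : ∀ y, (e (v' y)).1 = v y) (hD : ∀ a, D' (e.symm (a, 0)) = D a)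
    (hA : ∀ a c, e (A' (e.symm (a, c + lst a))) = (A a + f c, κ c))
    {ε : SignType} (h : HasTorsionSign v D A ε) : HasTorsionSign v' D' A' ε := by
  obtain ⟨L, u, hL, hu, rfl⟩ := h
  have hL1 : ∀ y, L (v y) = y := fun x => LinearMap.congr_fun hL x
  have hu1 : ∀ y, D (u y) = y := fun x => LinearMap.congr_fun hu x
  refine ⟨L ∘ₗ LinearMap.fst ℝ E C ∘ₗ e, e.symm ∘ₗ LinearMap.inl ℝ E C ∘ₗ u, ?_, ?_, ?_⟩
  · exact LinearMap.ext fun y => by simp [hv, hL1]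
  · exact LinearMap.ext fun y => by simp [hD, hu1]
  · have p1 := det_id_add_pos (LinearMap.inr ℝ E C ∘ₗ lst ∘ₗ LinearMap.fst ℝ E C)
      (by ext x <;> simp)
    rw [← LinearMap.det_conj _ e]
    rw [← sign_det_triangular (A + u ∘ₗ L) f κ hκ _ (fun a c => rfl
      : ∀ a c, (LinearMap.prod ((A + u ∘ₗ L) ∘ₗ LinearMap.fst ℝ E C + f ∘ₗ LinearMap.snd ℝ E C)
        (κ ∘ₗ LinearMap.snd ℝ E C)) (a, c) = ((A + u ∘ₗ L) a + f c, κ c))]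
    rw [← mul_one (SignType.sign _), ← sign_pos p1, ← sign_mul, ← LinearMap.det_comp]
    congr 2
    apply LinearMap.ext
    rintro ⟨a, c⟩
    have := hA a c
    simp only [LinearMap.comp_apply, LinearMap.add_apply, LinearMap.id_apply, LinearMap.fst_apply,
      LinearMap.inr_apply, LinearEquiv.coe_coe, map_add, Prod.mk_add_mk, add_zero,
      LinearEquiv.apply_symm_apply, this, LinearMap.inl_apply, LinearMap.prod_apply]
    ext <;> simp; abel

end Torsion

/-! ### The determinant in the definition of the sign of an intersection -/

/-- Two Schur complements eliminate the unit blocks coming from (a, a) and (v, v). What remains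
records the difference of the two components of each pair, and the sign comes from a block -1 of
size κ. -/
theorem det_intersection_matrix {ι κ : Type*} [Fintype ι] [DecidableEq ι] [Fintype κ]
    [DecidableEq κ] (P P' : Matrix ι ι ℝ) (Q Q' : Matrix κ ι ℝ) (S : Matrix κ κ ℝ)
    (R : Matrix ι κ ℝ) :
    (Matrix.fromBlocks (Matrix.fromBlocks P 0 Q 1) (Matrix.fromBlocks 0 1 1 0)
      (Matrix.fromBlocks Q' 1 P' 0) (Matrix.fromBlocks S 0 R 1)).det =
    (-1) ^ Fintype.card κ * (Matrix.fromBlocks (P - P') (-R) (Q - Q') (1 - S)).det := by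
  -- The two pivots are placed at the ends. Rows and columns are permuted alike, so the determinant
  -- is unchanged.
  let e : κ ⊕ ((ι ⊕ κ) ⊕ ι) ≃ (ι ⊕ κ) ⊕ (κ ⊕ ι) :=
    { toFun := Sum.elim (fun i => .inl (.inr i)) (Sum.elim (Sum.elim (fun k => .inl (.inl k))
        (fun i => .inr (.inl i))) (fun k => .inr (.inr k)))
      invFun := Sum.elim (Sum.elim (fun k => .inr (.inl (.inl k))) (fun i => .inl i))
        (Sum.elim (fun i => .inr (.inl (.inr i))) (fun k => .inr (.inr k)))
      left_inv := by rintro (i | (k | i) | k) <;> rfl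
      right_inv := by rintro ((k | i) | (i | k)) <;> rfl }
  rw [← Matrix.det_submatrix_equiv_self e]
  have h1 : (Matrix.fromBlocks (Matrix.fromBlocks P 0 Q 1) (Matrix.fromBlocks 0 1 1 0)
      (Matrix.fromBlocks Q' 1 P' 0) (Matrix.fromBlocks S 0 R 1)).submatrix e e =
      Matrix.fromBlocks (1 : Matrix κ κ ℝ) (Matrix.fromCols (Matrix.fromCols Q 1) 0)
        (Matrix.fromRows (Matrix.fromRows 0 1) 0)
        (Matrix.fromBlocks (Matrix.fromBlocks P 0 Q' S) (Matrix.fromRows 1 0)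
          (Matrix.fromCols P' R) 1) := by
    ext (i | (k | i) | k) (j | (l | j) | l) <;> simp [e]
  rw [h1, Matrix.det_fromBlocks_one₁₁]
  have h2 : Matrix.fromBlocks (Matrix.fromBlocks P 0 Q' S) (Matrix.fromRows 1 0)
          (Matrix.fromCols P' R) 1 - Matrix.fromRows (Matrix.fromRows (0 : Matrix ι κ ℝ) 1) 0 *
            (Matrix.fromCols (Matrix.fromCols Q (1 : Matrix κ κ ℝ)) (0 : Matrix κ ι ℝ)) =
      Matrix.fromBlocks (Matrix.fromBlocks P 0 (Q' - Q) (S - 1)) (Matrix.fromRows 1 0)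
          (Matrix.fromCols P' R) (1 : Matrix ι ι ℝ) := by
    rw [Matrix.fromRows_mul, Matrix.fromRows_mul]
    ext ((k | i) | k) ((l | j) | l) <;> simp
  rw [h2, Matrix.det_fromBlocks_one₂₂]
  have h3 : Matrix.fromBlocks P 0 (Q' - Q) (S - 1) -
      (Matrix.fromRows 1 0 : Matrix (ι ⊕ κ) ι ℝ) * Matrix.fromCols P' R =
      Matrix.fromBlocks 1 0 0 (-1) * Matrix.fromBlocks (P - P') (-R) (Q - Q') (1 - S) := by
    rw [Matrix.fromRows_mul, Matrix.fromBlocks_multiply]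
    ext (k | i) (l | j) <;> simp
  rw [h3, Matrix.det_mul, Matrix.det_fromBlocks_zero₂₁, Matrix.det_neg]
  simp

end

section

/-! ### Quaternions -/

theorem re_mul_comm (a b : ℍ[ℝ]) : (a * b).re = (b * a).re := by
  simp only [Quaternion.re_mul]; ring

theorem re_conj {g : ℍ[ℝ]} (hg : g ≠ 0) (q : ℍ[ℝ]) : (g * q * g⁻¹).re = q.re := by
  rw [re_mul_comm, ← mul_assoc, inv_mul_cancel₀ hg, one_mul]

theorem SU2.star_eq_inv (x : SU2) : star (x : ℍ[ℝ]) = (x : ℍ[ℝ])⁻¹ :=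
  eq_inv_of_mul_eq_one_left (Unitary.coe_star_mul_self x)

theorem SU2.ne_zero (x : SU2) : (x : ℍ[ℝ]) ≠ 0 := by
  intro h
  have := Unitary.coe_star_mul_self x
  rw [h, mul_zero] at this
  exact zero_ne_one this

theorem SU2.coe_inv (x : SU2) : ((x⁻¹ : SU2) : ℍ[ℝ]) = (x : ℍ[ℝ])⁻¹ := by
  rw [← SU2.star_eq_inv]; rfl

/-- A unit quaternion as a unit of the ring of quaternions. -/
def SU2.toUnits : SU2 →* ℍ[ℝ]ˣ where
  toFun x := Units.mk0 x (SU2.ne_zero x)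
  map_one' := by ext1; rfl
  map_mul' x y := by ext1; rfl

theorem coe_toUnit {q : ℍ[ℝ]} (hq : q ≠ 0) : (toUnit q : ℍ[ℝ]) = q := by simp [toUnit, hq]

theorem toUnit_coe (u : ℍ[ℝ]ˣ) : toUnit (u : ℍ[ℝ]) = u := by
  ext1; exact coe_toUnit u.ne_zero

theorem toUnit_coe_SU2 (x : SU2) : toUnit (x : ℍ[ℝ]) = SU2.toUnits x := by
  ext1; exact coe_toUnit x.ne_zero

/-! ### The braid group -/

theorem Braid.induction {n : ℕ} {p : Braid n → Prop} (one : p 1) (sigma : ∀ i, p (σ i))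
    (sigma_inv : ∀ i, p (σ i)⁻¹) (mul : ∀ β γ, p β → p γ → p (β * γ)) (β : Braid n) : p β := by
  obtain ⟨w, rfl⟩ := PresentedGroup.mk_surjective (braidRels n) β
  induction w using FreeGroup.induction_on with
  | C1 => simpa using one
  | of i => exact sigma i
  | inv_of i _ => rw [map_inv]; exact sigma_inv i
  | mul x y hx hy => rw [map_mul]; exact mul _ _ hx hy

theorem braidAct_sigma (G : Type*) [Group G] {n : ℕ} (i : Fin n) :
    braidAct G (σ i) = sigmaAct G i := by simp [braidAct, braidLift, σ]

theorem braidPerm_sigma {n : ℕ} (i : Fin n) :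
    braidPerm (σ i) = Equiv.swap i.castSucc i.succ := by simp [braidPerm, braidLift, σ]

theorem addStrand_sigma {n : ℕ} (i : Fin n) : addStrand (σ i) = σ i.castSucc := by
  simp [addStrand, braidLift, σ]

variable {G H : Type*} [Group G] [Group H] {n : ℕ}

theorem sigmaAct_apply (i : Fin n) (X : Fin (n + 1) → G) (j : Fin (n + 1)) :
    sigmaAct G i X j = if j = i.castSucc then X i.castSucc * X i.succ * (X i.castSucc)⁻¹
      else if j = i.succ then X i.castSucc else X j := rfl

theorem sigmaAct_inv_apply (i : Fin n) (X : Fin (n + 1) → G) (j : Fin (n + 1)) :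
    (sigmaAct G i)⁻¹ X j = if j = i.castSucc then X i.succ
      else if j = i.succ then (X i.succ)⁻¹ * X i.castSucc * X i.succ else X j := rfl

theorem braidAct_mul_apply (β γ : Braid n) (X : Fin (n + 1) → G) :
    braidAct G (β * γ) X = braidAct G β (braidAct G γ X) := by rw [map_mul]; rfl

theorem braidAct_map (f : G →* H) (β : Braid n) :
    ∀ X : Fin (n + 1) → G, braidAct H β (f ∘ X) = f ∘ braidAct G β X := by
  induction β using Braid.induction with
  | one => simp
  | sigma i =>
    intro X; funext j
    simp only [braidAct_sigma, sigmaAct_apply, Function.comp]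
    split_ifs <;> simp
  | sigma_inv i =>
    intro X; funext j
    simp only [map_inv, braidAct_sigma, sigmaAct_inv_apply, Function.comp]
    split_ifs <;> simp
  | mul β γ hβ hγ => intro X; rw [braidAct_mul_apply, hγ, hβ, braidAct_mul_apply]

theorem braidAct_conj (g : G) (β : Braid n) (X : Fin (n + 1) → G) :
    braidAct G β (fun i => g * X i * g⁻¹) = fun i => g * braidAct G β X i * g⁻¹ :=
  braidAct_map (MulAut.conj g).toMonoidHom β X

/-- Each crossing moves entries by the underlying transposition and conjugates at most one of them.
Real parts and norms of entries are therefore only permuted, which is what the tangent spaces need.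
-/
theorem braidAct_isConj (β : Braid n) : ∀ (X : Fin (n + 1) → G) (j : Fin (n + 1)),
    ∃ g : G, braidAct G β X j = g * X ((braidPerm β)⁻¹ j) * g⁻¹ := by
  induction β using Braid.induction with
  | one => intro X j; exact ⟨1, by simp⟩
  | sigma i =>
    intro X j
    rw [braidAct_sigma, sigmaAct_apply, braidPerm_sigma, Equiv.swap_inv]
    split_ifs with h1 h2
    · exact ⟨X i.castSucc, by rw [h1, Equiv.swap_apply_left]⟩
    · exact ⟨1, by rw [h2, Equiv.swap_apply_right]; simp⟩
    · exact ⟨1, by rw [Equiv.swap_apply_of_ne_of_ne h1 h2]; simp⟩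
  | sigma_inv i =>
    intro X j
    rw [map_inv, map_inv, inv_inv, braidAct_sigma, sigmaAct_inv_apply, braidPerm_sigma]
    split_ifs with h1 h2
    · exact ⟨1, by rw [h1, Equiv.swap_apply_left]; simp⟩
    · exact ⟨(X i.succ)⁻¹, by rw [h2, Equiv.swap_apply_right]; simp⟩
    · exact ⟨1, by rw [Equiv.swap_apply_of_ne_of_ne h1 h2]; simp⟩
  | mul β γ hβ hγ =>
    intro X j
    obtain ⟨g, hg⟩ := hβ (braidAct G γ X) j
    obtain ⟨k, hk⟩ := hγ X ((braidPerm β)⁻¹ j)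
    refine ⟨g * k, ?_⟩
    rw [braidAct_mul_apply, hg, hk, map_mul, mul_inv_rev, Equiv.Perm.mul_apply]
    simp [mul_assoc]

theorem tupleProd_comp {M M' : Type*} [Monoid M] [Monoid M'] (f : M →* M') {N : ℕ}
    (X : Fin N → M) : tupleProd (f ∘ X) = f (tupleProd X) := by
  rw [tupleProd, tupleProd, map_list_prod, List.map_ofFn]

theorem tupleProd_succ {M : Type*} [Monoid M] {N : ℕ} (X : Fin (N + 1) → M) :
    tupleProd X = X 0 * tupleProd (fun i => X i.succ) := by
  simp [tupleProd, List.ofFn_succ]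

theorem tupleProd_castSucc {M : Type*} [Monoid M] {N : ℕ} (X : Fin (N + 1) → M) :
    tupleProd X = tupleProd (fun i => X i.castSucc) * X (Fin.last N) := by
  rw [tupleProd, List.ofFn_succ', List.concat_eq_append, List.prod_append, List.prod_singleton]
  rfl

/-- Only two adjacent factors change, and (xyx⁻¹)x = xy. The induction peels off the first entry
until the crossing is at the front. -/
theorem tupleProd_sigmaAct : ∀ {n : ℕ} (i : Fin n) (X : Fin (n + 1) → G),
    tupleProd (sigmaAct G i X) = tupleProd X := by
  intro n
  induction n with
  | zero => intro i; exact i.elim0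
  | succ n ih =>
    intro i X
    cases i using Fin.cases with
    | zero =>
      have h0 : (Fin.castSucc (0 : Fin (n + 1))) = 0 := rfl
      have h1 : ∀ j : Fin n, j.succ.succ ≠ Fin.succ (0 : Fin (n + 1)) := fun j h =>
        Fin.succ_ne_zero j (Fin.succ_injective _ h)
      rw [tupleProd_succ, tupleProd_succ, tupleProd_succ X, tupleProd_succ (fun i => X i.succ)]
      simp only [sigmaAct_apply, h0, if_true, Fin.succ_ne_zero, if_false, h1]
      group
    | succ i =>
      rw [tupleProd_succ, tupleProd_succ X, ← ih i (fun i => X i.succ)]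
      have h0 : (0 : Fin (n + 1 + 1)) ≠ i.succ.castSucc := by simp [Fin.ext_iff]
      have h1 : sigmaAct G i.succ X 0 = X 0 := by
        rw [sigmaAct_apply, if_neg h0, if_neg (Fin.succ_ne_zero _).symm]
      have h2 : (fun j : Fin (n + 1) => sigmaAct G i.succ X j.succ) =
          sigmaAct G i (fun i => X i.succ) := by
        funext j
        simp only [sigmaAct_apply, ← Fin.succ_castSucc, Fin.succ_inj]
      rw [h1, h2]

theorem tupleProd_braidAct (β : Braid n) :
    ∀ X : Fin (n + 1) → G, tupleProd (braidAct G β X) = tupleProd X := by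
  induction β using Braid.induction with
  | one => simp
  | sigma i => intro X; rw [braidAct_sigma, tupleProd_sigmaAct]
  | sigma_inv i =>
    intro X
    rw [map_inv, braidAct_sigma]
    rw [← tupleProd_sigmaAct i, ← Equiv.Perm.mul_apply, mul_inv_cancel, Equiv.Perm.one_apply]
  | mul β γ hβ hγ => intro X; rw [braidAct_mul_apply, hβ, hγ]

/-! ### The extended action -/

/-- The tuples of non-zero quaternions. -/
def nonzeroTuples (N : ℕ) : Set (Fin N → ℍ[ℝ]) := {x | ∀ i, x i ≠ 0}

theorem isOpen_nonzeroTuples (N : ℕ) : IsOpen (nonzeroTuples N) := by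
  rw [nonzeroTuples, Set.ofPred_forall]
  exact isOpen_iInter_of_finite fun i => isOpen_ne_fun (continuous_apply i) continuous_const

theorem toH_mem {N : ℕ} (X : Fin N → SU2) : toH X ∈ nonzeroTuples N := fun i => (X i).ne_zero

theorem nonzeroTuples_mem_nhds {N : ℕ} (X : Fin N → SU2) : nonzeroTuples N ∈ nhds (toH X) :=
  (isOpen_nonzeroTuples N).mem_nhds (toH_mem X)

theorem extAct_mem (β : Braid n) (x : Fin (n + 1) → ℍ[ℝ]) :
    extAct β x ∈ nonzeroTuples (n + 1) := fun _ => Units.ne_zero _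

theorem extAct_toH (β : Braid n) (X : Fin (n + 1) → SU2) :
    extAct β (toH X) = toH (braidAct SU2 β X) := by
  funext j
  simp only [extAct, toH, toUnit_coe_SU2]
  have := congrFun (braidAct_map SU2.toUnits β X) j
  exact (congrArg Units.val this)

theorem extAct_one {x : Fin (n + 1) → ℍ[ℝ]} (hx : x ∈ nonzeroTuples (n + 1)) :
    extAct 1 x = x := by
  funext j; simp [extAct, coe_toUnit (hx j)]

theorem extAct_mul (β γ : Braid n) (x : Fin (n + 1) → ℍ[ℝ]) :
    extAct (β * γ) x = extAct β (extAct γ x) := by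
  funext j
  simp only [extAct, braidAct_mul_apply, toUnit_coe]

theorem extAct_sigma (i : Fin n) {x : Fin (n + 1) → ℍ[ℝ]} (hx : x ∈ nonzeroTuples (n + 1))
    (j : Fin (n + 1)) :
    extAct (σ i) x j = if j = i.castSucc then x i.castSucc * x i.succ * (x i.castSucc)⁻¹
      else if j = i.succ then x i.castSucc else x j := by
  simp only [extAct, braidAct_sigma, sigmaAct_apply]
  split_ifs <;> simp [coe_toUnit (hx _)]

theorem extAct_sigma_inv (i : Fin n) {x : Fin (n + 1) → ℍ[ℝ]} (hx : x ∈ nonzeroTuples (n + 1))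
    (j : Fin (n + 1)) :
    extAct (σ i)⁻¹ x j = if j = i.castSucc then x i.succ
      else if j = i.succ then (x i.succ)⁻¹ * x i.castSucc * x i.succ else x j := by
  simp only [extAct, map_inv, braidAct_sigma, sigmaAct_inv_apply]
  split_ifs <;> simp [coe_toUnit (hx _)]

theorem differentiableAt_extAct (β : Braid n) : ∀ x ∈ nonzeroTuples (n + 1),
    DifferentiableAt ℝ (extAct β) x := by
  induction β using Braid.induction with
  | one =>
    intro x hx
    refine differentiableAt_id.congr_of_eventuallyEq ?_
    filter_upwards [(isOpen_nonzeroTuples _).mem_nhds hx] with y hy using extAct_one hy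
  | sigma i =>
    intro x hx
    rw [differentiableAt_pi]
    intro j
    have : DifferentiableAt ℝ (fun x : Fin (n + 1) → ℍ[ℝ] =>
      if j = i.castSucc then x i.castSucc * x i.succ * (x i.castSucc)⁻¹
        else if j = i.succ then x i.castSucc else x j) x := by
      have h := hx i.castSucc
      split_ifs <;> fun_prop (disch := assumption)
    refine this.congr_of_eventuallyEq ?_
    filter_upwards [(isOpen_nonzeroTuples _).mem_nhds hx] with y hy using extAct_sigma i hy j
  | sigma_inv i =>
    intro x hx
    rw [differentiableAt_pi]
    intro j
    have : DifferentiableAt ℝ (fun x : Fin (n + 1) → ℍ[ℝ] =>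
      if j = i.castSucc then x i.succ
        else if j = i.succ then (x i.succ)⁻¹ * x i.castSucc * x i.succ else x j) x := by
      have h := hx i.succ
      split_ifs <;> fun_prop (disch := assumption)
    refine this.congr_of_eventuallyEq ?_
    filter_upwards [(isOpen_nonzeroTuples _).mem_nhds hx] with y hy using extAct_sigma_inv i hy j
  | mul β γ hβ hγ =>
    intro x hx
    have : extAct (β * γ) = extAct β ∘ extAct γ := funext fun x => extAct_mul β γ x
    rw [this]
    exact (hβ _ (extAct_mem γ x)).comp x (hγ x hx)

theorem hasFDerivAt_extAct (β : Braid n) (X : Fin (n + 1) → SU2) :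
    HasFDerivAt (extAct β) (dAct β X) (toH X) :=
  (differentiableAt_extAct β _ (toH_mem X)).hasFDerivAt

theorem dAct_mul (β γ : Braid n) (X : Fin (n + 1) → SU2) (a : Fin (n + 1) → ℍ[ℝ]) :
    dAct (β * γ) X a = dAct β (braidAct SU2 γ X) (dAct γ X a) := by
  have h2 : HasFDerivAt (extAct β) (dAct β (braidAct SU2 γ X)) (extAct γ (toH X)) := by
    rw [extAct_toH]; exact hasFDerivAt_extAct _ _
  have h1 := h2.comp (toH X) (hasFDerivAt_extAct γ X)
  have : extAct (β * γ) = extAct β ∘ extAct γ := funext fun x => extAct_mul β γ x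
  rw [← this] at h1
  exact DFunLike.congr_fun ((hasFDerivAt_extAct _ X).unique h1) a

theorem dAct_one (X : Fin (n + 1) → SU2) (a : Fin (n + 1) → ℍ[ℝ]) : dAct 1 X a = a := by
  have h : HasFDerivAt (extAct (1 : Braid n)) (ContinuousLinearMap.id ℝ _) (toH X) := by
    refine (hasFDerivAt_id _).congr_of_eventuallyEq ?_
    filter_upwards [nonzeroTuples_mem_nhds X] with y hy using extAct_one hy
  exact DFunLike.congr_fun ((hasFDerivAt_extAct _ X).unique h) a

theorem extAct_isConj (β : Braid n) {x : Fin (n + 1) → ℍ[ℝ]} (hx : x ∈ nonzeroTuples (n + 1))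
    (j : Fin (n + 1)) :
    ∃ g : ℍ[ℝ], g ≠ 0 ∧ extAct β x j = g * x ((braidPerm β)⁻¹ j) * g⁻¹ := by
  obtain ⟨g, hg⟩ := braidAct_isConj β (fun i => toUnit (x i)) j
  refine ⟨g, g.ne_zero, ?_⟩
  rw [extAct, hg]
  simp [coe_toUnit (hx _)]

theorem extAct_re (β : Braid n) {x : Fin (n + 1) → ℍ[ℝ]} (hx : x ∈ nonzeroTuples (n + 1))
    (j : Fin (n + 1)) : (extAct β x j).re = (x ((braidPerm β)⁻¹ j)).re := by
  obtain ⟨g, h0, hg⟩ := extAct_isConj β hx j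
  rw [hg, re_conj h0]

theorem extAct_norm (β : Braid n) {x : Fin (n + 1) → ℍ[ℝ]} (hx : x ∈ nonzeroTuples (n + 1))
    (j : Fin (n + 1)) : ‖extAct β x j‖ = ‖x ((braidPerm β)⁻¹ j)‖ := by
  obtain ⟨g, h0, hg⟩ := extAct_isConj β hx j
  rw [hg, norm_mul, norm_mul, norm_inv, mul_right_comm, mul_inv_cancel₀ (norm_ne_zero_iff.2 h0),
    one_mul]

/-- The real part as a continuous linear map. -/
def reCLM : ℍ[ℝ] →L[ℝ] ℝ :=
  LinearMap.toContinuousLinearMap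
    { toFun := fun q => q.re, map_add' := fun _ _ => rfl, map_smul' := fun _ _ => rfl }

theorem dAct_re (β : Braid n) (X : Fin (n + 1) → SU2) (a : Fin (n + 1) → ℍ[ℝ])
    (j : Fin (n + 1)) : (dAct β X a j).re = (a ((braidPerm β)⁻¹ j)).re := by
  have h1 := reCLM.hasFDerivAt.comp (toH X) ((hasFDerivAt_pi'.1 (hasFDerivAt_extAct β X)) j)
  have h2 : HasFDerivAt (fun x : Fin (n + 1) → ℍ[ℝ] => reCLM (x ((braidPerm β)⁻¹ j)))
      (reCLM ∘L ContinuousLinearMap.proj ((braidPerm β)⁻¹ j)) (toH X) :=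
    reCLM.hasFDerivAt.comp (toH X) (hasFDerivAt_apply (𝕜 := ℝ) ((braidPerm β)⁻¹ j) (toH X))
  have h3 := h2.congr_of_eventuallyEq (f₁ := reCLM ∘ fun x => extAct β x j) (by
    filter_upwards [nonzeroTuples_mem_nhds X] with y hy using extAct_re β hy j)
  exact DFunLike.congr_fun (h1.unique h3) a

/-- This is the derivative of the invariance of the squared norm. Together with `dAct_re` it shows
that the derivative of the action preserves the tangent spaces of the spheres. -/
theorem dAct_re_mul_star (β : Braid n) (X : Fin (n + 1) → SU2) (a : Fin (n + 1) → ℍ[ℝ])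
    (j : Fin (n + 1)) : (dAct β X a j * star (braidAct SU2 β X j : ℍ[ℝ])).re =
      (a ((braidPerm β)⁻¹ j) * star (X ((braidPerm β)⁻¹ j) : ℍ[ℝ])).re := by
  have h1 := ((hasFDerivAt_pi'.1 (hasFDerivAt_extAct β X)) j).norm_sq
  have h2 := (hasFDerivAt_apply (𝕜 := ℝ) ((braidPerm β)⁻¹ j) (toH X)).norm_sq
  have h3 := h2.congr_of_eventuallyEq (f₁ := fun x => ‖extAct β x j‖ ^ 2) (by
    filter_upwards [nonzeroTuples_mem_nhds X] with y hy
    rw [extAct_norm β hy j])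
  have h4 := DFunLike.congr_fun (h1.unique h3) a
  simp only [extAct_toH] at h4
  have h5 : 2 * inner ℝ (toH (braidAct SU2 β X) j) (dAct β X a j) =
    2 * inner ℝ (toH X ((braidPerm β)⁻¹ j)) (a ((braidPerm β)⁻¹ j)) := by
    simpa using h4
  rw [real_inner_comm, real_inner_comm (a _)] at h5
  simp only [Quaternion.inner_def, toH] at h5
  linarith

theorem extAct_conj (β : Braid n) {g : ℍ[ℝ]} (hg : g ≠ 0) {x : Fin (n + 1) → ℍ[ℝ]}
    (hx : x ∈ nonzeroTuples (n + 1)) :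
    extAct β (fun i => g * x i * g⁻¹) = fun i => g * extAct β x i * g⁻¹ := by
  funext j
  have h : (fun i => toUnit (g * x i * g⁻¹)) =
      fun i => toUnit g * toUnit (x i) * (toUnit g)⁻¹ := by
    funext i
    ext1
    rw [coe_toUnit (mul_ne_zero (mul_ne_zero hg (hx i)) (inv_ne_zero hg))]
    simp [coe_toUnit hg, coe_toUnit (hx i)]
  rw [extAct, h, braidAct_conj]
  simp [coe_toUnit hg, extAct]

/-- Conjugation ignores the norm of the conjugating quaternion, so the affine curve 1 + te can stand
for exp(te). -/
theorem hasDerivAt_conj_curve (e q : ℍ[ℝ]) :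
    HasDerivAt (fun t : ℝ => (1 + t • e) * q * (1 + t • e)⁻¹) (e * q - q * e) 0 := by
  have h1 : HasDerivAt (fun t : ℝ => 1 + t • e) e 0 := by
    simpa using ((hasDerivAt_id (0 : ℝ)).smul_const e).const_add 1
  have h2 : HasDerivAt (fun t : ℝ => (1 + t • e)⁻¹) (-e) 0 := by
    have h := (hasFDerivAt_inv' (𝕜 := ℝ) (R := ℍ[ℝ]) (x := 1 + (0 : ℝ) • e)
      (by simp)).comp_hasDerivAt 0 h1
    exact h.congr_deriv (by simp)
  exact ((h1.mul_const q).mul h2).congr_deriv (by simp [sub_eq_add_neg])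

/-- The braid action commutes with conjugation; differentiate this along the curve 1 + te, which is
nonzero for small t. -/
theorem dAct_orbitVec (β : Braid n) (X : Fin (n + 1) → SU2) (e : ℍ[ℝ]) :
    dAct β X (orbitVec X e) = orbitVec (braidAct SU2 β X) e := by
  have h1 : ∀ Y : Fin (n + 1) → SU2, HasDerivAt
      (fun t : ℝ => fun i => (1 + t • e) * toH Y i * (1 + t • e)⁻¹) (orbitVec Y e) 0 := fun Y =>
    hasDerivAt_pi.2 fun i => hasDerivAt_conj_curve e (Y i)
  have h2 : HasFDerivAt (extAct β) (dAct β X)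
      (fun i => (1 + (0 : ℝ) • e) * toH X i * (1 + (0 : ℝ) • e)⁻¹) := by
    simpa using hasFDerivAt_extAct β X
  have h3 := h2.comp_hasDerivAt 0 (h1 X)
  have h4 := (h1 (braidAct SU2 β X)).congr_of_eventuallyEq (f₁ := extAct β ∘ fun t : ℝ =>
      fun i => (1 + t • e) * toH X i * (1 + t • e)⁻¹) (by
    have : ∀ᶠ t : ℝ in nhds 0, 1 + t • e ≠ 0 :=
      ContinuousAt.eventually_ne (by fun_prop) (by simp)
    filter_upwards [this] with t ht
    simp only [Function.comp]
    rw [extAct_conj β ht (toH_mem X), extAct_toH])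
  exact h3.unique h4

theorem tupleProd_extAct (β : Braid n) {x : Fin (n + 1) → ℍ[ℝ]}
    (hx : x ∈ nonzeroTuples (n + 1)) : tupleProd (extAct β x) = tupleProd x := by
  have h1 : tupleProd (extAct β x) =
      Units.coeHom _ (tupleProd (braidAct ℍ[ℝ]ˣ β fun i => toUnit (x i))) :=
    tupleProd_comp (Units.coeHom ℍ[ℝ]) _
  rw [h1, tupleProd_braidAct, ← tupleProd_comp]
  congr 1
  funext i
  exact coe_toUnit (hx i)

/-! ### The derivative of the product -/

theorem differentiable_tupleProd : ∀ (N : ℕ),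
    Differentiable ℝ (tupleProd : (Fin N → ℍ[ℝ]) → ℍ[ℝ])
  | 0 => by
    have : (tupleProd : (Fin 0 → ℍ[ℝ]) → ℍ[ℝ]) = fun _ => 1 := funext fun X => by simp [tupleProd]
    rw [this]
    exact differentiable_const 1
  | N + 1 => by
    have h := differentiable_tupleProd N
    have : (tupleProd : (Fin (N + 1) → ℍ[ℝ]) → ℍ[ℝ]) =
        fun X => X 0 * tupleProd (fun i => X i.succ) := funext tupleProd_succ
    rw [this]
    fun_prop

/-- The derivative of the product of the entries of a tuple. -/
def dProd {N : ℕ} (X : Fin N → SU2) : (Fin N → ℍ[ℝ]) →L[ℝ] ℍ[ℝ] := fderiv ℝ tupleProd (toH X)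

theorem hasFDerivAt_tupleProd {N : ℕ} (X : Fin N → SU2) :
    HasFDerivAt tupleProd (dProd X) (toH X) := (differentiable_tupleProd N _).hasFDerivAt

theorem tupleProd_toH {N : ℕ} (X : Fin N → SU2) : tupleProd (toH X) = ((tupleProd X : SU2) : ℍ[ℝ]) :=
  tupleProd_comp (unitary ℍ[ℝ]).subtype X

/-- At a diagonal point the derivative of the inverse contributes P⁻¹ dP P⁻¹ with the same product
P, so only the difference of the two components matters. -/
theorem dF_apply {N : ℕ} (X : Fin N → SU2) (p : (Fin N → ℍ[ℝ]) × (Fin N → ℍ[ℝ])) :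
    dF X p = (dProd X p.1 - dProd X p.2) * ((tupleProd X : SU2) : ℍ[ℝ])⁻¹ := by
  have h0 : (tupleProd (toH X) : ℍ[ℝ]) ≠ 0 := by rw [tupleProd_toH]; exact SU2.ne_zero _
  have h1 : HasFDerivAt (fun p : (Fin N → ℍ[ℝ]) × (Fin N → ℍ[ℝ]) => tupleProd p.1)
      (dProd X ∘L ContinuousLinearMap.fst ℝ _ _) (toH X, toH X) :=
    (hasFDerivAt_tupleProd X).comp (toH X, toH X) (f := Prod.fst) hasFDerivAt_fst
  have h2 : HasFDerivAt (fun p : (Fin N → ℍ[ℝ]) × (Fin N → ℍ[ℝ]) => tupleProd p.2)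
      (dProd X ∘L ContinuousLinearMap.snd ℝ _ _) (toH X, toH X) :=
    (hasFDerivAt_tupleProd X).comp (toH X, toH X) (f := Prod.snd) hasFDerivAt_snd
  have h3 := (hasFDerivAt_inv' (𝕜 := ℝ) h0).comp (toH X, toH X) h2
  have h4 := (h1.mul' h3).fderiv
  simp only [dF]
  erw [h4]
  simp only [tupleProd_toH] at h0
  simp [tupleProd_toH, sub_mul]
  rw [mul_assoc (_)⁻¹, mul_inv_cancel_left₀ h0, sub_eq_neg_add]

theorem dProd_dAct (β : Braid n) (X : Fin (n + 1) → SU2) (a : Fin (n + 1) → ℍ[ℝ]) :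
    dProd (braidAct SU2 β X) (dAct β X a) = dProd X a := by
  have h1 : HasFDerivAt tupleProd (dProd (braidAct SU2 β X)) (extAct β (toH X)) := by
    rw [extAct_toH]; exact hasFDerivAt_tupleProd _
  have h2 := h1.comp (toH X) (hasFDerivAt_extAct β X)
  have h3 := (hasFDerivAt_tupleProd X).congr_of_eventuallyEq (f₁ := tupleProd ∘ extAct β) (by
    filter_upwards [nonzeroTuples_mem_nhds X] with y hy using tupleProd_extAct β hy)
  exact DFunLike.congr_fun (h2.unique h3) a

end

section

/-! ### Imaginary quaternions -/

/-- The imaginary quaternion with given coordinates. -/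
def imag : (Fin 3 → ℝ) →ₗ[ℝ] ℍ[ℝ] where
  toFun y := ⟨0, y 0, y 1, y 2⟩
  map_add' y z := by ext <;> first | exact (add_zero (0 : ℝ)).symm | rfl
  map_smul' t y := by ext <;> first | exact (mul_zero t).symm | rfl

/-- The coordinates of the imaginary part of a quaternion. -/
def imCoords : ℍ[ℝ] →ₗ[ℝ] (Fin 3 → ℝ) where
  toFun q := ![q.imI, q.imJ, q.imK]
  map_add' y z := by ext i; fin_cases i <;> simp
  map_smul' t y := by ext i; fin_cases i <;> simp

@[simp] theorem imag_re (y : Fin 3 → ℝ) : (imag y).re = 0 := rfl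
@[simp] theorem imag_imI (y : Fin 3 → ℝ) : (imag y).imI = y 0 := rfl
@[simp] theorem imag_imJ (y : Fin 3 → ℝ) : (imag y).imJ = y 1 := rfl
@[simp] theorem imag_imK (y : Fin 3 → ℝ) : (imag y).imK = y 2 := rfl

@[simp] theorem imCoords_imag (y : Fin 3 → ℝ) : imCoords (imag y) = y := by
  ext i; fin_cases i <;> rfl

theorem imag_imCoords {q : ℍ[ℝ]} (hq : q.re = 0) : imag (imCoords q) = q := by
  ext
  · exact hq.symm
  all_goals rfl

theorem imag_single (k : Fin 3) : imag (Pi.single k 1) = imBasis k := by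
  fin_cases k <;> ext <;> simp [imBasis]

theorem imCoords_imBasis (k : Fin 3) : imCoords (imBasis k) = Pi.single k 1 := by
  rw [← imag_single, imCoords_imag]

theorem imag_injective : Function.Injective imag := fun y z h => by
  rw [← imCoords_imag y, h, imCoords_imag]

theorem inner_imag (η : Fin 3 → ℝ) (q : ℍ[ℝ]) :
    inner ℝ (imag η) q = ∑ k, η k * imCoords q k := by
  simp [Quaternion.inner_def, Fin.sum_univ_three, imCoords]

/-- The centralizer of a non-zero imaginary quaternion is commutative. -/
theorem commute_of_commute_imag {e : ℍ[ℝ]} (he : e.re = 0) (he0 : e ≠ 0) {x y : ℍ[ℝ]}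
    (hx : e * x = x * e) (hy : e * y = y * e) : x * y = y * x := by
  have x1 := congrArg (fun q => q.imI) hx
  have x2 := congrArg (fun q => q.imJ) hx
  have x3 := congrArg (fun q => q.imK) hx
  have y1 := congrArg (fun q => q.imI) hy
  have y2 := congrArg (fun q => q.imJ) hy
  have y3 := congrArg (fun q => q.imK) hy
  simp only [Quaternion.imI_mul, Quaternion.imJ_mul, Quaternion.imK_mul, he] at x1 x2 x3 y1 y2 y3
  have hcases : e.imI ≠ 0 ∨ e.imJ ≠ 0 ∨ e.imK ≠ 0 := by
    by_contra! h
    exact he0 (by ext; exacts [he, h.1, h.2.1, h.2.2])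
  -- The imaginary parts of x and y are both parallel to e, so their cross product vanishes. Each
  -- identity holds after multiplying twice by a nonzero coordinate of e.
  have key : x.imJ * y.imK = x.imK * y.imJ ∧ x.imK * y.imI = x.imI * y.imK ∧
      x.imI * y.imJ = x.imJ * y.imI := by
    rcases hcases with h | h | h
    all_goals
      refine ⟨?_, ?_, ?_⟩ <;> apply mul_left_cancel₀ h <;> apply mul_left_cancel₀ h <;> grind
  ext <;> simp only [Quaternion.re_mul, Quaternion.imI_mul, Quaternion.imJ_mul, Quaternion.imK_mul]
    <;> linarith [key.1, key.2.1, key.2.2]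

/-! ### The maps between tangent spaces -/

theorem commutator_tangent (x : SU2) (e : ℍ[ℝ]) :
    (e * x - x * e).re = 0 ∧ ((e * x - x * e) * star (x : ℍ[ℝ])).re = 0 := by
  constructor
  · rw [Quaternion.re_sub, re_mul_comm, sub_self]
  · rw [SU2.star_eq_inv, sub_mul, Quaternion.re_sub, re_conj x.ne_zero,
      mul_inv_cancel_right₀ x.ne_zero, sub_self]

theorem orbitVec_mem {N : ℕ} (X : Fin N → SU2) (e : ℍ[ℝ]) : orbitVec X e ∈ tangentR X :=
  fun i => commutator_tangent (X i) e

/-- The derivative of the orbit map. -/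
def orbitMap {N : ℕ} (X : Fin N → SU2) : (Fin 3 → ℝ) →ₗ[ℝ] tangentR X where
  toFun y := ⟨orbitVec X (imag y), orbitVec_mem X _⟩
  map_add' y z := by
    ext1; funext i
    simp only [orbitVec, map_add, Submodule.coe_add, Pi.add_apply]
    noncomm_ring
  map_smul' t y := by
    ext1; funext i
    simp [orbitVec, smul_sub]

theorem coe_orbitMap {N : ℕ} (X : Fin N → SU2) (y : Fin 3 → ℝ) :
    (orbitMap X y : Fin N → ℍ[ℝ]) = orbitVec X (imag y) := rfl

/-- The derivative of the product, translated to the unit element. -/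
def logProd {N : ℕ} (X : Fin N → SU2) (z : Fin N → ℍ[ℝ]) : ℍ[ℝ] :=
  dProd X z * ((tupleProd X : SU2) : ℍ[ℝ])⁻¹

/-- The derivative of the product on the tangent space, as a map to `ℝ³`. -/
def prodMap {N : ℕ} (X : Fin N → SU2) : tangentR X →ₗ[ℝ] (Fin 3 → ℝ) where
  toFun z := imCoords (logProd X z)
  map_add' y z := by simp [logProd, add_mul]
  map_smul' t y := by simp [logProd]

theorem prodMap_apply {N : ℕ} (X : Fin N → SU2) (z : tangentR X) :
    prodMap X z = imCoords (logProd X z) := rfl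

/-- The product rule for X₀ · (rest) after right translation: the contribution of the rest is
conjugated by X₀. Inductions on the length of the tuple rely on it. -/
theorem logProd_succ {N : ℕ} (X : Fin (N + 1) → SU2) (z : Fin (N + 1) → ℍ[ℝ]) :
    logProd X z = z 0 * (X 0 : ℍ[ℝ])⁻¹ +
      X 0 * logProd (fun i => X i.succ) (fun i => z i.succ) * (X 0 : ℍ[ℝ])⁻¹ := by
  have h0 : HasFDerivAt (fun x : Fin (N + 1) → ℍ[ℝ] => x 0)
      (ContinuousLinearMap.proj 0 : _ →L[ℝ] ℍ[ℝ]) (toH X) := hasFDerivAt_apply 0 _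
  have h1 : HasFDerivAt (fun x : Fin (N + 1) → ℍ[ℝ] => fun i : Fin N => x i.succ)
      (ContinuousLinearMap.pi fun i : Fin N =>
        (ContinuousLinearMap.proj i.succ : (Fin (N + 1) → ℍ[ℝ]) →L[ℝ] ℍ[ℝ])) (toH X) :=
    hasFDerivAt_pi.2 fun i => hasFDerivAt_apply i.succ _
  have h2 := (hasFDerivAt_tupleProd (fun i : Fin N => X i.succ)).comp (toH X) h1
  have h3 := h0.mul' h2
  have h4 : (tupleProd : (Fin (N + 1) → ℍ[ℝ]) → ℍ[ℝ]) =
    (fun x => x 0) * (tupleProd ∘ fun x => fun i : Fin N => x i.succ) := funext tupleProd_succ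
  rw [← h4] at h3
  have h5 : dProd X z = X 0 * dProd (fun i => X i.succ) (fun i => z i.succ) +
      z 0 * ((tupleProd (fun i => X i.succ) : SU2) : ℍ[ℝ]) := by
    rw [(hasFDerivAt_tupleProd X).unique h3, ← tupleProd_toH]
    rfl
  have h6 : ((tupleProd (fun i => X i.succ) : SU2) : ℍ[ℝ]) ≠ 0 := SU2.ne_zero _
  rw [logProd, h5, tupleProd_succ X]
  simp only [Submonoid.coe_mul, mul_inv_rev, logProd, add_mul]
  rw [add_comm, mul_assoc (z 0), mul_inv_cancel_left₀ h6]
  simp only [mul_assoc]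

theorem logProd_re : ∀ {N : ℕ} {X : Fin N → SU2} {z : Fin N → ℍ[ℝ]}, z ∈ tangentR X →
    (logProd X z).re = 0
  | 0, X, z, _ => by
    have : z = 0 := Subsingleton.elim _ _
    rw [this, logProd, map_zero, zero_mul, Quaternion.re_zero]
  | N + 1, X, z, hz => by
    rw [logProd_succ, Quaternion.re_add, re_conj (X 0).ne_zero,
      logProd_re (N := N) fun i => hz i.succ, ← SU2.star_eq_inv, (hz 0).2, add_zero]

theorem imag_prodMap {N : ℕ} (X : Fin N → SU2) (z : tangentR X) :
    imag (prodMap X z) = logProd X z := imag_imCoords (logProd_re z.2)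

theorem logProd_zero {N : ℕ} (X : Fin N → SU2) : logProd X 0 = 0 := by simp [logProd]

theorem inner_conj (x : SU2) (a b : ℍ[ℝ]) :
    inner ℝ a (x * b * (x : ℍ[ℝ])⁻¹) = inner ℝ ((x : ℍ[ℝ])⁻¹ * a * x) b := by
  simp only [Quaternion.inner_def, ← SU2.star_eq_inv, star_mul, star_star]
  have : a * (x * (star b * star (x : ℍ[ℝ]))) = a * x * star b * star (x : ℍ[ℝ]) := by
    simp only [mul_assoc]
  rw [this, re_mul_comm]
  simp only [mul_assoc]

/-- An imaginary quaternion orthogonal to the image of the derivative of the product commutes with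
all the entries. -/
theorem commute_of_orthogonal {η : ℍ[ℝ]} : ∀ {N : ℕ} {X : Fin N → SU2},
    (∀ z ∈ tangentR X, inner ℝ η (logProd X z) = 0) → ∀ i, η * X i = X i * η
  | 0, _, _, i => i.elim0
  | N + 1, X, h, i => by
    have hz : ∀ (a : ℍ[ℝ]) (b : Fin N → ℍ[ℝ]), (a.re = 0 ∧ (a * star (X 0 : ℍ[ℝ])).re = 0) →
        b ∈ tangentR (fun i => X i.succ) →
        (Fin.cons a b : Fin (N + 1) → ℍ[ℝ]) ∈ tangentR X := by
      intro a b ha hb i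
      cases i using Fin.cases with
      | zero => exact ha
      | succ i => exact hb i
    have h0 : η * X 0 = X 0 * η := by
      -- The orbit direction of η in the first entry maps to η - X₀ηX₀⁻¹. Orthogonality to η, with
      -- ηX₀η-conjugates of equal norm, forces η = X₀ηX₀⁻¹.
      have h1 := h _ (hz (η * X 0 - X 0 * η) 0 (commutator_tangent _ _) (Submodule.zero_mem _))
      rw [logProd_succ] at h1
      simp only [Fin.cons_zero, Fin.cons_succ] at h1
      have h2 : (fun i : Fin N => (0 : Fin N → ℍ[ℝ]) i) = 0 := rfl
      rw [h2, logProd_zero, mul_zero, zero_mul, add_zero, sub_mul, mul_assoc,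
        mul_inv_cancel₀ (X 0).ne_zero, mul_one] at h1
      have h3 : ‖(X 0 : ℍ[ℝ]) * η * (X 0 : ℍ[ℝ])⁻¹‖ = ‖η‖ := by
        rw [norm_mul, norm_mul, norm_inv, mul_right_comm,
          mul_inv_cancel₀ (norm_ne_zero_iff.2 (X 0).ne_zero), one_mul]
      have h4 : ‖η - (X 0 : ℍ[ℝ]) * η * (X 0 : ℍ[ℝ])⁻¹‖ ^ 2 = 0 := by
        rw [inner_sub_right, real_inner_self_eq_norm_sq] at h1
        rw [norm_sub_sq_real, h3]
        linarith
      have h5 := sub_eq_zero.1 (norm_eq_zero.1 (pow_eq_zero_iff two_ne_zero |>.1 h4))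
      conv_lhs => rw [h5]
      rw [mul_assoc, inv_mul_cancel₀ (X 0).ne_zero, mul_one]
    cases i using Fin.cases with
    | zero => exact h0
    | succ i =>
      refine commute_of_orthogonal (X := fun i => X i.succ) (fun z hz' => ?_) i
      have h1 := h _ (hz 0 z (by simp) hz')
      rw [logProd_succ] at h1
      simp only [Fin.cons_zero, Fin.cons_succ, zero_mul, zero_add] at h1
      -- Conjugation by X₀ preserves the inner product and fixes η, so the hypothesis passes to the
      -- remaining entries.
      rwa [inner_conj, mul_assoc, h0, inv_mul_cancel_left₀ (X 0).ne_zero] at h1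

/-- A functional vanishing on the image is the inner product with an imaginary η, which commutes
with all entries by `commute_of_orthogonal`. If η were nonzero, the entries would commute with each
other. -/
theorem prodMap_surjective {N : ℕ} {X : Fin N → SU2} (hX : Irred X) :
    Function.Surjective (prodMap X) := by
  rw [← LinearMap.range_eq_top]
  by_contra h
  obtain ⟨f, hf, hf'⟩ := Submodule.exists_le_ker_of_lt_top _ (lt_top_iff_ne_top.2 h)
  have hfx : ∀ y, f y = ∑ k, f (Pi.single k 1) * y k := fun y => by
    conv_lhs => rw [← Finset.univ_sum_single y, map_sum]
    refine Finset.sum_congr rfl fun k _ => ?_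
    have : (Pi.single k (y k) : Fin 3 → ℝ) = y k • Pi.single k 1 := by
      rw [← Pi.single_smul, smul_eq_mul, mul_one]
    rw [this, map_smul, smul_eq_mul, mul_comm]
  have hη : imag (fun k => f (Pi.single k 1)) ≠ 0 := by
    intro h0
    have h1 := imag_injective (h0.trans (map_zero imag).symm)
    refine hf (LinearMap.ext fun y => ?_)
    rw [hfx]
    simp [fun k => congrFun h1 k]
  have hc := commute_of_orthogonal (η := imag fun k => f (Pi.single k 1)) (X := X) (by
    intro z hz
    rw [inner_imag, ← hfx]
    exact hf' ⟨⟨z, hz⟩, rfl⟩)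
  obtain ⟨i, j, hij⟩ := hX
  exact hij (Subtype.ext (commute_of_commute_imag (imag_re _) hη (hc i) (hc j)))

/-- A kernel vector is an imaginary quaternion centralizing every entry; irreducibility rules out a
nonzero one. -/
theorem orbitMap_injective {N : ℕ} {X : Fin N → SU2} (hX : Irred X) :
    Function.Injective (orbitMap X) := by
  rw [← LinearMap.ker_eq_bot, LinearMap.ker_eq_bot']
  intro y hy
  by_contra h
  have hη : imag y ≠ 0 := fun h0 => h (imag_injective (h0.trans (map_zero imag).symm))
  have hc : ∀ i, imag y * X i = X i * imag y := fun i =>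
    sub_eq_zero.1 (congrFun (congrArg Subtype.val hy) i)
  obtain ⟨i, j, hij⟩ := hX
  exact hij (Subtype.ext (commute_of_commute_imag (imag_re _) hη (hc i) (hc j)))

variable {n : ℕ}

theorem dAct_mem {β : Braid n} {X : Fin (n + 1) → SU2} {a : Fin (n + 1) → ℍ[ℝ]}
    (ha : a ∈ tangentR X) : dAct β X a ∈ tangentR (braidAct SU2 β X) := fun j =>
  ⟨by rw [dAct_re]; exact (ha _).1, by rw [dAct_re_mul_star]; exact (ha _).2⟩

theorem dAct_mem_of_fixed {β : Braid n} {X : Fin (n + 1) → SU2} (hX : braidAct SU2 β X = X)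
    {a : Fin (n + 1) → ℍ[ℝ]} (ha : a ∈ tangentR X) : dAct β X a ∈ tangentR X := by
  have := dAct_mem (β := β) ha
  rwa [hX] at this

/-- The derivative of the action of a braid at a fixed point, on the tangent space. -/
def actMap (β : Braid n) (X : Fin (n + 1) → SU2) (hX : braidAct SU2 β X = X) :
    tangentR X →ₗ[ℝ] tangentR X :=
  (dAct β X).toLinearMap.restrict fun _ ha => dAct_mem_of_fixed hX ha

theorem coe_actMap (β : Braid n) (X : Fin (n + 1) → SU2) (hX : braidAct SU2 β X = X)
    (z : tangentR X) : (actMap β X hX z : Fin (n + 1) → ℍ[ℝ]) = dAct β X z := rfl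

theorem actMap_orbitMap (β : Braid n) (X : Fin (n + 1) → SU2) (hX : braidAct SU2 β X = X)
    (y : Fin 3 → ℝ) : actMap β X hX (orbitMap X y) = orbitMap X y := by
  ext1
  rw [coe_actMap, coe_orbitMap, dAct_orbitVec, hX]

theorem logProd_dAct (β : Braid n) (X : Fin (n + 1) → SU2) (z : Fin (n + 1) → ℍ[ℝ]) :
    logProd (braidAct SU2 β X) (dAct β X z) = logProd X z := by
  rw [logProd, logProd, dProd_dAct, tupleProd_braidAct]

theorem prodMap_actMap (β : Braid n) (X : Fin (n + 1) → SU2) (hX : braidAct SU2 β X = X)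
    (z : tangentR X) : prodMap X (actMap β X hX z) = prodMap X z := by
  rw [prodMap_apply, prodMap_apply, coe_actMap]
  congr 1
  have := logProd_dAct β X z
  rwa [hX] at this

/-- The sign of the intersection at a fixed point, as the sign of a torsion. -/
def FixedSign (β : Braid n) (X : Fin (n + 1) → SU2) (hX : braidAct SU2 β X = X) (ε : SignType) :
    Prop :=
  HasTorsionSign (orbitMap X) (prodMap X) (LinearMap.id - actMap β X hX) ε

theorem sub_actMap_comp_orbitMap (β : Braid n) (X : Fin (n + 1) → SU2)
    (hX : braidAct SU2 β X = X) : (LinearMap.id - actMap β X hX) ∘ₗ orbitMap X = 0 :=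
  LinearMap.ext fun y => by simp [actMap_orbitMap]

theorem prodMap_comp_sub_actMap (β : Braid n) (X : Fin (n + 1) → SU2)
    (hX : braidAct SU2 β X = X) : prodMap X ∘ₗ (LinearMap.id - actMap β X hX) = 0 :=
  LinearMap.ext fun y => by simp [prodMap_actMap]

end

section

/-! ### The sign of an intersection as the sign of a torsion -/

theorem coe_eq_sum_iff {V ι : Type*} [AddCommGroup V] [Module ℝ V] [Fintype ι]
    {T : Submodule ℝ V} (b : Module.Basis ι ℝ T) (x : T) (c : ι → ℝ) :
    (x : V) = ∑ r, c r • (b r : V) ↔ ∀ r, c r = b.repr x r := by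
  have h : (x : V) = ∑ r, c r • (b r : V) ↔ x = ∑ r, c r • b r := by
    rw [Subtype.ext_iff]; simp
  rw [h]
  constructor
  · rintro rfl r
    rw [b.repr_sum_self]
  · intro hc
    conv_lhs => rw [← b.sum_repr x]
    simp [hc]

variable {V : Type*} [AddCommGroup V] [Module ℝ V] {T : Submodule ℝ V} {m : ℕ}

/-- The coordinates of the pairs `w, (a, a), (a, B a), (v, v)`, for a basis `(v, a)` of `T`. -/
def pairMatrix (b : Module.Basis (Fin 3 ⊕ Fin m) ℝ T) (B : T →ₗ[ℝ] T) (w₁ w₂ : Fin 3 → T) :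
    Matrix ((Fin 3 ⊕ Fin m) ⊕ (Fin m ⊕ Fin 3)) ((Fin 3 ⊕ Fin m) ⊕ (Fin m ⊕ Fin 3)) ℝ :=
  Matrix.of fun r s => Sum.elim
    (fun r => b.repr (Sum.elim (Sum.elim w₁ fun i => b (.inr i))
      (Sum.elim (fun i => b (.inr i)) fun k => b (.inl k)) s) r)
    (fun r => b.repr (Sum.elim (Sum.elim w₂ fun i => b (.inr i))
      (Sum.elim (fun i => B (b (.inr i))) fun k => b (.inl k)) s) r.swap) r

/-- The second half of the rows lists (0, a) before (0, v), opposite to the order in the basis `b`;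
this is why `Sum.swap` occurs. -/
theorem eq_pairMatrix_iff (b : Module.Basis (Fin 3 ⊕ Fin m) ℝ T) (B : T →ₗ[ℝ] T)
    (w₁ w₂ : Fin 3 → T)
    (M : Matrix ((Fin 3 ⊕ Fin m) ⊕ (Fin m ⊕ Fin 3)) ((Fin 3 ⊕ Fin m) ⊕ (Fin m ⊕ Fin 3)) ℝ) :
    (∀ s, (Sum.elim (Sum.elim (fun k => ((w₁ k : V), (w₂ k : V)))
          (fun i => ((b (.inr i) : V), (b (.inr i) : V))))
        (Sum.elim (fun i => ((b (.inr i) : V), (B (b (.inr i)) : V)))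
          (fun k => ((b (.inl k) : V), (b (.inl k) : V)))) s : V × V) =
      ∑ r, M r s • Sum.elim (Sum.elim (fun k => ((b (.inl k) : V), (0 : V)))
          (fun i => ((b (.inr i) : V), 0)))
        (Sum.elim (fun i => (0, (b (.inr i) : V))) (fun k => (0, (b (.inl k) : V)))) r) ↔
    M = pairMatrix b B w₁ w₂ := by
  have hsum : ∀ s, (∑ r, M r s • Sum.elim (Sum.elim (fun k => ((b (.inl k) : V), (0 : V)))
          (fun i => ((b (.inr i) : V), 0)))
        (Sum.elim (fun i => (0, (b (.inr i) : V))) (fun k => (0, (b (.inl k) : V)))) r : V × V) =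
      (∑ r, M (.inl r) s • (b r : V), ∑ r, M (.inr r.swap) s • (b r : V)) := by
    intro s
    refine Prod.ext ?_ ?_
    · simp only [Fintype.sum_sum_type, Prod.fst_add, Prod.fst_sum, Prod.smul_fst, Sum.elim_inl,
        Sum.elim_inr, smul_zero, Finset.sum_const_zero, add_zero]
    · simp only [Fintype.sum_sum_type, Prod.snd_add, Prod.snd_sum, Prod.smul_snd, Sum.elim_inl,
        Sum.elim_inr, smul_zero, Finset.sum_const_zero, zero_add, Sum.swap_inl, Sum.swap_inr]
      exact add_comm _ _
  have hfam : ∀ s, (Sum.elim (Sum.elim (fun k => ((w₁ k : V), (w₂ k : V)))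
          (fun i => ((b (.inr i) : V), (b (.inr i) : V))))
        (Sum.elim (fun i => ((b (.inr i) : V), (B (b (.inr i)) : V)))
          (fun k => ((b (.inl k) : V), (b (.inl k) : V)))) s : V × V) =
      (((Sum.elim (Sum.elim w₁ fun i => b (.inr i))
        (Sum.elim (fun i => b (.inr i)) fun k => b (.inl k)) s : T) : V),
        ((Sum.elim (Sum.elim w₂ fun i => b (.inr i))
      (Sum.elim (fun i => B (b (.inr i))) fun k => b (.inl k)) s : T) : V)) := by
    rintro ((k | i) | (i | k)) <;> rfl
  constructor
  · intro h
    ext r s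
    have hs := h s
    rw [hsum, hfam, Prod.mk.injEq, coe_eq_sum_iff, coe_eq_sum_iff] at hs
    cases r with
    | inl r => exact hs.1 r
    | inr r => exact (by simpa using hs.2 r.swap : M (.inr r) s = _)
  · rintro rfl s
    rw [hsum, hfam, Prod.mk.injEq, coe_eq_sum_iff, coe_eq_sum_iff]
    exact ⟨fun r => rfl, fun r => by simp [pairMatrix]⟩

/-- The first three coordinates with respect to a basis. -/
def firstCoords (b : Module.Basis (Fin 3 ⊕ Fin m) ℝ T) : T →ₗ[ℝ] (Fin 3 → ℝ) :=
  LinearMap.pi fun k => b.coord (.inl k)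

/-- The sign (-1)^(3m) in the convention meets (-1)^m from `det_intersection_matrix`, and 4m is
even. The columns left over are those of 1 - B + uL: on v the map 1 - B vanishes and u gives w₁ -
w₂, while L vanishes on a. -/
theorem det_pairMatrix (b : Module.Basis (Fin 3 ⊕ Fin m) ℝ T) (B : T →ₗ[ℝ] T)
    (hB : ∀ k, B (b (.inl k)) = b (.inl k)) (w₁ w₂ : Fin 3 → T) (u : (Fin 3 → ℝ) →ₗ[ℝ] T)
    (hu : ∀ k, u (Pi.single k 1) = w₁ k - w₂ k) :
    (-1) ^ (3 * m) * (pairMatrix b B w₁ w₂).det =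
      LinearMap.det (LinearMap.id - B + u ∘ₗ firstCoords b) := by
  have h1 : pairMatrix b B w₁ w₂ = Matrix.fromBlocks
      (Matrix.fromBlocks (.of fun r k => b.repr (w₁ k) (.inl r)) 0
        (.of fun r k => b.repr (w₁ k) (.inr r)) 1) (Matrix.fromBlocks 0 1 1 0)
      (Matrix.fromBlocks (.of fun r k => b.repr (w₂ k) (.inr r)) 1
        (.of fun r k => b.repr (w₂ k) (.inl r)) 0)
      (Matrix.fromBlocks (.of fun r i => b.repr (B (b (.inr i))) (.inr r)) 0
        (.of fun r i => b.repr (B (b (.inr i))) (.inl r)) 1) := by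
    ext ((k | i) | (i | k)) ((l | j) | (j | l)) <;>
      simp [pairMatrix, Finsupp.single_apply, Matrix.one_apply, eq_comm]
  have h2 : ∀ k : Fin 3, firstCoords b (b (.inl k)) = Pi.single k 1 := by
    intro k; funext l
    simp [firstCoords, Finsupp.single_apply, Pi.single_apply, eq_comm]
  have h3 : ∀ i : Fin m, firstCoords b (b (.inr i)) = 0 := by
    intro k; funext l
    simp [firstCoords]
  rw [h1, det_intersection_matrix, Fintype.card_fin, ← mul_assoc, ← pow_add,
    Even.neg_one_pow ⟨2 * m, by ring⟩, one_mul, ← LinearMap.det_toMatrix b]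
  congr 1
  ext (k | i) (l | j) <;> rw [LinearMap.toMatrix_apply] <;>
    simp [h2, h3, hu, hB, Finsupp.single_apply, Matrix.one_apply, eq_comm]

/-- The left inverse splits T as the image of v plus the kernel of L. Thus every choice of L comes
from a completion of the orbit vectors to a basis. -/
theorem exists_basis_of_leftInverse [FiniteDimensional ℝ T] (v : (Fin 3 → ℝ) →ₗ[ℝ] T)
    (L : T →ₗ[ℝ] (Fin 3 → ℝ)) (hL : L ∘ₗ v = LinearMap.id) :
    ∃ (m : ℕ) (b : Module.Basis (Fin 3 ⊕ Fin m) ℝ T), (∀ k, b (.inl k) = v (Pi.single k 1)) ∧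
      firstCoords b = L := by
  have hL1 : ∀ y, L (v y) = y := fun x => LinearMap.congr_fun hL x
  let e : T ≃ₗ[ℝ] (Fin 3 → ℝ) × LinearMap.ker L :=
    { toFun := fun x => (L x, ⟨x - v (L x), by simp [hL1]⟩)
      map_add' := fun x y => by ext <;> simp; abel
      map_smul' := fun t x => by ext <;> simp [smul_sub]
      invFun := fun p => v p.1 + p.2
      left_inv := fun x => by simp
      right_inv := fun p => by
        have hp : L p.2 = 0 := p.2.2
        ext <;> simp [hL1, hp] }
  refine ⟨Module.finrank ℝ (LinearMap.ker L),
    ((Pi.basisFun ℝ (Fin 3)).prod (Module.finBasis ℝ (LinearMap.ker L))).map e.symm, ?_, ?_⟩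
  · intro k
    simp only [Module.Basis.map_apply, Module.Basis.prod_apply]
    show v _ + _ = _
    simp
  · refine LinearMap.ext fun x => funext fun k => ?_
    simp [firstCoords, e]

variable {n : ℕ}

/-- Completing v by vectors a amounts to choosing L, and lifting i, j, k by w amounts to choosing u
= w₁ - w₂, since df sees only the difference of the components. -/
theorem hasSign_iff (β : Braid n) (X : Fin (n + 1) → SU2) (hX : braidAct SU2 β X = X)
    (ε : SignType) : HasSign β X ε ↔ FixedSign β X hX ε := by
  have hv : ∀ k, (orbitMap X (Pi.single k 1) : Fin (n + 1) → ℍ[ℝ]) = orbitVec X (imBasis k) :=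
    fun k => by rw [coe_orbitMap, imag_single]
  constructor
  · rintro ⟨m, a, w, M, hli, hspan, hw, hM, rfl⟩
    let b : Module.Basis (Fin 3 ⊕ Fin m) ℝ (tangentR X) :=
      (Module.Basis.span hli).map (LinearEquiv.ofEq _ _ hspan)
    have hb : ∀ r, (b r : Fin (n + 1) → ℍ[ℝ]) =
        Sum.elim (fun k => orbitVec X (imBasis k)) a r := fun r => by
      simp [b, Module.Basis.span_apply]
    have hbv : ∀ k, b (.inl k) = orbitMap X (Pi.single k 1) := fun k =>
      Subtype.ext ((hb _).trans (hv k).symm)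
    let w₁ : Fin 3 → tangentR X := fun k => ⟨(w k).1, (hw k).1⟩
    let w₂ : Fin 3 → tangentR X := fun k => ⟨(w k).2, (hw k).2.1⟩
    have hM' := (eq_pairMatrix_iff b (actMap β X hX) w₁ w₂ M).1 (fun s => by
      simpa only [hb, coe_actMap, Sum.elim_inl, Sum.elim_inr] using hM s)
    let u : (Fin 3 → ℝ) →ₗ[ℝ] tangentR X :=
      (Pi.basisFun ℝ (Fin 3)).constr ℝ fun k => w₁ k - w₂ k
    have hu : ∀ k, u (Pi.single k 1) = w₁ k - w₂ k := fun k => by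
      rw [← Pi.basisFun_apply, Module.Basis.constr_basis]
    refine ⟨firstCoords b, u, ?_, ?_, ?_⟩
    · refine (Pi.basisFun ℝ (Fin 3)).ext fun k => ?_
      rw [Pi.basisFun_apply, LinearMap.comp_apply, ← hbv]
      funext l
      simp [firstCoords, Finsupp.single_apply, Pi.single_apply, eq_comm]
    · refine (Pi.basisFun ℝ (Fin 3)).ext fun k => ?_
      rw [Pi.basisFun_apply, LinearMap.comp_apply, hu, prodMap_apply, LinearMap.id_apply,
        ← imCoords_imBasis, ← (hw k).2.2, dF_apply, logProd, ← map_sub]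
      rfl
    · rw [hM', det_pairMatrix b (actMap β X hX) (fun k => by rw [hbv, actMap_orbitMap]) w₁ w₂ u hu]
  · rintro ⟨L, u, hL, hu, rfl⟩
    obtain ⟨m, b, hbv, rfl⟩ := exists_basis_of_leftInverse _ L hL
    have hbv' : ∀ k, (b (.inl k) : Fin (n + 1) → ℍ[ℝ]) = orbitVec X (imBasis k) := fun k => by
      rw [hbv, hv]
    have helim : Sum.elim (fun k => orbitVec X (imBasis k))
        (fun i => (b (.inr i) : Fin (n + 1) → ℍ[ℝ])) = fun r => (b r : Fin (n + 1) → ℍ[ℝ]) := by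
      funext r; cases r <;> simp [hbv']
    -- The lift may be taken with zero second component.
    let w₁ : Fin 3 → tangentR X := fun k => u (Pi.single k 1)
    refine ⟨m, fun i => b (.inr i), fun k => (w₁ k, (0 : tangentR X)),
      pairMatrix b (actMap β X hX) w₁ (fun _ => 0), ?_, ?_, ?_, ?_, ?_⟩
    · rw [helim]
      exact b.linearIndependent.map' (tangentR X).subtype (Submodule.ker_subtype _)
    · rw [helim, show (fun r => (b r : Fin (n + 1) → ℍ[ℝ])) = (tangentR X).subtype ∘ b from rfl,
        Set.range_comp, Submodule.span_image, b.span_eq, Submodule.map_top,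
        Submodule.range_subtype]
    · intro k
      refine ⟨(w₁ k).2, Submodule.zero_mem _, ?_⟩
      rw [dF_apply, ← map_sub]
      have h1 := LinearMap.congr_fun hu (Pi.single k 1)
      rw [LinearMap.comp_apply, LinearMap.id_apply] at h1
      rw [← imag_single, ← h1, imag_prodMap, logProd]
      simp [w₁]
    · intro s
      have := (eq_pairMatrix_iff b (actMap β X hX) w₁ (fun _ => 0) _).2 rfl s
      simpa only [hbv', coe_actMap] using this
    · rw [det_pairMatrix b (actMap β X hX) (fun k => by rw [hbv, actMap_orbitMap]) w₁ (fun _ => 0) u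
        (fun k => by simp [w₁])]

theorem HasSign.unique {β : Braid n} {X : Fin (n + 1) → SU2} (hX : braidAct SU2 β X = X)
    {ε ε' : SignType} (h : HasSign β X ε) (h' : HasSign β X ε') : ε = ε' :=
  HasTorsionSign.unique (sub_actMap_comp_orbitMap β X hX) (prodMap_comp_sub_actMap β X hX)
    ((hasSign_iff β X hX ε).1 h) ((hasSign_iff β X hX ε').1 h')

theorem exists_hasSign {β : Braid n} {X : Fin (n + 1) → SU2} (hX : braidAct SU2 β X = X)
    (hirr : Irred X) : ∃ ε, HasSign β X ε := by
  obtain ⟨ε, h⟩ := exists_hasTorsionSign (LinearMap.id - actMap β X hX)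
    (orbitMap_injective hirr) (prodMap_surjective hirr)
  exact ⟨ε, (hasSign_iff β X hX ε).2 h⟩

/-- If (a, c) is tangent to H then D(a - c) = 0, so exactness gives a - c = x - dβ x. Then (a, c) =
(a - x, a - x) + (x, dβ x). -/
theorem HasSign.transverseAt {β : Braid n} {X : Fin (n + 1) → SU2} (hX : braidAct SU2 β X = X)
    {ε : SignType} (hε : ε ≠ 0) (h : HasSign β X ε) : TransverseAt β X := by
  have h0 : ((tupleProd X : SU2) : ℍ[ℝ]) ≠ 0 := SU2.ne_zero _
  apply le_antisymm
  · refine sup_le ?_ ?_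
    · rintro _ ⟨a, ha, rfl⟩
      refine ⟨⟨ha, ha⟩, ?_⟩
      show dF X _ = 0
      rw [dF_apply]; simp
    · rintro _ ⟨a, ha, rfl⟩
      refine ⟨⟨ha, dAct_mem_of_fixed hX ha⟩, ?_⟩
      show dF X _ = 0
      have := dProd_dAct β X a
      rw [hX] at this
      rw [dF_apply]; simp [this]
  · rintro ⟨a, c⟩ ⟨⟨ha, hc⟩, hac⟩
    have hac' : dF X (a, c) = 0 := hac
    rw [dF_apply, ← map_sub] at hac'
    obtain ⟨x, hx⟩ := ((hasSign_iff β X hX ε).1 h).exact hε (prodMap_comp_sub_actMap β X hX)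
      (z := ⟨a - c, Submodule.sub_mem _ ha hc⟩) (by
        rw [prodMap_apply]
        show imCoords ((dProd X (a - c)) * _) = 0
        rw [hac', map_zero])
    have hx' : (x : Fin (n + 1) → ℍ[ℝ]) - dAct β X x = a - c := congrArg Subtype.val hx
    refine Submodule.mem_sup.2 ⟨_, ⟨a - x, Submodule.sub_mem _ ha x.2, rfl⟩, _,
      ⟨x, x.2, rfl⟩, ?_⟩
    ext1
    · simp
    · have : dAct β X x = x - (a - c) := by rw [← hx']; abel
      simp [this]

end

section

variable {n : ℕ}

/-! ### Conjugation of braids -/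

theorem fixed_conj {G : Type*} [Group G] {β : Braid n} (γ : Braid n) {X : Fin (n + 1) → G}
    (hX : braidAct G β X = X) :
    braidAct G (γ * β * γ⁻¹) (braidAct G γ X) = braidAct G γ X := by
  rw [← braidAct_mul_apply, inv_mul_cancel_right, braidAct_mul_apply, hX]

theorem dAct_inv_dAct (γ : Braid n) (X : Fin (n + 1) → SU2) (a : Fin (n + 1) → ℍ[ℝ]) :
    dAct γ⁻¹ (braidAct SU2 γ X) (dAct γ X a) = a := by
  rw [← dAct_mul, inv_mul_cancel, dAct_one]

theorem dAct_dAct_inv (γ : Braid n) (X : Fin (n + 1) → SU2) (a : Fin (n + 1) → ℍ[ℝ]) :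
    dAct γ X (dAct γ⁻¹ (braidAct SU2 γ X) a) = a := by
  have h : braidAct SU2 γ⁻¹ (braidAct SU2 γ X) = X := by
    rw [← braidAct_mul_apply, inv_mul_cancel, map_one]; rfl
  have := dAct_mul γ γ⁻¹ (braidAct SU2 γ X) a
  rw [h, mul_inv_cancel, dAct_one] at this
  exact this.symm

/-- The derivative of the action of a braid, as an isomorphism of tangent spaces. -/
def actEquiv (γ : Braid n) (X : Fin (n + 1) → SU2) :
    tangentR X ≃ₗ[ℝ] tangentR (braidAct SU2 γ X) where
  toFun z := ⟨dAct γ X z, dAct_mem z.2⟩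
  map_add' y z := by ext1; simp
  map_smul' t z := by ext1; simp
  invFun z := ⟨dAct γ⁻¹ (braidAct SU2 γ X) z, by
    have h : braidAct SU2 γ⁻¹ (braidAct SU2 γ X) = X := by
      rw [← braidAct_mul_apply, inv_mul_cancel, map_one]; rfl
    have := dAct_mem (β := γ⁻¹) z.2
    rwa [h] at this⟩
  left_inv z := Subtype.ext (dAct_inv_dAct γ X z)
  right_inv z := Subtype.ext (dAct_dAct_inv γ X z)

/-- The derivative of γ is an isomorphism between the two complexes, and a torsion sign is preserved
by isomorphisms. -/
theorem HasSign.conj {β : Braid n} {X : Fin (n + 1) → SU2} (hX : braidAct SU2 β X = X)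
    (γ : Braid n) {ε : SignType} (h : HasSign β X ε) :
    HasSign (γ * β * γ⁻¹) (braidAct SU2 γ X) ε := by
  rw [hasSign_iff _ _ (fixed_conj γ hX)]
  refine HasTorsionSign.congr (actEquiv γ X) (fun y => ?_) (fun z => ?_) (fun z => ?_)
    ((hasSign_iff β X hX ε).1 h)
  · exact Subtype.ext (dAct_orbitVec γ X (imag y)).symm
  · rw [prodMap_apply, prodMap_apply]
    exact congrArg imCoords (logProd_dAct γ X z)
  · ext1
    show dAct γ X z - dAct (γ * β * γ⁻¹) (braidAct SU2 γ X) (dAct γ X z) =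
      dAct γ X (z - dAct β X z)
    have h1 := dAct_mul γ β X z
    rw [hX] at h1
    rw [← dAct_mul, inv_mul_cancel_right, h1, map_sub]

/-! ### Stabilization -/

theorem braidAct_addStrand {G : Type*} [Group G] (β : Braid n) :
    ∀ X : Fin (n + 1 + 1) → G, braidAct G (addStrand β) X =
      Fin.snoc (α := fun _ => G) (braidAct G β fun i => X i.castSucc) (X (Fin.last _)) := by
  have last_ne_castSucc : ∀ i : Fin n, Fin.last (n + 1) ≠ i.castSucc.castSucc := by
    intro i; simp only [ne_eq, Fin.ext_iff, Fin.val_last, Fin.val_castSucc]; omega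
  have last_ne_succ : ∀ i : Fin n, Fin.last (n + 1) ≠ i.castSucc.succ := by
    intro i; simp only [ne_eq, Fin.ext_iff, Fin.val_last, Fin.val_castSucc, Fin.val_succ]; omega
  induction β using Braid.induction with
  | one =>
    intro X
    funext j
    cases j using Fin.lastCases <;> simp
  | sigma i =>
    intro X
    rw [addStrand_sigma, braidAct_sigma, braidAct_sigma]
    funext j
    cases j using Fin.lastCases with
    | last => rw [sigmaAct_apply, if_neg (last_ne_castSucc i), if_neg (last_ne_succ i), Fin.snoc_last]
    | cast j =>
      rw [Fin.snoc_castSucc, sigmaAct_apply, sigmaAct_apply]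
      simp only [Fin.castSucc_inj, Fin.succ_castSucc]
  | sigma_inv i =>
    intro X
    rw [map_inv, map_inv, map_inv, addStrand_sigma, braidAct_sigma, braidAct_sigma]
    funext j
    cases j using Fin.lastCases with
    | last => rw [sigmaAct_inv_apply, if_neg (last_ne_castSucc i), if_neg (last_ne_succ i), Fin.snoc_last]
    | cast j =>
      rw [Fin.snoc_castSucc, sigmaAct_inv_apply, sigmaAct_inv_apply]
      simp only [Fin.castSucc_inj, Fin.succ_castSucc]
  | mul β γ hβ hγ =>
    intro X
    rw [map_mul, braidAct_mul_apply, hγ, hβ]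
    simp only [Fin.snoc_castSucc, Fin.snoc_last, braidAct_mul_apply]

/-- A tuple with its last entry repeated. -/
def dupLast {G : Type*} (X : Fin (n + 1) → G) : Fin (n + 1 + 1) → G :=
  Fin.snoc (α := fun _ => G) X (X (Fin.last n))

@[simp] theorem dupLast_castSucc {G : Type*} (X : Fin (n + 1) → G) (i : Fin (n + 1)) :
    dupLast X i.castSucc = X i := by simp [dupLast]

@[simp] theorem dupLast_last {G : Type*} (X : Fin (n + 1) → G) :
    dupLast X (Fin.last (n + 1)) = X (Fin.last n) := by simp [dupLast]

theorem sigmaAct_dupLast {G : Type*} [Group G] (X : Fin (n + 1) → G) :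
    sigmaAct G (Fin.last n) (dupLast X) = dupLast X := by
  funext j
  rw [sigmaAct_apply]
  split_ifs with h1 h2
  · rw [h1, Fin.succ_last, dupLast_last, dupLast_castSucc, mul_inv_cancel_right]
  · rw [h2, Fin.succ_last, dupLast_last, dupLast_castSucc]
  · rfl

/-- The two stabilizations of a braid. -/
def IsStabilization (β : Braid n) (β' : Braid (n + 1)) : Prop :=
  β' = addStrand β * σ (Fin.last n) ∨ β' = addStrand β * (σ (Fin.last n))⁻¹

theorem fixed_dupLast {G : Type*} [Group G] {β : Braid n} {β' : Braid (n + 1)}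
    (hβ : IsStabilization β β') {X : Fin (n + 1) → G} (hX : braidAct G β X = X) :
    braidAct G β' (dupLast X) = dupLast X := by
  have h1 : braidAct G (addStrand β) (dupLast X) = dupLast X := by
    rw [braidAct_addStrand]
    simp only [dupLast_castSucc, dupLast_last, hX]
    rfl
  rcases hβ with rfl | rfl
  · rw [braidAct_mul_apply, braidAct_sigma, sigmaAct_dupLast, h1]
  · rw [braidAct_mul_apply, map_inv, braidAct_sigma, Equiv.Perm.inv_eq_iff_eq.2
      (sigmaAct_dupLast X).symm, h1]

/-- The braid `addStrand β` leaves the last entry alone, so the last coordinate of the fixed point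
equation involves only the new crossing and makes the last two entries equal. The crossing then acts
trivially on the tuple. -/
theorem eq_dupLast_of_fixed {G : Type*} [Group G] {β : Braid n} {β' : Braid (n + 1)}
    (hβ : IsStabilization β β') {Y : Fin (n + 1 + 1) → G} (hY : braidAct G β' Y = Y) :
    Y = dupLast (fun i => Y i.castSucc) ∧
      braidAct G β (fun i => Y i.castSucc) = fun i => Y i.castSucc := by
  have hne : Fin.last (n + 1) ≠ (Fin.last n).castSucc := by simp [Fin.ext_iff]
  have h1 : Y (Fin.last (n + 1)) = Y (Fin.last n).castSucc := by
    have h := congrFun hY (Fin.last (n + 1))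
    rcases hβ with rfl | rfl
    · rw [braidAct_mul_apply, braidAct_addStrand, braidAct_sigma, Fin.snoc_last, sigmaAct_apply,
        if_neg hne, if_pos (Fin.succ_last n).symm] at h
      exact h.symm
    · rw [braidAct_mul_apply, braidAct_addStrand, map_inv, braidAct_sigma, Fin.snoc_last,
        sigmaAct_inv_apply, if_neg hne, if_pos (Fin.succ_last n).symm, Fin.succ_last] at h
      rw [mul_assoc, inv_mul_eq_iff_eq_mul] at h
      exact (mul_right_cancel h).symm
  have h2 : Y = dupLast (fun i => Y i.castSucc) := by
    funext j
    cases j using Fin.lastCases with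
    | last => rw [dupLast_last, h1]
    | cast j => rw [dupLast_castSucc]
  refine ⟨h2, ?_⟩
  have h3 : braidAct G (addStrand β) Y = Y := by
    rcases hβ with rfl | rfl
    · rw [braidAct_mul_apply, braidAct_sigma] at hY
      rw [h2, sigmaAct_dupLast, ← h2] at hY
      exact hY
    · rw [braidAct_mul_apply, map_inv, braidAct_sigma, h2, Equiv.Perm.inv_eq_iff_eq.2
        (sigmaAct_dupLast _).symm, ← h2] at hY
      exact hY
  funext j
  have h4 := congrFun h3 j.castSucc
  rwa [braidAct_addStrand, Fin.snoc_castSucc] at h4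

theorem dAct_addStrand (β : Braid n) (Y : Fin (n + 1 + 1) → SU2) (a : Fin (n + 1 + 1) → ℍ[ℝ])
    (j : Fin (n + 1)) : dAct (addStrand β) Y a j.castSucc =
      dAct β (fun i => Y i.castSucc) (fun i => a i.castSucc) j ∧
    dAct (addStrand β) Y a (Fin.last _) = a (Fin.last _) := by
  have h0 : ∀ x : Fin (n + 1 + 1) → ℍ[ℝ], extAct (addStrand β) x =
      fun j => ((Fin.snoc (α := fun _ => ℍ[ℝ]ˣ) (braidAct ℍ[ℝ]ˣ β fun i => toUnit (x i.castSucc))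
        (toUnit (x (Fin.last _))) j : ℍ[ℝ]ˣ) : ℍ[ℝ]) := by
    intro x; funext j; rw [extAct, braidAct_addStrand]
  have h := hasFDerivAt_extAct (addStrand β) Y
  constructor
  · have h1 := (hasFDerivAt_pi'.1 h) j.castSucc
    have h2 : HasFDerivAt (fun x : Fin (n + 1 + 1) → ℍ[ℝ] => fun i : Fin (n + 1) => x i.castSucc)
        (ContinuousLinearMap.pi fun i : Fin (n + 1) =>
          (ContinuousLinearMap.proj i.castSucc : (Fin (n + 1 + 1) → ℍ[ℝ]) →L[ℝ] ℍ[ℝ])) (toH Y) :=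
      hasFDerivAt_pi.2 fun i => hasFDerivAt_apply i.castSucc _
    have h3 := (hasFDerivAt_pi'.1 (hasFDerivAt_extAct β fun i => Y i.castSucc) j).comp (toH Y) h2
    have h4 : (fun x => extAct (addStrand β) x j.castSucc) =
        (fun x => extAct β x j) ∘ fun x => fun i : Fin (n + 1) => x i.castSucc := by
      funext x
      simp only [h0, Fin.snoc_castSucc]; rfl
    rw [h4] at h1
    exact DFunLike.congr_fun (h1.unique h3) a
  · have h1 := (hasFDerivAt_pi'.1 h) (Fin.last _)
    have h3 : HasFDerivAt (fun x => extAct (addStrand β) x (Fin.last _))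
        (ContinuousLinearMap.proj (Fin.last (n + 1)) : (Fin (n + 1 + 1) → ℍ[ℝ]) →L[ℝ] ℍ[ℝ])
        (toH Y) := by
      refine (hasFDerivAt_apply (𝕜 := ℝ) (Fin.last (n + 1)) (toH Y)).congr_of_eventuallyEq ?_
      filter_upwards [nonzeroTuples_mem_nhds Y] with y hy
      simp only [h0, Fin.snoc_last, coe_toUnit (hy _)]
    exact DFunLike.congr_fun (h1.unique h3) a

/-- At equal entries x = y = q the derivative of xyx⁻¹ collapses to a + q(b - a)q⁻¹. This is the
case met at fixed points of a stabilization. -/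
theorem dAct_sigma (i : Fin n) (Y : Fin (n + 1) → SU2) (hY : Y i.succ = Y i.castSucc)
    (a : Fin (n + 1) → ℍ[ℝ]) (j : Fin (n + 1)) :
    dAct (σ i) Y a j = if j = i.castSucc then a i.castSucc +
        Y i.castSucc * (a i.succ - a i.castSucc) * (Y i.castSucc : ℍ[ℝ])⁻¹
      else if j = i.succ then a i.castSucc else a j := by
  have h1 := (hasFDerivAt_pi'.1 (hasFDerivAt_extAct (σ i) Y)) j
  have hp : ∀ k, HasFDerivAt (fun x : Fin (n + 1) → ℍ[ℝ] => x k)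
      (ContinuousLinearMap.proj k : (Fin (n + 1) → ℍ[ℝ]) →L[ℝ] ℍ[ℝ]) (toH Y) :=
    fun k => hasFDerivAt_apply k _
  have hq := (Y i.castSucc).ne_zero
  have hi := (hasFDerivAt_inv' (𝕜 := ℝ) (x := toH Y i.castSucc) hq).comp (toH Y) (hp i.castSucc)
  have h2 := ((hp i.castSucc).mul' (hp i.succ)).mul' hi
  have hev : (fun x => extAct (σ i) x j) =ᶠ[nhds (toH Y)] fun x =>
      if j = i.castSucc then x i.castSucc * x i.succ * (x i.castSucc)⁻¹
      else if j = i.succ then x i.castSucc else x j := by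
    filter_upwards [nonzeroTuples_mem_nhds Y] with y hy using extAct_sigma i hy j
  have h3 := h1.congr_of_eventuallyEq hev.symm
  split_ifs at h3 ⊢ with hj1 hj2
  · refine (DFunLike.congr_fun (h3.unique h2) a).trans ?_
    simp [toH, hY]
    rw [mul_inv_cancel_right₀ hq, mul_assoc (_)⁻¹, mul_assoc (Y i.castSucc : ℍ[ℝ]) (Y i.castSucc : ℍ[ℝ]),
      mul_inv_cancel_left₀ hq]
    noncomm_ring
  · exact DFunLike.congr_fun (h3.unique (hp _)) a
  · exact DFunLike.congr_fun (h3.unique (hp _)) a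

theorem dAct_sigma_inv (i : Fin n) (Y : Fin (n + 1) → SU2) (hY : Y i.succ = Y i.castSucc)
    (a : Fin (n + 1) → ℍ[ℝ]) (j : Fin (n + 1)) :
    dAct (σ i)⁻¹ Y a j = if j = i.castSucc then a i.succ
      else if j = i.succ then a i.succ -
        (Y i.castSucc : ℍ[ℝ])⁻¹ * (a i.succ - a i.castSucc) * Y i.castSucc else a j := by
  have h1 := (hasFDerivAt_pi'.1 (hasFDerivAt_extAct (σ i)⁻¹ Y)) j
  have hp : ∀ k, HasFDerivAt (fun x : Fin (n + 1) → ℍ[ℝ] => x k)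
      (ContinuousLinearMap.proj k : (Fin (n + 1) → ℍ[ℝ]) →L[ℝ] ℍ[ℝ]) (toH Y) :=
    fun k => hasFDerivAt_apply k _
  have hq := (Y i.castSucc).ne_zero
  have hq' : toH Y i.succ ≠ 0 := (Y i.succ).ne_zero
  have hi := (hasFDerivAt_inv' (𝕜 := ℝ) hq').comp (toH Y) (hp i.succ)
  have h2 := (hi.mul' (hp i.castSucc)).mul' (hp i.succ)
  have hev : (fun x => extAct (σ i)⁻¹ x j) =ᶠ[nhds (toH Y)] fun x =>
      if j = i.castSucc then x i.succ
      else if j = i.succ then (x i.succ)⁻¹ * x i.castSucc * x i.succ else x j := by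
    filter_upwards [nonzeroTuples_mem_nhds Y] with y hy using extAct_sigma_inv i hy j
  have h3 := h1.congr_of_eventuallyEq hev.symm
  split_ifs at h3 ⊢ with hj1 hj2
  · exact DFunLike.congr_fun (h3.unique (hp _)) a
  · refine (DFunLike.congr_fun (h3.unique h2) a).trans ?_
    simp [toH, hY]
    rw [inv_mul_cancel₀ hq, one_mul, inv_mul_cancel_right₀ hq]
    noncomm_ring
  · exact DFunLike.congr_fun (h3.unique (hp _)) a

end

/-! ### The sign under stabilization. -/

section

variable {n : ℕ}

/-- A vector with vanishing last entry moves only the first factors, and right translation by the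
inverse of the whole product cancels the extra factor. -/
theorem logProd_dupLast (X : Fin (n + 1) → SU2) (z : Fin (n + 1) → ℍ[ℝ]) :
    logProd (dupLast X) (Fin.snoc (α := fun _ => ℍ[ℝ]) z 0) = logProd X z := by
  have h0 : HasFDerivAt (fun x : Fin (n + 1 + 1) → ℍ[ℝ] => x (Fin.last _))
      (ContinuousLinearMap.proj (Fin.last _) : _ →L[ℝ] ℍ[ℝ]) (toH (dupLast X)) :=
    hasFDerivAt_apply _ _
  have h1 : HasFDerivAt (fun x : Fin (n + 1 + 1) → ℍ[ℝ] => fun i : Fin (n + 1) => x i.castSucc)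
      (ContinuousLinearMap.pi fun i : Fin (n + 1) =>
        (ContinuousLinearMap.proj i.castSucc : (Fin (n + 1 + 1) → ℍ[ℝ]) →L[ℝ] ℍ[ℝ]))
      (toH (dupLast X)) :=
    hasFDerivAt_pi.2 fun i => hasFDerivAt_apply i.castSucc _
  have hX : (fun i : Fin (n + 1) => toH (dupLast X) i.castSucc) = toH X := by
    funext i; simp [toH]
  have h2' : HasFDerivAt tupleProd (dProd X) (fun i => toH (dupLast X) i.castSucc) := by
    rw [hX]; exact hasFDerivAt_tupleProd X
  have h3 := (h2'.comp _ h1).mul' h0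
  have h4 : (tupleProd : (Fin (n + 1 + 1) → ℍ[ℝ]) → ℍ[ℝ]) =
    (tupleProd ∘ fun x => fun i : Fin (n + 1) => x i.castSucc) * (fun x => x (Fin.last _)) :=
    funext tupleProd_castSucc
  rw [← h4] at h3
  have h5 : dProd (dupLast X) (Fin.snoc (α := fun _ => ℍ[ℝ]) z 0) =
      dProd X z * X (Fin.last n) := by
    rw [(hasFDerivAt_tupleProd _).unique h3]
    simp only [add_apply, smul_apply,
      ContinuousLinearMap.comp_apply, ContinuousLinearMap.proj_apply, Fin.snoc_last, smul_zero,
      zero_add, MulOpposite.smul_eq_mul_unop, MulOpposite.unop_op]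
    have h6 : (ContinuousLinearMap.pi fun i : Fin (n + 1) =>
        (ContinuousLinearMap.proj i.castSucc : (Fin (n + 1 + 1) → ℍ[ℝ]) →L[ℝ] ℍ[ℝ]))
        (Fin.snoc (α := fun _ => ℍ[ℝ]) z 0) = z := by
      funext i; simp
    rw [h6]
    simp [toH]
  rw [logProd, logProd, h5, tupleProd_castSucc]
  simp only [dupLast_castSucc, dupLast_last, Submonoid.coe_mul, mul_inv_rev]
  rw [mul_assoc, mul_inv_cancel_left₀ (SU2.ne_zero _)]

/-- The tangent space at `q` of the conjugacy class of `q`. -/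
def sphereTangent (q : SU2) : Submodule ℝ ℍ[ℝ] :=
  (tangentR fun _ : Fin 1 => q).comap (LinearMap.pi fun _ => LinearMap.id)

theorem mem_sphereTangent {q : SU2} {z : ℍ[ℝ]} :
    z ∈ sphereTangent q ↔ z.re = 0 ∧ (z * star (q : ℍ[ℝ])).re = 0 :=
  ⟨fun h => h 0, fun h _ => h⟩

/-- Conjugation by a quaternion that commutes with `q`, on the tangent space of the class
of `q`. -/
def sphereConj (q : SU2) (p : ℍ[ℝ]) (hp : p ≠ 0) (hpq : p * q = q * p) :
    sphereTangent q →ₗ[ℝ] sphereTangent q where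
  toFun z := ⟨p⁻¹ * z * p, by
    have hz := mem_sphereTangent.1 z.2
    have hp' : star (q : ℍ[ℝ]) = p⁻¹ * star (q : ℍ[ℝ]) * p := by
      rw [SU2.star_eq_inv, eq_comm, ← mul_left_inj' q.ne_zero, mul_assoc, mul_assoc, hpq,
        inv_mul_cancel_left₀ q.ne_zero, inv_mul_cancel₀ hp, inv_mul_cancel₀ q.ne_zero]
    have h1 : ∀ w : ℍ[ℝ], (p⁻¹ * w * p).re = w.re := fun w => by
      have := re_conj (inv_ne_zero hp) w
      rwa [inv_inv] at this
    refine mem_sphereTangent.2 ⟨by rw [h1, hz.1], ?_⟩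
    have h2 : p⁻¹ * (z : ℍ[ℝ]) * p * star (q : ℍ[ℝ]) = p⁻¹ * (z * star (q : ℍ[ℝ])) * p := by
      conv_lhs => rw [hp']
      simp only [mul_assoc]
      rw [mul_inv_cancel_left₀ hp]
    rw [h2, h1, hz.2]⟩
  map_add' y z := by ext1; simp [mul_add, add_mul]
  map_smul' t z := by ext1; simp

theorem coe_sphereConj (q : SU2) (p : ℍ[ℝ]) (hp : p ≠ 0) (hpq : p * q = q * p)
    (z : sphereTangent q) : (sphereConj q p hp hpq z : ℍ[ℝ]) = p⁻¹ * z * p := rfl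

theorem SU2.inv_comm (q : SU2) : (q : ℍ[ℝ])⁻¹ * q = q * (q : ℍ[ℝ])⁻¹ := by
  rw [inv_mul_cancel₀ q.ne_zero, mul_inv_cancel₀ q.ne_zero]

theorem SU2.mul_self (q : SU2) : (q : ℍ[ℝ]) * q = (2 * (q : ℍ[ℝ]).re) • (q : ℍ[ℝ]) - 1 := by
  have h1 : (q : ℍ[ℝ]) * star (q : ℍ[ℝ]) = 1 := Unitary.coe_mul_star_self q
  have h2 : star (q : ℍ[ℝ]) = ((2 * (q : ℍ[ℝ]).re : ℝ) : ℍ[ℝ]) - q := by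
    rw [eq_sub_iff_add_eq', Quaternion.self_add_star]; push_cast; rfl
  rw [h2, mul_sub, ← Quaternion.coe_commutes, Quaternion.coe_mul_eq_smul] at h1
  rw [← h1]; abel

/-- Conjugation by `q` is a rotation of the tangent space of the class of `q`. -/
theorem det_sphereConj_pos (q : SU2) : 0 < LinearMap.det (sphereConj q q q.ne_zero rfl) := by
  by_cases hp : (1 + q : ℍ[ℝ]) = 0
  · have hq : (q : ℍ[ℝ]) = -1 := by rw [eq_neg_iff_add_eq_zero, add_comm, hp]
    have : sphereConj q q q.ne_zero rfl = LinearMap.id := by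
      refine LinearMap.ext fun z => Subtype.ext ?_
      rw [coe_sphereConj, hq]; simp [inv_neg]
    rw [this, LinearMap.det_id]; exact one_pos
  -- From q² = 2 Re(q) q - 1 follows (1+q)² = (2 + 2 Re q) q, so conjugation by q is the square of
  -- conjugation by 1 + q. Its determinant is a square, and nonzero by invertibility.
  · have h1 : sphereConj q q q.ne_zero rfl =
        sphereConj q (1 + q) hp (by noncomm_ring) ∘ₗ sphereConj q (1 + q) hp (by noncomm_ring) := by
      have h2 : (1 + q : ℍ[ℝ]) * (1 + q) = (2 + 2 * (q : ℍ[ℝ]).re) • (q : ℍ[ℝ]) := by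
        rw [add_smul, add_mul, mul_add, mul_add, SU2.mul_self, two_smul]; noncomm_ring
      have h3 : (2 + 2 * (q : ℍ[ℝ]).re) ≠ 0 := by
        intro h
        rw [h, zero_smul] at h2
        exact hp (mul_self_eq_zero.1 h2)
      refine LinearMap.ext fun z => Subtype.ext ?_
      rw [LinearMap.comp_apply, coe_sphereConj, coe_sphereConj, coe_sphereConj]
      have h4 : (1 + q : ℍ[ℝ])⁻¹ * ((1 + q : ℍ[ℝ])⁻¹ * z * (1 + q)) * (1 + q) =
          ((1 + q : ℍ[ℝ]) * (1 + q))⁻¹ * z * ((1 + q) * (1 + q)) := by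
        rw [mul_inv_rev]; simp only [mul_assoc]
      rw [h4, h2, smul_inv₀]
      simp [smul_smul, h3]
    have h5 : sphereConj q (q : ℍ[ℝ])⁻¹ (inv_ne_zero q.ne_zero) q.inv_comm ∘ₗ
        sphereConj q q q.ne_zero rfl = LinearMap.id := by
      refine LinearMap.ext fun z => Subtype.ext ?_
      rw [LinearMap.comp_apply, coe_sphereConj, coe_sphereConj, inv_inv, mul_assoc, mul_assoc,
        mul_inv_cancel₀ q.ne_zero, mul_one, mul_inv_cancel_left₀ q.ne_zero, LinearMap.id_apply]
    have h6 : LinearMap.det (sphereConj q q q.ne_zero rfl) ≠ 0 := by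
      intro h
      have := congrArg LinearMap.det h5
      rw [LinearMap.det_comp, h, mul_zero, LinearMap.det_id] at this
      exact zero_ne_one this
    refine lt_of_le_of_ne ?_ h6.symm
    rw [h1, LinearMap.det_comp]
    exact mul_self_nonneg _

/-- The tangent space of the tuples with one more entry. -/
def dupLastEquiv (X : Fin (n + 1) → SU2) :
    tangentR (dupLast X) ≃ₗ[ℝ] tangentR X × sphereTangent (X (Fin.last n)) where
  toFun z := (⟨fun i => (z : Fin (n + 1 + 1) → ℍ[ℝ]) i.castSucc, fun i => by
      have := z.2 i.castSucc
      rwa [dupLast_castSucc] at this⟩,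
    ⟨(z : Fin (n + 1 + 1) → ℍ[ℝ]) (Fin.last _), mem_sphereTangent.2 (by
      have := z.2 (Fin.last _)
      rwa [dupLast_last] at this)⟩)
  map_add' y z := by ext <;> rfl
  map_smul' t z := by ext <;> rfl
  invFun p := ⟨Fin.snoc (α := fun _ => ℍ[ℝ]) (p.1 : Fin (n + 1) → ℍ[ℝ]) (p.2 : ℍ[ℝ]), fun i => by
    cases i using Fin.lastCases with
    | last => rw [Fin.snoc_last, dupLast_last]; exact mem_sphereTangent.1 p.2.2
    | cast i => rw [Fin.snoc_castSucc, dupLast_castSucc]; exact p.1.2 i⟩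
  left_inv z := by
    ext1; funext i
    cases i using Fin.lastCases <;> simp
  right_inv p := by
    refine Prod.ext (Subtype.ext ?_) (Subtype.ext ?_)
    · funext i; simp
    · simp

/-- The inclusion of the tangent space of the last entry. -/
def singleLast (X : Fin (n + 1) → SU2) : sphereTangent (X (Fin.last n)) →ₗ[ℝ] tangentR X where
  toFun c := ⟨Pi.single (Fin.last n) (c : ℍ[ℝ]), fun i => by
    by_cases h : i = Fin.last n
    · subst h; rw [Pi.single_eq_same]; exact mem_sphereTangent.1 c.2
    · rw [Pi.single_eq_of_ne h]; simp⟩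
  map_add' c d := by ext1; simp [Pi.single_add]
  map_smul' t c := by ext1; simp [Pi.single_smul]

/-- The last entry of a tangent vector. -/
def lastEntry (X : Fin (n + 1) → SU2) : tangentR X →ₗ[ℝ] sphereTangent (X (Fin.last n)) where
  toFun a := ⟨(a : Fin (n + 1) → ℍ[ℝ]) (Fin.last n), mem_sphereTangent.2 (a.2 _)⟩
  map_add' _ _ := rfl
  map_smul' _ _ := rfl

/-- The new coordinate is c, the last entry minus the one before it. In the coordinates (a, c) the
new map 1 - dβ' is triangular, with diagonal blocks 1 - dβ and a map of positive determinant on the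
new tangent plane or space. -/
theorem HasSign.stabilize {β : Braid n} {X : Fin (n + 1) → SU2} (hX : braidAct SU2 β X = X)
    {β' : Braid (n + 1)} (hβ : IsStabilization β β') {ε : SignType} (h : HasSign β X ε) :
    HasSign β' (dupLast X) ε := by
  have hX' := fixed_dupLast hβ hX
  rw [hasSign_iff _ _ hX']
  have ht := (hasSign_iff β X hX ε).1 h
  have hdup : dupLast X (Fin.last n).succ = dupLast X (Fin.last n).castSucc := by
    rw [Fin.succ_last, dupLast_last, dupLast_castSucc]
  have hq := (X (Fin.last n)).ne_zero
  have hlast : Fin.last (n + 1) ≠ (Fin.last n).castSucc := by simp [Fin.ext_iff]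
  have hv : ∀ y, (dupLastEquiv X (orbitMap (dupLast X) y)).1 = orbitMap X y := by
    intro y
    ext1; funext i
    show _ - _ = _ - _
    rw [dupLast_castSucc]
  have hD : ∀ a, prodMap (dupLast X) ((dupLastEquiv X).symm (a, 0)) = prodMap X a := fun a =>
    congrArg imCoords (logProd_dupLast X a)
  have hσ : braidAct SU2 (σ (Fin.last n)) (dupLast X) = dupLast X := by
    rw [braidAct_sigma, sigmaAct_dupLast]
  have hσ' : braidAct SU2 (σ (Fin.last n))⁻¹ (dupLast X) = dupLast X := by
    rw [map_inv]; exact Equiv.Perm.inv_eq_iff_eq.2 hσ.symm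
  have hinit : (fun i : Fin (n + 1) => dupLast X i.castSucc) = X := funext fun i => by simp
  have hne : ∀ j : Fin (n + 1), j.castSucc ≠ (Fin.last n).succ := fun j => by
    rw [Fin.succ_last]; exact (Fin.castSucc_lt_last j).ne
  rcases hβ with rfl | rfl
  -- Positive crossing: the last entry becomes the old next-to-last one, so the block on c is the
  -- identity.
  · refine ht.stabilize (dupLastEquiv X) (lastEntry X)
      (-(actMap β X hX ∘ₗ singleLast X ∘ₗ sphereConj (X (Fin.last n)) (X (Fin.last n) : ℍ[ℝ])⁻¹
        (inv_ne_zero hq) (SU2.inv_comm _))) LinearMap.id (by simp) hv hD ?_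
    intro a c
    have h1 : ∀ z, dAct (addStrand β * σ (Fin.last n)) (dupLast X) z =
        dAct (addStrand β) (dupLast X) (dAct (σ (Fin.last n)) (dupLast X) z) := fun z => by
      rw [dAct_mul, hσ]
    have h2 : (fun i : Fin (n + 1) => dAct (σ (Fin.last n)) (dupLast X)
        (Fin.snoc (α := fun _ => ℍ[ℝ]) (a : Fin (n + 1) → ℍ[ℝ])
          ((c : ℍ[ℝ]) + (a : Fin (n + 1) → ℍ[ℝ]) (Fin.last n))) i.castSucc) =
        (a : Fin (n + 1) → ℍ[ℝ]) + Pi.single (Fin.last n)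
          (X (Fin.last n) * (c : ℍ[ℝ]) * (X (Fin.last n) : ℍ[ℝ])⁻¹) := by
      funext i
      rw [dAct_sigma _ _ hdup, if_neg (hne i)]
      simp only [Fin.castSucc_inj, Fin.succ_last, Fin.snoc_last, Fin.snoc_castSucc,
        dupLast_castSucc, Pi.add_apply]
      split_ifs with hi
      · subst hi; simp
      · simp [hi]
    refine Prod.ext (Subtype.ext ?_) (Subtype.ext ?_)
    · funext j
      show (Fin.snoc (α := fun _ => ℍ[ℝ]) (a : Fin (n + 1) → ℍ[ℝ])
          ((c : ℍ[ℝ]) + (a : Fin (n + 1) → ℍ[ℝ]) (Fin.last n)) : Fin (n + 1 + 1) → ℍ[ℝ])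
          j.castSucc - dAct _ _ _ j.castSucc = (a : Fin (n + 1) → ℍ[ℝ]) j - dAct β X a j +
          -(dAct β X (Pi.single (Fin.last n)
            ((X (Fin.last n) : ℍ[ℝ])⁻¹⁻¹ * c * (X (Fin.last n) : ℍ[ℝ])⁻¹)) j)
      rw [h1, (dAct_addStrand β _ _ j).1, hinit]
      erw [h2]
      rw [map_add, Fin.snoc_castSucc, inv_inv, Pi.add_apply]
      abel
    · show (Fin.snoc (α := fun _ => ℍ[ℝ]) (a : Fin (n + 1) → ℍ[ℝ])
          ((c : ℍ[ℝ]) + (a : Fin (n + 1) → ℍ[ℝ]) (Fin.last n)) : Fin (n + 1 + 1) → ℍ[ℝ])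
          (Fin.last _) - dAct _ _ _ (Fin.last _) = c
      rw [h1, (dAct_addStrand β _ _ (Fin.last n)).2, dAct_sigma _ _ hdup, if_neg hlast,
        if_pos (Fin.succ_last n).symm, Fin.snoc_last]
      show _ - (Fin.snoc (α := fun _ => ℍ[ℝ]) (a : Fin (n + 1) → ℍ[ℝ])
          ((c : ℍ[ℝ]) + (a : Fin (n + 1) → ℍ[ℝ]) (Fin.last n)) : Fin (n + 1 + 1) → ℍ[ℝ])
          (Fin.last n).castSucc = _
      rw [Fin.snoc_castSucc]
      abel
  -- Negative crossing: the last component of 1 - dβ' is q⁻¹cq for the repeated entry q, a rotation.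
  · refine ht.stabilize (dupLastEquiv X) (lastEntry X)
      (-(actMap β X hX ∘ₗ singleLast X)) (sphereConj (X (Fin.last n)) (X (Fin.last n)) hq rfl)
      (det_sphereConj_pos _) hv hD ?_
    intro a c
    have h1 : ∀ z, dAct (addStrand β * (σ (Fin.last n))⁻¹) (dupLast X) z =
        dAct (addStrand β) (dupLast X) (dAct (σ (Fin.last n))⁻¹ (dupLast X) z) := fun z => by
      rw [dAct_mul, hσ']
    have h2 : (fun i : Fin (n + 1) => dAct (σ (Fin.last n))⁻¹ (dupLast X)
        (Fin.snoc (α := fun _ => ℍ[ℝ]) (a : Fin (n + 1) → ℍ[ℝ])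
          ((c : ℍ[ℝ]) + (a : Fin (n + 1) → ℍ[ℝ]) (Fin.last n))) i.castSucc) =
        (a : Fin (n + 1) → ℍ[ℝ]) + Pi.single (Fin.last n) (c : ℍ[ℝ]) := by
      funext i
      rw [dAct_sigma_inv _ _ hdup, if_neg (hne i)]
      simp only [Fin.castSucc_inj, Fin.succ_last, Fin.snoc_last, Fin.snoc_castSucc, Pi.add_apply]
      split_ifs with hi
      · subst hi; simp [add_comm]
      · simp [hi]
    refine Prod.ext (Subtype.ext ?_) (Subtype.ext ?_)
    · funext j
      show (Fin.snoc (α := fun _ => ℍ[ℝ]) (a : Fin (n + 1) → ℍ[ℝ])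
          ((c : ℍ[ℝ]) + (a : Fin (n + 1) → ℍ[ℝ]) (Fin.last n)) : Fin (n + 1 + 1) → ℍ[ℝ])
          j.castSucc - dAct _ _ _ j.castSucc = (a : Fin (n + 1) → ℍ[ℝ]) j - dAct β X a j +
          -(dAct β X (Pi.single (Fin.last n) (c : ℍ[ℝ])) j)
      rw [h1, (dAct_addStrand β _ _ j).1, hinit]
      erw [h2]
      rw [map_add, Fin.snoc_castSucc, Pi.add_apply]
      abel
    · show (Fin.snoc (α := fun _ => ℍ[ℝ]) (a : Fin (n + 1) → ℍ[ℝ])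
          ((c : ℍ[ℝ]) + (a : Fin (n + 1) → ℍ[ℝ]) (Fin.last n)) : Fin (n + 1 + 1) → ℍ[ℝ])
          (Fin.last _) - dAct _ _ _ (Fin.last _) =
          (X (Fin.last n) : ℍ[ℝ])⁻¹ * c * (X (Fin.last n) : ℍ[ℝ])
      rw [h1, (dAct_addStrand β _ _ (Fin.last n)).2, dAct_sigma_inv _ _ hdup, if_neg hlast,
        if_pos (Fin.succ_last n).symm, Fin.succ_last, dupLast_castSucc]
      show _ - ((Fin.snoc (α := fun _ => ℍ[ℝ]) (a : Fin (n + 1) → ℍ[ℝ])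
          ((c : ℍ[ℝ]) + (a : Fin (n + 1) → ℍ[ℝ]) (Fin.last n)) : Fin (n + 1 + 1) → ℍ[ℝ])
          (Fin.last _) - _ * ((Fin.snoc (α := fun _ => ℍ[ℝ]) (a : Fin (n + 1) → ℍ[ℝ])
          ((c : ℍ[ℝ]) + (a : Fin (n + 1) → ℍ[ℝ]) (Fin.last n)) : Fin (n + 1 + 1) → ℍ[ℝ])
          (Fin.last _) - (Fin.snoc (α := fun _ => ℍ[ℝ]) (a : Fin (n + 1) → ℍ[ℝ])
          ((c : ℍ[ℝ]) + (a : Fin (n + 1) → ℍ[ℝ]) (Fin.last n)) : Fin (n + 1 + 1) → ℍ[ℝ])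
          (Fin.last n).castSucc) * _) = _
      rw [Fin.snoc_castSucc, Fin.snoc_last, add_sub_cancel_right]
      abel

/-- Some sign exists at an irreducible point; it passes to the stabilization, where uniqueness
identifies it. -/
theorem HasSign.of_stabilize {β : Braid n} {X : Fin (n + 1) → SU2} (hX : braidAct SU2 β X = X)
    (hirr : Irred X) {β' : Braid (n + 1)} (hβ : IsStabilization β β') {ε : SignType}
    (h : HasSign β' (dupLast X) ε) : HasSign β X ε := by
  obtain ⟨ε', h'⟩ := exists_hasSign hX hirr
  rwa [(h.unique (fixed_dupLast hβ hX) (h'.stabilize hX hβ))]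

end

section

variable {n μ : ℕ}

/-! ### Intersection points as classes of irreducible fixed tuples -/

/-- The irreducible tuples in `R^{α,c}` that are fixed by a braid. -/
abbrev FixedIrr (α : Fin μ → ℝ) (c : Fin (n + 1) → Fin μ) (β : Braid n) : Type :=
  {X : Fin (n + 1) → SU2 // X ∈ repSpace α c ∧ braidAct SU2 β X = X ∧ Irred X}

/-- Conjugacy of tuples. -/
instance fixedSetoid (α : Fin μ → ℝ) (c : Fin (n + 1) → Fin μ) (β : Braid n) :
    Setoid (FixedIrr α c β) where
  r X Y := ∃ g : SU2, Y.1 = fun i => g * X.1 i * g⁻¹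
  iseqv :=
    { refl := fun X => ⟨1, by simp⟩
      symm := by
        rintro X Y ⟨g, h⟩
        exact ⟨g⁻¹, funext fun i => by simp [h, mul_assoc]⟩
      trans := by
        rintro X Y Z ⟨g, h⟩ ⟨k, h'⟩
        exact ⟨k * g, funext fun i => by simp [h, h', mul_assoc]⟩ }

theorem irred_sum_elim {N : ℕ} {X : Fin N → SU2} : Irred (Sum.elim X X) ↔ Irred X := by
  constructor
  · rintro ⟨i | i, j | j, h⟩ <;> exact ⟨i, j, h⟩
  · rintro ⟨i, j, h⟩
    exact ⟨.inl i, .inl j, h⟩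

/-- The point of the diagonal given by an irreducible tuple. -/
def FixedIrr.diag {α : Fin μ → ℝ} {c : Fin (n + 1) → Fin μ} {β : Braid n} (X : FixedIrr α c β) :
    HIrr α c :=
  ⟨(X.1, X.1), ⟨X.2.1, X.2.1, rfl⟩, irred_sum_elim.2 X.2.2.2⟩

/-- The point of the graph in the class of p may be another representative; since the braid action
commutes with conjugation, p itself is on the graph. -/
theorem fixed_of_mem {α : Fin μ → ℝ} {c : Fin (n + 1) → Fin μ} {β : Braid n} {p : HIrr α c}
    (hp : p.1.2 = p.1.1) (h : (⟦p⟧ : HHat α c) ∈ GammaHat α c β) :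
    braidAct SU2 β p.1.1 = p.1.1 := by
  obtain ⟨q, hq, hq'⟩ := h
  obtain ⟨g, h1, h2⟩ := Quotient.exact hq
  have h3 : p.1.1 = fun i => g * q.1.1 i * g⁻¹ := funext h1
  have h4 : p.1.2 = fun i => g * q.1.2 i * g⁻¹ := funext h2
  rw [hp, hq'] at h4
  conv_lhs => rw [h3, braidAct_conj]
  exact h4.symm

/-- The intersection points are the conjugacy classes of irreducible fixed tuples. -/
def intersectionEquiv (α : Fin μ → ℝ) (c : Fin (n + 1) → Fin μ) (β : Braid n) :
    Quotient (fixedSetoid α c β) ≃ ↥(LambdaHat α c ∩ GammaHat α c β) :=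
  Equiv.ofBijective
    (Quotient.lift (fun X => ⟨⟦X.diag⟧, ⟨X.diag, rfl, rfl⟩, ⟨X.diag, rfl, X.2.2.1.symm⟩⟩) (by
      rintro X Y ⟨g, h⟩
      exact Subtype.ext (Quotient.sound ⟨g, congrFun h, congrFun h⟩)))
    (by
      constructor
      · rintro ⟨X⟩ ⟨Y⟩ h
        obtain ⟨g, h1, -⟩ := Quotient.exact (congrArg Subtype.val h)
        exact Quotient.sound ⟨g, funext h1⟩
      · rintro ⟨P, ⟨p, rfl, hp⟩, hΓ⟩
        refine ⟨⟦⟨p.1.1, p.2.1.1, fixed_of_mem hp hΓ, ?_⟩⟧, ?_⟩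
        · have := p.2.2
          rw [hp] at this
          exact irred_sum_elim.1 this
        · exact Subtype.ext (congrArg (Quotient.mk (conjSetoid α c))
            (Subtype.ext (Prod.ext rfl hp.symm))))

/-- All irreducible fixed tuples have positive sign, and there are `k` of them up to conjugacy. -/
structure HasPositivePoints (α : Fin μ → ℝ) (k : ℕ) (b : ColoredBraid μ) : Prop where
  hasSign : ∀ X : FixedIrr α b.color b.braid, HasSign b.braid X.1 1
  finite : Finite (Quotient (fixedSetoid α b.color b.braid))
  card : Nat.card (Quotient (fixedSetoid α b.color b.braid)) = k

variable {α : Fin μ → ℝ} {k : ℕ} {b : ColoredBraid μ}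

theorem HasPositivePoints.finite_inter (h : HasPositivePoints α k b) :
    (LambdaHat α b.color ∩ GammaHat α b.color b.braid).Finite := by
  have := h.finite
  have := Finite.of_equiv _ (intersectionEquiv α b.color b.braid)
  exact Set.toFinite _

theorem HasPositivePoints.hasSign_of_diag (h : HasPositivePoints α k b) {p : HIrr α b.color}
    (hp : p.1.2 = p.1.1) (hfix : braidAct SU2 b.braid p.1.1 = p.1.1) :
    HasSign b.braid p.1.1 1 := by
  have hirr := p.2.2
  rw [hp] at hirr
  exact h.hasSign ⟨p.1.1, p.2.1.1, hfix, irred_sum_elim.1 hirr⟩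

/-- Uniqueness of the sign at each fixed tuple empties the set of negative points, so the
intersection number is a plain count. -/
theorem HasPositivePoints.intersectionNumber_eq (h : HasPositivePoints α k b) :
    intersectionNumber b α = k := by
  have h1 : signedPoints b α 1 = LambdaHat α b.color ∩ GammaHat α b.color b.braid := by
    ext P
    refine ⟨fun hP => hP.1, fun hP => ⟨hP, ?_⟩⟩
    obtain ⟨p, rfl, hp⟩ := hP.1
    exact ⟨p, rfl, hp, h.hasSign_of_diag hp (fixed_of_mem hp hP.2)⟩
  have h2 : signedPoints b α (-1) = ∅ := by
    ext P
    simp only [Set.mem_empty_iff_false, iff_false]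
    rintro ⟨hP, p, rfl, hp, hs⟩
    have hfix := fixed_of_mem hp hP.2
    exact absurd ((h.hasSign_of_diag hp hfix).unique hfix hs) (by decide)
  rw [intersectionNumber, h1, h2, Set.ncard_empty, Nat.cast_zero, sub_zero, ← h.card,
    Nat.card_congr (intersectionEquiv α b.color b.braid), Nat.card_coe_set_eq]

/-! ### Invariance under Markov moves -/

theorem re_coe_conj (g x : SU2) : ((g * x * g⁻¹ : SU2) : ℍ[ℝ]).re = (x : ℍ[ℝ]).re := by
  rw [Submonoid.coe_mul, Submonoid.coe_mul, SU2.coe_inv, re_conj g.ne_zero]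

theorem braidAct_mem_repSpace {c c' : Fin (n + 1) → Fin μ} (γ : Braid n)
    (hc : c = c' ∘ braidPerm γ) {X : Fin (n + 1) → SU2} (hX : X ∈ repSpace α c) :
    braidAct SU2 γ X ∈ repSpace α c' := by
  intro j
  obtain ⟨g, hg⟩ := braidAct_isConj γ X j
  have := hX ((braidPerm γ)⁻¹ j)
  rw [hg, re_coe_conj, this, hc, Function.comp, ← Equiv.Perm.mul_apply, mul_inv_cancel,
    Equiv.Perm.one_apply]

/-- On commuting entries the conjugation in a crossing disappears, and the action only permutes
them. -/
theorem commute_braidAct {G : Type*} [Group G] (β : Braid n) : ∀ X : Fin (n + 1) → G,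
    (∀ i j, X i * X j = X j * X i) →
      ∀ i j, braidAct G β X i * braidAct G β X j = braidAct G β X j * braidAct G β X i := by
  induction β using Braid.induction with
  | one => intro X h; simpa using h
  | sigma i =>
    intro X h
    have : ∀ j, ∃ k, braidAct G (σ i) X j = X k := fun j => by
      rw [braidAct_sigma, sigmaAct_apply]
      split_ifs
      · exact ⟨i.succ, by rw [h, mul_inv_cancel_right]⟩
      · exact ⟨_, rfl⟩
      · exact ⟨_, rfl⟩
    choose f hf using this
    intro j k
    rw [hf, hf, h]
  | sigma_inv i =>
    intro X h
    have : ∀ j, ∃ k, braidAct G (σ i)⁻¹ X j = X k := fun j => by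
      rw [map_inv, braidAct_sigma, sigmaAct_inv_apply]
      split_ifs
      · exact ⟨_, rfl⟩
      · exact ⟨i.castSucc, by rw [mul_assoc, h, inv_mul_cancel_left]⟩
      · exact ⟨_, rfl⟩
    choose f hf using this
    intro j k
    rw [hf, hf, h]
  | mul β γ hβ hγ =>
    intro X h
    rw [braidAct_mul_apply]
    exact hβ _ (hγ X h)

theorem irred_braidAct (γ : Braid n) {X : Fin (n + 1) → SU2} (hX : Irred X) :
    Irred (braidAct SU2 γ X) := by
  by_contra h
  rw [Irred] at h
  push Not at h
  obtain ⟨i, j, hij⟩ := hX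
  have h1 := commute_braidAct γ⁻¹ _ h i j
  rw [← braidAct_mul_apply, inv_mul_cancel, map_one] at h1
  exact hij h1

/-- The action of a braid on fixed tuples. -/
def FixedIrr.act {c c' : Fin (n + 1) → Fin μ} {β : Braid n} (γ : Braid n)
    (hc : c = c' ∘ braidPerm γ) (X : FixedIrr α c β) : FixedIrr α c' (γ * β * γ⁻¹) :=
  ⟨braidAct SU2 γ X.1, braidAct_mem_repSpace γ hc X.2.1, fixed_conj γ X.2.2.1,
    irred_braidAct γ X.2.2.2⟩

theorem inv_act_act {G : Type*} [Group G] (γ : Braid n) (X : Fin (n + 1) → G) :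
    braidAct G γ⁻¹ (braidAct G γ X) = X := by
  rw [← braidAct_mul_apply, inv_mul_cancel, map_one]; rfl

/-- Conjugate braids have the same fixed tuples, up to the action of the conjugating braid. -/
def fixedEquivConj {c c' : Fin (n + 1) → Fin μ} {β : Braid n} (γ : Braid n)
    (hc : c = c' ∘ braidPerm γ) : FixedIrr α c β ≃ FixedIrr α c' (γ * β * γ⁻¹) where
  toFun := FixedIrr.act γ hc
  invFun Y := ⟨braidAct SU2 γ⁻¹ Y.1,
    braidAct_mem_repSpace γ⁻¹ (by
      funext j
      rw [hc, Function.comp, Function.comp, map_inv, ← Equiv.Perm.mul_apply, mul_inv_cancel,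
        Equiv.Perm.one_apply]) Y.2.1,
    by
      have := fixed_conj γ⁻¹ Y.2.2.1
      rwa [show γ⁻¹ * (γ * β * γ⁻¹) * γ⁻¹⁻¹ = β by group] at this,
    irred_braidAct γ⁻¹ Y.2.2.2⟩
  left_inv X := Subtype.ext (inv_act_act γ X.1)
  right_inv Y := Subtype.ext (by
    have := inv_act_act γ⁻¹ Y.1
    rwa [inv_inv] at this)

theorem HasPositivePoints.of_equiv {b b' : ColoredBraid μ}
    (e : FixedIrr α b.color b.braid ≃ FixedIrr α b'.color b'.braid)
    (he : ∀ X Y, X ≈ Y ↔ e X ≈ e Y)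
    (hs : ∀ X, HasSign b.braid X.1 1 ↔ HasSign b'.braid (e X).1 1) :
    HasPositivePoints α k b ↔ HasPositivePoints α k b' := by
  have e' : Quotient (fixedSetoid α b.color b.braid) ≃
    Quotient (fixedSetoid α b'.color b'.braid) := Quotient.congr e he
  constructor
  · rintro ⟨h1, h2, h3⟩
    refine ⟨fun Y => ?_, Finite.of_equiv _ e', ?_⟩
    · have := (hs (e.symm Y)).1 (h1 _)
      rwa [e.apply_symm_apply] at this
    · rw [← h3, Nat.card_congr e']
  · rintro ⟨h1, h2, h3⟩
    exact ⟨fun X => (hs X).2 (h1 _), Finite.of_equiv _ e'.symm, by rw [← h3, Nat.card_congr e']⟩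

theorem hasSign_conj_iff {β : Braid n} {X : Fin (n + 1) → SU2} (hX : braidAct SU2 β X = X)
    (γ : Braid n) (ε : SignType) :
    HasSign β X ε ↔ HasSign (γ * β * γ⁻¹) (braidAct SU2 γ X) ε := by
  refine ⟨fun h => h.conj hX γ, fun h => ?_⟩
  have := h.conj (fixed_conj γ hX) γ⁻¹
  rwa [show γ⁻¹ * (γ * β * γ⁻¹) * γ⁻¹⁻¹ = β by group, inv_act_act] at this

theorem rel_act_iff {c c' : Fin (n + 1) → Fin μ} {β : Braid n} (γ : Braid n)
    (hc : c = c' ∘ braidPerm γ) (X Y : FixedIrr α c β) :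
    X ≈ Y ↔ fixedEquivConj γ hc X ≈ fixedEquivConj γ hc Y := by
  refine exists_congr fun g => ?_
  show _ ↔ braidAct SU2 γ Y.1 = fun i => g * braidAct SU2 γ X.1 i * g⁻¹
  rw [← braidAct_conj, (braidAct SU2 γ).injective.eq_iff]

theorem dupLast_mem_repSpace {c : Fin (n + 1) → Fin μ} {X : Fin (n + 1) → SU2} :
    dupLast X ∈ repSpace α (Fin.snoc (α := fun _ => Fin μ) c (c (Fin.last n))) ↔
      X ∈ repSpace α c := by
  constructor
  · intro h i
    simpa only [dupLast_castSucc, Fin.snoc_castSucc] using h i.castSucc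
  · intro h i
    cases i using Fin.lastCases with
    | last => simpa only [dupLast_last, Fin.snoc_last] using h (Fin.last n)
    | cast i => simpa only [dupLast_castSucc, Fin.snoc_castSucc] using h i

theorem irred_dupLast {X : Fin (n + 1) → SU2} : Irred (dupLast X) ↔ Irred X := by
  constructor
  · have h : ∀ i, ∃ j, dupLast X i = X j := fun i => by
      cases i using Fin.lastCases with
      | last => exact ⟨_, dupLast_last X⟩
      | cast i => exact ⟨_, dupLast_castSucc X i⟩
    rintro ⟨i, j, hij⟩
    obtain ⟨i', hi⟩ := h i
    obtain ⟨j', hj⟩ := h j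
    exact ⟨i', j', by rwa [← hi, ← hj]⟩
  · rintro ⟨i, j, hij⟩
    exact ⟨i.castSucc, j.castSucc, by simpa using hij⟩

/-- The fixed tuples of a stabilization. -/
def fixedEquivStab {c : Fin (n + 1) → Fin μ} {β : Braid n} {β' : Braid (n + 1)}
    (hβ : IsStabilization β β') : FixedIrr α c β ≃
      FixedIrr α (Fin.snoc (α := fun _ => Fin μ) c (c (Fin.last n))) β' where
  toFun X := ⟨dupLast X.1, dupLast_mem_repSpace.2 X.2.1, fixed_dupLast hβ X.2.2.1,
    irred_dupLast.2 X.2.2.2⟩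
  invFun Y := ⟨fun i => Y.1 i.castSucc, by
      have h := eq_dupLast_of_fixed hβ Y.2.2.1
      obtain ⟨h1, -, h3⟩ := Y.2
      rw [h.1] at h1 h3
      exact ⟨dupLast_mem_repSpace.1 h1, h.2, irred_dupLast.1 h3⟩⟩
  left_inv X := Subtype.ext (funext fun i => dupLast_castSucc X.1 i)
  right_inv Y := Subtype.ext (eq_dupLast_of_fixed hβ Y.2.2.1).1.symm

theorem dupLast_eq_conj_iff {G : Type*} [Group G] (g : G) (X Y : Fin (n + 1) → G) :
    (Y = fun i => g * X i * g⁻¹) ↔ dupLast Y = fun i => g * dupLast X i * g⁻¹ := by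
  constructor
  · rintro rfl
    funext i
    cases i using Fin.lastCases <;> simp
  · intro h
    funext i
    simpa using congrFun h i.castSucc

/-- For each move there is a bijection of fixed irreducible tuples that respects conjugacy and
signs: the action of γ for a conjugation, the repetition of the last entry for a stabilization. -/
theorem MarkovMove.hasPositivePoints_iff {b b' : ColoredBraid μ} (h : MarkovMove b b') :
    HasPositivePoints α k b ↔ HasPositivePoints α k b' := by
  cases h with
  | conj γ hc hβ =>
    subst hβ
    exact HasPositivePoints.of_equiv (fixedEquivConj γ hc) (rel_act_iff γ hc)
      fun X => hasSign_conj_iff X.2.2.1 γ 1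
  | stab hc hβ =>
    subst hc
    exact HasPositivePoints.of_equiv (fixedEquivStab hβ)
      (fun X Y => exists_congr fun g => dupLast_eq_conj_iff g X.1 Y.1)
      fun X => ⟨fun h => h.stabilize X.2.2.1 hβ, fun h => h.of_stabilize X.2.2.1 X.2.2.2 hβ⟩

/-- Equal closures are joined by a chain of Markov moves and their inverses. In particular the braid
picked by choice in `benardConway` inherits the property. -/
theorem HasPositivePoints.of_closure_eq {b b' : ColoredBraid μ} (h : HasPositivePoints α k b)
    (hb : b'.closure = b.closure) : HasPositivePoints α k b' := by
  have h1 := Quot.eqvGen_exact hb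
  have h2 : HasPositivePoints α k b' ↔ HasPositivePoints α k b := by
    clear hb h
    induction h1 with
    | rel _ _ h => exact h.hasPositivePoints_iff
    | refl => exact Iff.rfl
    | symm _ _ _ ih => exact ih.symm
    | trans _ _ _ _ _ ih ih' => exact ih.trans ih'
  exact h2.2 h

theorem HasPositivePoints.benardConway_eq (h : HasPositivePoints α k b) :
    benardConway b.closure α = k :=
  (h.of_closure_eq (Quot.exists_rep b.closure).choose_spec).intersectionNumber_eq

theorem HasPositivePoints.wellDefined (h : HasPositivePoints α k b) :
    WellDefined b.closure α where
  isCompact b' hb := (h.of_closure_eq hb).finite_inter.isCompact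
  transverse b' hb p hp hfix := by
    have hfix' : braidAct SU2 b'.braid p.1.1 = p.1.1 := hfix.symm.trans hp
    exact ((h.of_closure_eq hb).hasSign_of_diag hp hfix').transverseAt hfix' one_ne_zero
  finite b' hb := (h.of_closure_eq hb).finite_inter
  eq_intersectionNumber b' hb := by
    rw [h.benardConway_eq, (h.of_closure_eq hb).intersectionNumber_eq]

end

section

/-! ### The full twists on two strands -/

/-- Two crossings conjugate both entries by X₀X₁, and this product is unchanged, so powers
accumulate. -/
theorem braidAct_twist {G : Type*} [Group G] (X : Fin 2 → G) (k : ℕ) :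
    braidAct G (σ (0 : Fin 1) ^ (2 * k)) X =
      fun j => (X 0 * X 1) ^ k * X j * ((X 0 * X 1) ^ k)⁻¹ := by
  have h2 : ∀ X : Fin 2 → G, braidAct G (σ (0 : Fin 1) ^ 2) X =
      fun j => (X 0 * X 1) * X j * (X 0 * X 1)⁻¹ := by
    intro X
    rw [pow_two, braidAct_mul_apply, braidAct_sigma]
    funext j
    fin_cases j <;> simp [sigmaAct_apply, mul_assoc]
  induction k generalizing X with
  | zero => simp
  | succ k ih =>
    rw [mul_add, mul_one, pow_add, braidAct_mul_apply, ih, h2]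
    funext j
    have hP : X 0 * X 1 * X 0 * (X 0 * X 1)⁻¹ * (X 0 * X 1 * X 1 * (X 0 * X 1)⁻¹) =
      X 0 * X 1 := by group
    simp only [hP]
    rw [pow_succ]
    group

theorem extAct_twist (k : ℕ) {x : Fin 2 → ℍ[ℝ]} (hx : x ∈ nonzeroTuples 2) (j : Fin 2) :
    extAct (σ (0 : Fin 1) ^ (2 * k)) x j =
      (x 0 * x 1) ^ k * x j * ((x 0 * x 1) ^ k)⁻¹ := by
  rw [extAct, braidAct_twist]
  simp [coe_toUnit (hx _)]

/-- A quaternion that commutes with two non-commuting quaternions is real. -/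
theorem eq_coe_of_commute {x y r : ℍ[ℝ]} (hxy : x * y ≠ y * x) (hx : r * x = x * r)
    (hy : r * y = y * r) : r = (r.re : ℝ) := by
  by_contra h
  have h0 : r - (r.re : ℝ) ≠ 0 := sub_ne_zero.2 h
  refine hxy (commute_of_commute_imag (e := r - (r.re : ℝ)) (by simp) h0 ?_ ?_)
  · rw [sub_mul, mul_sub, hx, Quaternion.coe_commutes]
  · rw [sub_mul, mul_sub, hy, Quaternion.coe_commutes]

/-- A quaternion that commutes with an imaginary quaternion `p` lies in the span of `1`, `p`. -/
theorem commutator_eq_of_commute {p s : ℍ[ℝ]} (hp : p.re = 0) (hp0 : p ≠ 0) (hs : s * p = p * s)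
    (x : ℍ[ℝ]) : s * x - x * s = (-(s * p).re / ‖p‖ ^ 2) • (p * x - x * p) := by
  have hn : ‖p‖ ^ 2 ≠ 0 := pow_ne_zero 2 (norm_ne_zero_iff.2 hp0)
  have hn' : ‖p‖ ^ 2 = p.imI ^ 2 + p.imJ ^ 2 + p.imK ^ 2 := by
    rw [← real_inner_self_eq_norm_sq, Quaternion.inner_def]
    simp [hp]; ring
  have h1 := congrArg (fun q => q.imI) hs
  have h2 := congrArg (fun q => q.imJ) hs
  have h3 := congrArg (fun q => q.imK) hs
  simp only [Quaternion.imI_mul, Quaternion.imJ_mul, Quaternion.imK_mul, hp] at h1 h2 h3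
  -- As p is imaginary, p² = -‖p‖²; hence the coefficient of p in s is -Re(sp)/‖p‖², and the real
  -- part of s drops out of the commutator.
  have key : ‖p‖ ^ 2 • (s * x - x * s) = (-(s * p).re) • (p * x - x * p) := by
    rw [hn']
    ext <;>
    simp only [Quaternion.re_smul, Quaternion.imI_smul, Quaternion.imJ_smul, Quaternion.imK_smul,
      Quaternion.re_sub, Quaternion.imI_sub, Quaternion.imJ_sub, Quaternion.imK_sub,
      Quaternion.re_mul, Quaternion.imI_mul, Quaternion.imJ_mul, Quaternion.imK_mul, hp,
      smul_eq_mul]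
    · ring
    · grind
    · grind
    · grind
  rw [div_eq_inv_mul, mul_smul, ← key, smul_smul, inv_mul_cancel₀ hn, one_smul]

/-- The derivative of the `k`-th power. -/
def dPow (k : ℕ) (P : ℍ[ℝ]) : ℍ[ℝ] →L[ℝ] ℍ[ℝ] := fderiv ℝ (fun q => q ^ k) P

theorem hasFDerivAt_dPow (k : ℕ) (P : ℍ[ℝ]) : HasFDerivAt (fun q : ℍ[ℝ] => q ^ k) (dPow k P) P :=
  DifferentiableAt.hasFDerivAt (by fun_prop)

theorem dPow_succ (k : ℕ) (P h : ℍ[ℝ]) : dPow (k + 1) P h = P ^ k * h + dPow k P h * P := by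
  have h1 := (hasFDerivAt_dPow k P).mul' (hasFDerivAt_id P)
  have h2 : (fun q : ℍ[ℝ] => q ^ (k + 1)) = (fun q => q ^ k) * id := funext fun q => pow_succ q k
  have h3 := hasFDerivAt_dPow (k + 1) P
  rw [h2] at h3
  rw [h3.unique h1]
  rfl

theorem dPow_succ' (k : ℕ) (P h : ℍ[ℝ]) : dPow (k + 1) P h = P * dPow k P h + h * P ^ k := by
  have h1 := (hasFDerivAt_id P).mul' (hasFDerivAt_dPow k P)
  have h2 : (fun q : ℍ[ℝ] => q ^ (k + 1)) = id * (fun q => q ^ k) := funext fun q => pow_succ' q k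
  have h3 := hasFDerivAt_dPow (k + 1) P
  rw [h2] at h3
  rw [h3.unique h1]
  rfl

/-- The derivative of the power is the sum of the k terms P^i h P^(k-1-i). Under the real part,
which is cyclic, all contribute equally against a y commuting with P. -/
theorem dPow_re (k : ℕ) (P h : ℍ[ℝ]) : ∀ y : ℍ[ℝ], y * P = P * y →
    (dPow k P h * y * P).re = k * (h * P ^ k * y).re := by
  induction k with
  | zero =>
    intro y _
    have : dPow 0 P h = 0 := by simp [dPow]
    simp [this]
  | succ k ih =>
    intro y hy
    have hc : P ^ k * y = y * P ^ k := ((show Commute y P from hy).pow_right k).symm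
    rw [dPow_succ, add_mul, add_mul, Quaternion.re_add]
    have h1 : (dPow k P h * P * y * P).re = k * (h * P ^ k * (P * y)).re := by
      rw [← ih (P * y) (by rw [mul_assoc, hy])]
      simp only [mul_assoc]
    have h2 : (P ^ k * h * y * P).re = (h * P ^ k * (P * y)).re := by
      rw [mul_assoc, mul_assoc, re_mul_comm, ← hy, mul_assoc, mul_assoc, mul_assoc, ← mul_assoc y,
        hy, ← mul_assoc (P ^ k), ← pow_succ, mul_assoc P, ← hc, ← mul_assoc P, ← pow_succ']
    rw [h1, h2, pow_succ, mul_assoc h, mul_assoc]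
    push_cast
    simp only [mul_assoc]
    ring

variable {X : Fin 2 → SU2} {ℓ : ℕ}

theorem tupleProd_two {M : Type*} [Monoid M] (x : Fin 2 → M) : tupleProd x = x 0 * x 1 := by
  simp [tupleProd]

/-- The derivative of a power of the full twist at an irreducible fixed pair. -/
theorem dAct_twist (hX : braidAct SU2 (σ (0 : Fin 1) ^ (2 * ℓ)) X = X)
    (hirr : X 0 * X 1 ≠ X 1 * X 0) {p : ℍ[ℝ]}
    (hp : p = (X 0 * X 1 : ℍ[ℝ]) - ((X 0 * X 1 : ℍ[ℝ]).re : ℝ)) (z : Fin 2 → ℍ[ℝ]) :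
    z - dAct (σ (0 : Fin 1) ^ (2 * ℓ)) X z =
      (ℓ * (logProd X z * p).re / ‖p‖ ^ 2) • orbitVec X p := by
  set P : ℍ[ℝ] := X 0 * X 1 with hP
  have hP0 : P ≠ 0 := mul_ne_zero (X 0).ne_zero (X 1).ne_zero
  have hirr' : (X 0 : ℍ[ℝ]) * X 1 ≠ X 1 * X 0 := fun h => hirr (Subtype.ext h)
  have hcomm : ∀ j, P ^ ℓ * X j = X j * P ^ ℓ := fun j => by
    have h := congrFun hX j
    rw [braidAct_twist] at h
    have h' := congrArg Subtype.val (mul_inv_eq_iff_eq_mul.1 h)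
    simpa using h'
  set r : ℝ := (P ^ ℓ).re with hr
  -- Being fixed means that P^ℓ commutes with both entries, and these do not commute with each
  -- other.
  have hPr : P ^ ℓ = (r : ℝ) := eq_coe_of_commute hirr' (hcomm 0) (hcomm 1)
  have hr0 : r ≠ 0 := by
    intro h0
    rw [h0] at hPr
    exact pow_ne_zero ℓ hP0 (hPr.trans Quaternion.coe_zero)
  have hp_re : p.re = 0 := by rw [hp]; simp
  have hp0 : p ≠ 0 := by
    intro h0
    rw [h0, eq_comm, sub_eq_zero] at hp
    have h1 : P * X 0 = X 0 * P := by rw [hp, Quaternion.coe_commutes]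
    rw [hP, mul_assoc] at h1
    exact hirr' (mul_left_cancel₀ (X 0).ne_zero h1).symm
  have hpP : p * P = P * p := by rw [hp, sub_mul, mul_sub, Quaternion.coe_commutes]
  set h := dProd X z with hh
  set S := dPow ℓ P h with hS
  -- Differentiating P^(ℓ+1) as P^ℓ · P and as P · P^ℓ gives two expressions; the terms with the
  -- real number P^ℓ cancel.
  have hSP : S * P = P * S := by
    have h1 := (dPow_succ ℓ P h).symm.trans (dPow_succ' ℓ P h)
    rw [hPr, ← Quaternion.coe_commutes, add_comm] at h1
    exact add_right_cancel h1
  have hSp : S * p = p * S := by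
    rw [hp, sub_mul, mul_sub, hSP, Quaternion.coe_commutes]
  have hSre : (S * p).re = ℓ * r * (logProd X z * p).re := by
    -- `dPow_re` is applied with y = pP⁻¹, which commutes with P and cancels its extra factor.
    have hc : p * P⁻¹ * P = P * (p * P⁻¹) := by
      rw [inv_mul_cancel_right₀ hP0, ← mul_assoc, ← hpP, mul_inv_cancel_right₀ hP0]
    have h1 := dPow_re ℓ P h (p * P⁻¹) hc
    have h2 : p * P⁻¹ = P⁻¹ * p := by
      rw [← mul_right_inj' hP0, ← hc, inv_mul_cancel_right₀ hP0, mul_inv_cancel_left₀ hP0]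
    rw [mul_assoc, inv_mul_cancel_right₀ hP0, hPr, ← Quaternion.coe_commutes, mul_assoc,
      Quaternion.coe_mul_eq_smul, Quaternion.re_smul, h2, ← mul_assoc] at h1
    have h3 : ((X 0 * X 1 : SU2) : ℍ[ℝ]) = P := rfl
    rw [h1, logProd, tupleProd_two, h3, smul_eq_mul, ← hh]
    ring
  have hG : HasFDerivAt (fun x : Fin 2 → ℍ[ℝ] => (x 0 * x 1) ^ ℓ) (dPow ℓ P ∘L dProd X)
      (toH X) := by
    have h1 : HasFDerivAt (fun q : ℍ[ℝ] => q ^ ℓ) (dPow ℓ P) (tupleProd (toH X)) := by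
      rw [tupleProd_two]; exact hasFDerivAt_dPow ℓ P
    have h2 := h1.comp (toH X) (hasFDerivAt_tupleProd X)
    have h3 : (fun x : Fin 2 → ℍ[ℝ] => (x 0 * x 1) ^ ℓ) =
      (fun q : ℍ[ℝ] => q ^ ℓ) ∘ tupleProd := funext fun x => by
        rw [Function.comp, tupleProd_two]
    rw [h3]; exact h2
  have hGX : (toH X 0 * toH X 1) ^ ℓ = (r : ℍ[ℝ]) := hPr
  have hr0' : (r : ℍ[ℝ]) ≠ 0 := by
    rw [← hPr]; exact pow_ne_zero ℓ hP0
  funext j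
  have hi := (hasFDerivAt_inv' (𝕜 := ℝ) (x := (toH X 0 * toH X 1) ^ ℓ)
    (by rw [hGX]; exact hr0')).comp (toH X) hG
  have h2 := (hG.mul' (hasFDerivAt_apply (𝕜 := ℝ) j (toH X))).mul' hi
  have h1 := (hasFDerivAt_pi'.1 (hasFDerivAt_extAct (σ (0 : Fin 1) ^ (2 * ℓ)) X)) j
  have h3 := h2.congr_of_eventuallyEq
      (f₁ := fun x => extAct (σ (0 : Fin 1) ^ (2 * ℓ)) x j) (by
    filter_upwards [nonzeroTuples_mem_nhds X] with y hy using extAct_twist ℓ hy j)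
  have h4 : dAct (σ (0 : Fin 1) ^ (2 * ℓ)) X z j =
      r * X j * (-((r : ℍ[ℝ])⁻¹ * S * (r : ℍ[ℝ])⁻¹)) + (r * z j + S * X j) * (r : ℍ[ℝ])⁻¹ := by
    refine (DFunLike.congr_fun (h1.unique h3) z).trans ?_
    have hGX' : ((X 0 : ℍ[ℝ]) * (X 1 : ℍ[ℝ])) ^ ℓ = (r : ℍ[ℝ]) := hPr
    simp [hGX', toH, ← hh, ← hS, add_mul]
  have hrinv : (r : ℍ[ℝ])⁻¹ = ((r⁻¹ : ℝ) : ℍ[ℝ]) := (Quaternion.coe_inv r).symm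
  -- Near X the action is conjugation by a power with value r and derivative S. Since r is real, the
  -- derivative is z plus r⁻¹ times the commutator of S and X.
  have h5 : z j - dAct (σ (0 : Fin 1) ^ (2 * ℓ)) X z j = (-r⁻¹) • (S * X j - X j * S) := by
    rw [h4, hrinv]
    simp only [Quaternion.coe_mul_eq_smul, Quaternion.mul_coe_eq_smul, smul_mul_assoc,
      mul_smul_comm, mul_neg, smul_smul,
      mul_inv_cancel₀ hr0, one_smul, neg_smul, smul_sub, add_mul]
    simp [hr0]
    abel
  rw [Pi.sub_apply, h5, commutator_eq_of_commute hp_re hp0 hSp, hSre, smul_smul, Pi.smul_apply,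
    orbitVec]
  congr 1
  field_simp

/-- Conjugating all entries conjugates the product: the terms of the product rule telescope. -/
theorem logProd_orbitVec : ∀ {N : ℕ} (X : Fin N → SU2) (e : ℍ[ℝ]),
    logProd X (orbitVec X e) =
      e - ((tupleProd X : SU2) : ℍ[ℝ]) * e * ((tupleProd X : SU2) : ℍ[ℝ])⁻¹
  | 0, X, e => by
    have : orbitVec X e = 0 := Subsingleton.elim _ _
    rw [this, logProd_zero]
    simp [tupleProd]
  | N + 1, X, e => by
    rw [logProd_succ, tupleProd_succ X]
    have h := logProd_orbitVec (fun i : Fin N => X i.succ) e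
    have h' : (fun i : Fin N => orbitVec X e i.succ) = orbitVec (fun i : Fin N => X i.succ) e := rfl
    rw [h', h, orbitVec, Submonoid.coe_mul, mul_inv_rev, sub_mul,
      mul_inv_cancel_right₀ (X 0).ne_zero, mul_sub, sub_mul]
    simp only [mul_assoc]
    abel

end

section

/-! ### Positivity of the intersection points of the torus link -/

/-- The tangent space is the orthogonal complement of the span of 1 and q, which is a plane when q
is not real. -/
theorem finrank_sphereTangent {q : SU2} (hq : ∀ r : ℝ, (q : ℍ[ℝ]) ≠ r) :
    Module.finrank ℝ (sphereTangent q) = 2 := by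
  have h1 : sphereTangent q = (Submodule.span ℝ {(1 : ℍ[ℝ]), (q : ℍ[ℝ])})ᗮ := by
    ext z
    have e1 : inner ℝ (1 : ℍ[ℝ]) z = z.re := by rw [real_inner_comm, Quaternion.inner_def]; simp
    have e2 : inner ℝ (q : ℍ[ℝ]) z = (z * star (q : ℍ[ℝ])).re := by
      rw [real_inner_comm, Quaternion.inner_def]
    rw [mem_sphereTangent, Submodule.mem_orthogonal, ← e1, ← e2]
    constructor
    · rintro ⟨h1, h2⟩ u hu
      obtain ⟨s, t, rfl⟩ := Submodule.mem_span_pair.1 hu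
      rw [inner_add_left, real_inner_smul_left, real_inner_smul_left, h1, h2]
      simp
    · intro h
      exact ⟨h _ (Submodule.subset_span (by simp)), h _ (Submodule.subset_span (by simp))⟩
  have h2 : Module.finrank ℝ (Submodule.span ℝ {(1 : ℍ[ℝ]), (q : ℍ[ℝ])}) = 2 := by
    have hli : LinearIndependent ℝ ![(1 : ℍ[ℝ]), (q : ℍ[ℝ])] := by
      rw [LinearIndependent.pair_iff' one_ne_zero]
      intro r h
      refine hq r ?_
      rw [← h, ← Quaternion.coe_mul_eq_smul, mul_one]
    have := finrank_span_eq_card hli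
    rwa [Matrix.range_cons, Matrix.range_cons, Matrix.range_empty, Set.union_empty,
      Set.singleton_union, Fintype.card_fin] at this
  have h3 := Submodule.finrank_add_finrank_orthogonal
    (Submodule.span ℝ {(1 : ℍ[ℝ]), (q : ℍ[ℝ])})
  rw [← h1, h2, Quaternion.finrank_eq_four] at h3
  omega

variable {X : Fin 2 → SU2} {ℓ : ℕ}

theorem finrank_tangentR_two (hirr : X 0 * X 1 ≠ X 1 * X 0) :
    Module.finrank ℝ (tangentR X) = 4 := by
  have h0 : ∀ r : ℝ, (X 0 : ℍ[ℝ]) ≠ r := fun r h =>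
    hirr (Subtype.ext (by simp [h, Quaternion.coe_commutes]))
  have h1 : ∀ r : ℝ, (X 1 : ℍ[ℝ]) ≠ r := fun r h =>
    hirr (Subtype.ext (by simp [h, Quaternion.coe_commutes]))
  let e : tangentR X ≃ₗ[ℝ] sphereTangent (X 0) × sphereTangent (X 1) :=
    { toFun := fun z => (⟨(z : Fin 2 → ℍ[ℝ]) 0, mem_sphereTangent.2 (z.2 0)⟩,
        ⟨(z : Fin 2 → ℍ[ℝ]) 1, mem_sphereTangent.2 (z.2 1)⟩)
      map_add' := fun _ _ => rfl
      map_smul' := fun _ _ => rfl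
      invFun := fun p => ⟨![p.1, p.2], Fin.forall_fin_two.2
        ⟨mem_sphereTangent.1 p.1.2, mem_sphereTangent.1 p.2.2⟩⟩
      left_inv := fun z => by
        ext1; funext i
        fin_cases i <;> rfl
      right_inv := fun p => rfl }
  rw [e.finrank_eq, Module.finrank_prod, finrank_sphereTangent h0, finrank_sphereTangent h1]

theorem SU2.sum_sq (q : SU2) : (q : ℍ[ℝ]).re ^ 2 + (imCoords q 0 ^ 2 + imCoords q 1 ^ 2 +
    imCoords q 2 ^ 2) = 1 := by
  have h := congrArg (fun z => z.re) (Unitary.coe_mul_star_self q)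
  have h' : ((q : ℍ[ℝ]) * star (q : ℍ[ℝ])).re = 1 := h
  rw [Quaternion.re_mul] at h'
  simp [imCoords] at h' ⊢
  linarith

-- The map is y ↦ y - PyP⁻¹, expanded for P = c + p with c² + |p|² = 1.
open scoped Matrix in
theorem prodMap_orbitMap {N : ℕ} (X : Fin N → SU2) (y : Fin 3 → ℝ) (P : SU2)
    (hP : P = tupleProd X) (p : Fin 3 → ℝ) (hp : p = imCoords P) :
    prodMap X (orbitMap X y) = (2 * (p 0 ^ 2 + p 1 ^ 2 + p 2 ^ 2)) • y -
      (2 * (P : ℍ[ℝ]).re) • (crossProduct p y) - (2 * (p ⬝ᵥ y)) • p := by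
  have h1 := P.sum_sq
  rw [← hp] at h1
  rw [prodMap_apply, coe_orbitMap, logProd_orbitVec, ← hP, ← SU2.star_eq_inv]
  have hI : p 0 = (P : ℍ[ℝ]).imI := by rw [hp]; rfl
  have hJ : p 1 = (P : ℍ[ℝ]).imJ := by rw [hp]; rfl
  have hK : p 2 = (P : ℍ[ℝ]).imK := by rw [hp]; rfl
  rw [hI, hJ, hK] at h1
  have hdot : p ⬝ᵥ y = p 0 * y 0 + p 1 * y 1 + p 2 * y 2 := by
    simp [dotProduct, Fin.sum_univ_three]
  rw [hdot, cross_apply]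
  funext i
  fin_cases i <;>
    simp only [imCoords, LinearMap.coe_mk, AddHom.coe_mk, Pi.sub_apply, Pi.smul_apply, smul_eq_mul,
      hI, hJ, hK, Quaternion.re_mul, Quaternion.imI_mul, Quaternion.imJ_mul, Quaternion.imK_mul,
      Quaternion.imI_sub, Quaternion.imJ_sub, Quaternion.imK_sub, Quaternion.re_star,
      Quaternion.imI_star, Quaternion.imJ_star, Quaternion.imK_star, imag_re, imag_imI, imag_imJ,
      imag_imK, Fin.zero_eta, Fin.mk_one, Fin.reduceFinMk, Matrix.cons_val_zero, Matrix.cons_val_one,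
      Matrix.cons_val]
  · linear_combination (y 0) * -h1
  · linear_combination (y 1) * -h1
  · linear_combination (y 2) * -h1

end

/-! ### An explicit right inverse of the product map and the sign for the torus braid. -/

section

open scoped Matrix in
/-- The map `y ↦ (y + t p × y) / 2`. -/
def halfTurn (p : Fin 3 → ℝ) (t : ℝ) : (Fin 3 → ℝ) →ₗ[ℝ] (Fin 3 → ℝ) :=
  (2⁻¹ : ℝ) • (LinearMap.id + t • crossProduct p)

theorem halfTurn_apply (p : Fin 3 → ℝ) (t : ℝ) (y : Fin 3 → ℝ) :
    halfTurn p t y = (2⁻¹ : ℝ) • (y + t • crossProduct p y) := rfl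

theorem halfTurn_zero (p : Fin 3 → ℝ) (t : ℝ) (y : Fin 3 → ℝ) :
    halfTurn p t y 0 = 2⁻¹ * (y 0 + t * (p 1 * y 2 - p 2 * y 1)) := by
  rw [halfTurn_apply, cross_apply]; rfl

theorem halfTurn_one (p : Fin 3 → ℝ) (t : ℝ) (y : Fin 3 → ℝ) :
    halfTurn p t y 1 = 2⁻¹ * (y 1 + t * (p 2 * y 0 - p 0 * y 2)) := by
  rw [halfTurn_apply, cross_apply]; rfl

theorem halfTurn_two (p : Fin 3 → ℝ) (t : ℝ) (y : Fin 3 → ℝ) :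
    halfTurn p t y 2 = 2⁻¹ * (y 2 + t * (p 0 * y 1 - p 1 * y 0)) := by
  rw [halfTurn_apply, cross_apply]; rfl

-- This verifies that y ↦ v(`halfTurn p (c / s) y`) + s⁻¹(p·y) a is a right inverse of D when D a =
-- p. The image of D v is orthogonal to p, so the last term supplies the component along p.
open scoped Matrix in
theorem prodMap_halfTurn_apply (p y : Fin 3 → ℝ) (s c : ℝ)
    (hs : s = p 0 ^ 2 + p 1 ^ 2 + p 2 ^ 2) (hs0 : s ≠ 0) (hc : c ^ 2 + s = 1) :
    (2 * s) • halfTurn p (c / s) y - (2 * c) • crossProduct p (halfTurn p (c / s) y) -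
      (2 * (p ⬝ᵥ halfTurn p (c / s) y)) • p +
      (s⁻¹ * (p 0 * y 0 + p 1 * y 1 + p 2 * y 2)) • p = y := by
  have hdot : ∀ z : Fin 3 → ℝ, p ⬝ᵥ z = p 0 * z 0 + p 1 * z 1 + p 2 * z 2 := fun z => by
    simp [dotProduct, Fin.sum_univ_three]
  have hk : s * s⁻¹ = 1 := mul_inv_cancel₀ hs0
  rw [hdot, cross_apply, div_eq_mul_inv]
  generalize s⁻¹ = k at hk ⊢
  funext i
  fin_cases i <;>
    simp only [Pi.add_apply, Pi.sub_apply, Pi.smul_apply, smul_eq_mul, halfTurn_zero, halfTurn_one,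
      halfTurn_two, Fin.zero_eta, Fin.mk_one, Fin.reduceFinMk, Matrix.cons_val_zero,
      Matrix.cons_val_one, Matrix.cons_val]
  · linear_combination (c * (p 1 * y 2 - p 2 * y 1) + c ^ 2 * y 0 +
      (p 0 * y 0 + p 1 * y 1 + p 2 * y 2) * p 0) * hk - c ^ 2 * k * y 0 * hs +
      (y 0 - k * (p 0 * y 0 + p 1 * y 1 + p 2 * y 2) * p 0) * hc
  · linear_combination (c * (p 2 * y 0 - p 0 * y 2) + c ^ 2 * y 1 +
      (p 0 * y 0 + p 1 * y 1 + p 2 * y 2) * p 1) * hk - c ^ 2 * k * y 1 * hs +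
      (y 1 - k * (p 0 * y 0 + p 1 * y 1 + p 2 * y 2) * p 1) * hc
  · linear_combination (c * (p 0 * y 1 - p 1 * y 0) + c ^ 2 * y 2 +
      (p 0 * y 0 + p 1 * y 1 + p 2 * y 2) * p 2) * hk - c ^ 2 * k * y 2 * hs +
      (y 2 - k * (p 0 * y 0 + p 1 * y 1 + p 2 * y 2) * p 2) * hc

/-- The scalar product with a vector. -/
def dotMap (p : Fin 3 → ℝ) : (Fin 3 → ℝ) →ₗ[ℝ] ℝ :=
  ∑ k, p k • LinearMap.proj k

theorem dotMap_apply (p y : Fin 3 → ℝ) : dotMap p y = p 0 * y 0 + p 1 * y 1 + p 2 * y 2 := by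
  simp [dotMap, Fin.sum_univ_three]

theorem dotMap_single (p : Fin 3 → ℝ) (k : Fin 3) : dotMap p (Pi.single k 1) = p k := by
  fin_cases k <;> simp [dotMap_apply]

/-- The upper left block K has determinant (1 + t²s)/8, and its Schur complement is 2d because K⁻¹p
= 2p. -/
theorem det_halfTurn_border (p : Fin 3 → ℝ) (t s d : ℝ) (hs : s = p 0 ^ 2 + p 1 ^ 2 + p 2 ^ 2)
    (hs0 : 0 < s) (hd : 0 < d) :
    0 < (Matrix.fromBlocks (Matrix.of fun i k : Fin 3 => halfTurn p t (Pi.single k 1) i)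
      (Matrix.of fun i (_ : Fin 1) => -d * p i) (Matrix.of fun (_ : Fin 1) k => p k / s) 0).det := by
  set K : Matrix (Fin 3) (Fin 3) ℝ := Matrix.of fun i k => halfTurn p t (Pi.single k 1) i with hK
  have hdet : K.det = (1 + t ^ 2 * s) / 8 := by
    rw [Matrix.det_fin_three, hs]
    simp only [hK, Matrix.of_apply, halfTurn_zero, halfTurn_one, halfTurn_two, Pi.single_apply]
    simp
    ring
  have hdet0 : 0 < K.det := by rw [hdet]; positivity
  have hunit : IsUnit K.det := isUnit_iff_ne_zero.2 hdet0.ne'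
  let _ := K.invertibleOfIsUnitDet hunit
  set B : Matrix (Fin 3) (Fin 1) ℝ := Matrix.of fun i _ => -d * p i with hB
  -- The cross product of p with itself vanishes, so K halves p.
  have hKB : K * ((2 : ℝ) • B) = B := by
    ext i j
    fin_cases i <;>
      simp only [Matrix.mul_apply, Fin.sum_univ_three, hK, hB, Matrix.of_apply, Matrix.smul_apply,
        halfTurn_zero, halfTurn_one, halfTurn_two, Pi.single_apply, Fin.zero_eta, Fin.mk_one,
        Fin.reduceFinMk] <;> simp <;> ring
  have hinv : ⅟K * B = (2 : ℝ) • B := by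
    conv_lhs => rw [← hKB]
    rw [← Matrix.mul_assoc, invOf_mul_self, Matrix.one_mul]
  rw [Matrix.det_fromBlocks₁₁, Matrix.mul_assoc, hinv]
  refine mul_pos hdet0 ?_
  rw [Matrix.det_fin_one]
  simp [Matrix.mul_apply, Fin.sum_univ_three, hB]
  have : p 0 / s * (2 * (d * p 0)) + p 1 / s * (2 * (d * p 1)) + p 2 / s * (2 * (d * p 2)) =
      2 * d := by
    rw [eq_comm, hs]; rw [hs] at hs0; field_simp
  linarith

variable {X : Fin 2 → SU2} {ℓ : ℕ}

-- The rank-one map A kills the orbit and sends a vector a with D a = p to -ℓ v(p). In the basis (v,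
-- a) the map A + uL becomes the bordered matrix of `det_halfTurn_border` with d = ℓ.
open scoped Matrix in
theorem hasSign_twist (hℓ : 0 < ℓ) (hX : braidAct SU2 (σ (0 : Fin 1) ^ (2 * ℓ)) X = X)
    (hirr : Irred X) : HasSign (σ (0 : Fin 1) ^ (2 * ℓ)) X 1 := by
  have hne : X 0 * X 1 ≠ X 1 * X 0 := by
    obtain ⟨i, j, hij⟩ := hirr
    fin_cases i <;> fin_cases j <;> first | exact absurd rfl hij | exact hij | exact hij.symm
  rw [hasSign_iff _ _ hX]
  set P : SU2 := tupleProd X with hP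
  have hP' : P = X 0 * X 1 := tupleProd_two X
  have hPc : (P : ℍ[ℝ]) = X 0 * X 1 := by rw [hP']; rfl
  set p : Fin 3 → ℝ := imCoords P with hp
  set s : ℝ := p 0 ^ 2 + p 1 ^ 2 + p 2 ^ 2 with hs
  set c : ℝ := (P : ℍ[ℝ]).re with hc
  have hcs : c ^ 2 + s = 1 := P.sum_sq
  have hpim : imag p = (X 0 * X 1 : ℍ[ℝ]) - ((X 0 * X 1 : ℍ[ℝ]).re : ℝ) := by
    rw [← hPc, hp]
    ext <;> simp [imCoords]
  have hpn : ‖imag p‖ ^ 2 = s := by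
    rw [← real_inner_self_eq_norm_sq, inner_imag, imCoords_imag, Fin.sum_univ_three, hs]
    ring
  have hs0 : 0 < s := by
    rw [← hpn]
    refine pow_pos (norm_pos_iff.2 fun h0 => ?_) 2
    rw [h0, eq_comm, sub_eq_zero] at hpim
    have h1 : (X 0 * X 1 : ℍ[ℝ]) * X 0 = X 0 * (X 0 * X 1) := by
      rw [hpim, Quaternion.coe_commutes]
    rw [mul_assoc] at h1
    exact hne (Subtype.ext (mul_left_cancel₀ (X 0).ne_zero h1).symm)
  -- The image of the orbit under D is orthogonal to p, so a lift of p completes the orbit vectors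
  -- to a basis of the four-dimensional tangent space.
  obtain ⟨a, ha⟩ := prodMap_surjective hirr p
  have hDv : ∀ y, prodMap X (orbitMap X y) = (2 * s) • y - (2 * c) • crossProduct p y -
      (2 * (p ⬝ᵥ y)) • p := fun y => prodMap_orbitMap X y P hP p hp
  have hdot : ∀ y : Fin 3 → ℝ, p ⬝ᵥ y = p 0 * y 0 + p 1 * y 1 + p 2 * y 2 := fun y => by
    simp [dotProduct, Fin.sum_univ_three]
  have hpDv : ∀ y, dotMap p (prodMap X (orbitMap X y)) = 0 := fun y => by
    rw [hDv, dotMap_apply, hdot, cross_apply]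
    simp only [Pi.sub_apply, Pi.smul_apply, smul_eq_mul, Matrix.cons_val_zero, Matrix.cons_val_one,
      Matrix.cons_val, hs]
    ring
  have hpa : dotMap p (prodMap X a) = s := by
    rw [ha, dotMap_apply, hs]; ring
  have hA : ∀ z, (LinearMap.id - actMap _ X hX : tangentR X →ₗ[ℝ] tangentR X) z =
      (-(ℓ * dotMap p (prodMap X z)) / s) • orbitMap X p := fun z => by
    refine Subtype.ext ((dAct_twist hX hne hpim z).trans ?_)
    rw [hpn, ← imag_prodMap]
    have : (imag (prodMap X z) * imag p).re = - dotMap p (prodMap X z) := by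
      rw [Quaternion.re_mul, dotMap_apply]; simp; ring
    rw [this, mul_neg]
    rfl
  -- the basis formed by the orbit vectors and `a`
  let fam : Fin 3 ⊕ Fin 1 → tangentR X := Sum.elim (fun k => orbitMap X (Pi.single k 1)) fun _ => a
  have hsum : ∀ y : Fin 3 → ℝ, orbitMap X y = ∑ k, y k • orbitMap X (Pi.single k 1) := fun y => by
    conv_lhs => rw [← Finset.univ_sum_single y]
    rw [map_sum]
    refine Finset.sum_congr rfl fun k _ => ?_
    rw [← map_smul, ← Pi.single_smul, smul_eq_mul, mul_one]
  have hli : LinearIndependent ℝ fam := by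
    rw [Fintype.linearIndependent_iff]
    intro g hg
    rw [Fintype.sum_sum_type] at hg
    simp only [fam, Sum.elim_inl, Sum.elim_inr, Fintype.sum_unique] at hg
    rw [← hsum fun k => g (.inl k)] at hg
    have h1 : g (.inr default) = 0 := by
      have := congrArg (fun z => dotMap p (prodMap X z)) hg
      simpa [hpDv, hpa, hs0.ne'] using this
    rw [h1, zero_smul, add_zero] at hg
    have h2 := orbitMap_injective hirr (hg.trans (map_zero _).symm)
    rintro (k | i)
    · exact congrFun h2 k
    · rwa [Subsingleton.elim i default]
  let b : Module.Basis (Fin 3 ⊕ Fin 1) ℝ (tangentR X) :=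
    basisOfLinearIndependentOfCardEqFinrank hli (by
      rw [finrank_tangentR_two hne]; rfl)
  have hb : ∀ r, b r = fam r := fun r => by
    simp [b]
  have hbv : ∀ k, b (.inl k) = orbitMap X (Pi.single k 1) := fun k => hb _
  have hba : ∀ i, b (.inr i) = a := fun i => hb _
  have hrepr : ∀ y, (∀ k, b.repr (orbitMap X y) (.inl k) = y k) ∧
      ∀ i, b.repr (orbitMap X y) (.inr i) = 0 := fun y => by
    rw [hsum]
    simp only [← hbv, map_sum, map_smul, Module.Basis.repr_self]
    constructor
    · intro k
      simp [Finsupp.single_apply]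
    · intro i
      simp
  let u : (Fin 3 → ℝ) →ₗ[ℝ] tangentR X :=
    orbitMap X ∘ₗ halfTurn p (c / s) + LinearMap.toSpanSingleton ℝ _ a ∘ₗ (s⁻¹ • dotMap p)
  have hu : ∀ y, u y = orbitMap X (halfTurn p (c / s) y) + (s⁻¹ * dotMap p y) • a := fun y => by
    simp [u]
  refine ⟨firstCoords b, u, ?_, ?_, ?_⟩
  · refine LinearMap.ext fun y => funext fun k => ?_
    exact (hrepr y).1 k
  · refine LinearMap.ext fun y => ?_
    rw [LinearMap.comp_apply, hu, map_add, map_smul, hDv, ha, dotMap_apply, LinearMap.id_apply]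
    exact prodMap_halfTurn_apply p y s c hs hs0.ne' hcs
  · have hmat : LinearMap.toMatrix b b
        (LinearMap.id - actMap _ X hX + u ∘ₗ firstCoords b) =
        Matrix.fromBlocks (Matrix.of fun i k : Fin 3 => halfTurn p (c / s) (Pi.single k 1) i)
          (Matrix.of fun i (_ : Fin 1) => -(ℓ : ℝ) * p i)
          (Matrix.of fun (_ : Fin 1) k => p k / s) 0 := by
      have hL1 : ∀ k : Fin 3, firstCoords b (b (.inl k)) = Pi.single k 1 := fun k => by
        funext l; simp [firstCoords, Finsupp.single_apply, Pi.single_apply, eq_comm]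
      have hL2 : ∀ i : Fin 1, firstCoords b (b (.inr i)) = 0 := fun i => by
        funext l; simp [firstCoords]
      have hcol1 : ∀ k, (LinearMap.id - actMap _ X hX + u ∘ₗ firstCoords b :
          tangentR X →ₗ[ℝ] tangentR X) (b (.inl k)) =
          orbitMap X (halfTurn p (c / s) (Pi.single k 1)) + (p k / s) • b (.inr 0) := fun k => by
        rw [LinearMap.add_apply, LinearMap.comp_apply, hL1, hA, hbv, hpDv, hu, dotMap_single, hba,
          div_eq_inv_mul]
        simp [div_eq_inv_mul]
      have hcol2 : ∀ i, (LinearMap.id - actMap _ X hX + u ∘ₗ firstCoords b :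
          tangentR X →ₗ[ℝ] tangentR X) (b (.inr i)) =
          orbitMap X ((-(ℓ : ℝ)) • p) := fun i => by
        rw [LinearMap.add_apply, LinearMap.comp_apply, hL2, hA, hba, hpa, map_zero, add_zero,
          map_smul]
        congr 1
        field_simp
      ext (k | i) (l | j)
      · rw [LinearMap.toMatrix_apply, hcol1, map_add, Finsupp.add_apply, (hrepr _).1]
        simp
      · rw [LinearMap.toMatrix_apply, hcol2, (hrepr _).1]
        simp
      · rw [LinearMap.toMatrix_apply, hcol1, map_add, Finsupp.add_apply, (hrepr _).2]
        simp [Subsingleton.elim i 0]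
      · rw [LinearMap.toMatrix_apply, hcol2, (hrepr _).2]
        simp
    rw [← LinearMap.det_toMatrix b, hmat]
    exact sign_pos (det_halfTurn_border p (c / s) s ℓ hs hs0 (Nat.cast_pos.2 hℓ))

end

/-! ### Conjugacy of pairs of unit quaternions -/

/-- If p² = p'² = N, then N + p'p intertwines p and p'. It vanishes only for p' = -p, and then any
nonzero w anticommuting with p serves. -/
theorem exists_intertwiner {p p' w : ℍ[ℝ]} {N : ℝ} (hN : N ≠ 0) (hp : p * p = (N : ℍ[ℝ]))
    (hp' : p' * p' = (N : ℍ[ℝ])) (hw : w ≠ 0) (hwp : w * p = -(p * w)) :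
    ∃ g : ℍ[ℝ], g ≠ 0 ∧ g * p = p' * g ∧ (g = (N : ℍ[ℝ]) + p' * p ∨ g = w) := by
  by_cases h : (N : ℍ[ℝ]) + p' * p = 0
  · refine ⟨w, hw, ?_, Or.inr rfl⟩
    have hp0 : p ≠ 0 := by
      rintro rfl
      exact hN (Quaternion.coe_injective (by simpa using hp.symm))
    have : (p + p') * p = 0 := by rw [add_mul, hp, h]
    rw [eq_neg_of_add_eq_zero_right ((mul_eq_zero.1 this).resolve_right hp0), hwp, neg_mul]
  · refine ⟨_, h, ?_, Or.inl rfl⟩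
    rw [add_mul, mul_add, mul_assoc, hp, ← mul_assoc p', hp', add_comm, Quaternion.coe_commutes,
      ← Quaternion.coe_commutes N p']

/-- Move p to p' first, then rotate about p' until the commutators with p' agree. The second vector
is recovered from p', that commutator and Re(p'q). -/
theorem exists_conj_imaginary {p q p' q' : ℍ[ℝ]} (hp : p.re = 0) (hq : q.re = 0)
    (hp' : p'.re = 0) (hq' : q'.re = 0) (hpp : p * p = p' * p') (hqq : q * q = q' * q')
    (hpq : (p * q).re = (p' * q').re) (hne : p * q ≠ q * p) (hne' : p' * q' ≠ q' * p') :
    ∃ g : ℍ[ℝ], g ≠ 0 ∧ g * p = p' * g ∧ g * q = q' * g := by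
  have sq : ∀ {x : ℍ[ℝ]}, x.re = 0 → x * x = ((x * x).re : ℝ) := fun {x} hx => by
    ext <;> simp [hx] <;> ring
  have anti : ∀ {x y : ℍ[ℝ]}, x.re = 0 → y.re = 0 →
      (x * y - y * x) * x = -(x * (x * y - y * x)) := fun {x y} hx hy => by
    have h := sq hx
    have h2 : y * (x * x) = (x * x) * y := by rw [h, Quaternion.coe_commutes]
    simp only [sub_mul, mul_sub, mul_assoc] at h2 ⊢
    rw [h2]; abel
  have sqne : ∀ {x : ℍ[ℝ]}, x ≠ 0 → x.re = 0 → (x * x).re ≠ 0 := fun {x} hx h h' => by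
    have := sq h
    rw [h', Quaternion.coe_zero, mul_self_eq_zero] at this
    exact hx this
  have comre : ∀ x y : ℍ[ℝ], (x * y - y * x).re = 0 := fun x y => by
    rw [Quaternion.re_sub, Quaternion.re_mul, Quaternion.re_mul]; ring
  have comsq : ∀ {x y : ℍ[ℝ]}, x.re = 0 → y.re = 0 →
      ((x * y - y * x) * (x * y - y * x)).re = 4 * (x * y).re ^ 2 - 4 * (x * x).re * (y * y).re :=
    fun {x y} hx hy => by
      simp [hx, hy]; ring
  have recover : ∀ {x y : ℍ[ℝ]}, x.re = 0 → y.re = 0 →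
      x * (x * y - y * x) + (2 * (x * y).re : ℝ) * x = 2 * (x * x) * y := fun {x y} hx hy => by
    have h : x * y + y * x = (2 * (x * y).re : ℝ) := by
      ext <;> simp [hx, hy] <;> ring
    rw [← h, mul_sub, add_mul, ← mul_assoc, ← mul_assoc]
    have h2 : y * x * x = x * x * y := by
      rw [mul_assoc, sq hx, Quaternion.coe_commutes]
    rw [h2, two_mul, add_mul]; abel
  have hp0 : p ≠ 0 := by rintro rfl; simp at hne
  have hp0' : p' ≠ 0 := by rintro rfl; simp at hne'
  obtain ⟨g, hg, hgp, -⟩ := exists_intertwiner (sqne hp0 hp) (sq hp) (by rw [← hpp]; exact sq hp)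
    (sub_ne_zero.2 hne) (anti hp hq)
  have hgp' : g * p * g⁻¹ = p' := by rw [hgp, mul_assoc, mul_inv_cancel₀ hg, mul_one]
  have conjre : ∀ x : ℍ[ℝ], (g * x * g⁻¹).re = x.re := fun x => by
    rw [re_mul_comm, ← mul_assoc, inv_mul_cancel₀ hg, one_mul]
  have conjmul : ∀ x y : ℍ[ℝ], (g * x * g⁻¹) * (g * y * g⁻¹) = g * (x * y) * g⁻¹ := fun x y => by
    simp only [mul_assoc, inv_mul_cancel_left₀ hg]
  set q₁ : ℍ[ℝ] := g * q * g⁻¹ with hq₁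
  have hq1 : q₁.re = 0 := by rw [hq₁, conjre, hq]
  have hgq : g * q = q₁ * g := by rw [hq₁, mul_assoc, inv_mul_cancel₀ hg, mul_one]
  have hpq1 : (p' * q₁).re = (p' * q').re := by rw [← hgp', conjmul, conjre, hpq, hgp']
  have hqq1 : (q₁ * q₁).re = (q' * q').re := by rw [conjmul, conjre, hqq]
  have hr : p' * q₁ - q₁ * p' ≠ 0 := by
    rw [← hgp', conjmul, conjmul, sub_ne_zero]
    intro h
    exact hne (mul_left_cancel₀ hg (mul_right_cancel₀ (inv_ne_zero hg) h))
  clear_value q₁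
  have hrr : ((p' * q' - q' * p') * (p' * q' - q' * p')).re =
      ((p' * q₁ - q₁ * p') * (p' * q₁ - q₁ * p')).re := by
    rw [comsq hp' hq', comsq hp' hq1, hqq1, hpq1]
  have hc1 := anti hp' hq1
  have hc2 := anti hp' hq'
  -- The two commutators have equal squares and anticommute with p'. So N + r'r commutes with p',
  -- and so does the fallback w = p'.
  obtain ⟨k, hk, hkr, hk'⟩ := exists_intertwiner (sqne hr (comre _ _)) (sq (comre _ _))
    (p' := p' * q' - q' * p') (hrr ▸ sq (comre p' q')) hp0' (by rw [hc1, neg_neg])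
  have hkp : k * p' = p' * k := by
    rcases hk' with rfl | rfl
    · rw [add_mul, mul_add, Quaternion.coe_commutes, mul_assoc, hc1, mul_neg, ← mul_assoc, hc2,
        neg_mul, neg_neg, mul_assoc]
    · rfl
  have h1 := recover hp' hq1
  have h2 := recover hp' hq'
  have hkq : k * q₁ = q' * k := by
    have h20 : (2 : ℍ[ℝ]) ≠ 0 := by
      rw [← one_add_one_eq_two, ← Quaternion.coe_one, ← Quaternion.coe_add]
      exact fun h => absurd (Quaternion.coe_injective (h.trans Quaternion.coe_zero.symm))
        (by norm_num)
    have hne2 : 2 * (p' * p') ≠ 0 := mul_ne_zero h20 (mul_ne_zero hp0' hp0')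
    refine mul_left_cancel₀ hne2 ?_
    have hc : 2 * (p' * p') * k = k * (2 * (p' * p')) := by
      rw [sq hp', two_mul, add_mul, mul_add, Quaternion.coe_commutes]
    calc 2 * (p' * p') * (k * q₁) = k * (2 * (p' * p') * q₁) := by
          rw [← mul_assoc, hc, mul_assoc]
      _ = p' * (p' * q' - q' * p') * k + (2 * (p' * q₁).re : ℝ) * p' * k := by
          rw [← h1, mul_add, ← mul_assoc k p', hkp, mul_assoc p' k, hkr, ← mul_assoc p',
            ← mul_assoc k, ← Quaternion.coe_commutes, mul_assoc _ k, hkp, ← mul_assoc]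
      _ = 2 * (p' * p') * (q' * k) := by
          rw [hpq1, ← add_mul, h2, mul_assoc]
  refine ⟨k * g, mul_ne_zero hk hg, ?_, ?_⟩
  · rw [mul_assoc, hgp, ← mul_assoc, hkp, mul_assoc]
  · rw [mul_assoc, hgq, ← mul_assoc, hkq, mul_assoc]

/-- Three real parts fix the inner products of the imaginary parts of an irreducible pair. The
conjugating quaternion is then divided by its norm. -/
theorem SU2.exists_conj_pair {x y x' y' : SU2} (hx : (x : ℍ[ℝ]).re = (x' : ℍ[ℝ]).re)
    (hy : (y : ℍ[ℝ]).re = (y' : ℍ[ℝ]).re)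
    (hxy : ((x * y : SU2) : ℍ[ℝ]).re = ((x' * y' : SU2) : ℍ[ℝ]).re)
    (hne : x * y ≠ y * x) (hne' : x' * y' ≠ y' * x') :
    ∃ g : SU2, x' = g * x * g⁻¹ ∧ y' = g * y * g⁻¹ := by
  have split : ∀ z : SU2, (z : ℍ[ℝ]) = ((z : ℍ[ℝ]).re : ℝ) + (z : ℍ[ℝ]).im := fun z =>
    (Quaternion.re_add_im _).symm
  have comm : ∀ z w : SU2, (z : ℍ[ℝ]).im * (w : ℍ[ℝ]).im - (w : ℍ[ℝ]).im * (z : ℍ[ℝ]).im =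
      z * w - w * z := fun z w => by
    ext <;> simp <;> ring
  have hsq : ∀ z : SU2, (z : ℍ[ℝ]).im * (z : ℍ[ℝ]).im = (((z : ℍ[ℝ]).re * (z : ℍ[ℝ]).re - 1 : ℝ) : ℍ[ℝ]) :=
    fun z => by
      have h := z.sum_sq
      simp only [imCoords, LinearMap.coe_mk, AddHom.coe_mk] at h
      ext <;> simp at h ⊢ <;> linarith
  have hmul : ∀ z w : SU2, ((z : ℍ[ℝ]).im * (w : ℍ[ℝ]).im).re =
      ((z * w : SU2) : ℍ[ℝ]).re - (z : ℍ[ℝ]).re * (w : ℍ[ℝ]).re := fun z w => by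
    rw [Submonoid.coe_mul, Quaternion.re_mul, Quaternion.re_mul]
    simp; ring
  have hcomm : ∀ {z w : SU2}, z * w ≠ w * z →
      (z : ℍ[ℝ]).im * (w : ℍ[ℝ]).im ≠ (w : ℍ[ℝ]).im * (z : ℍ[ℝ]).im := fun {z w} h h0 => by
    rw [← sub_eq_zero, comm, sub_eq_zero] at h0
    exact h (Subtype.ext h0)
  obtain ⟨g, hg, h1, h2⟩ := exists_conj_imaginary (p := (x : ℍ[ℝ]).im) (q := (y : ℍ[ℝ]).im)
    (p' := (x' : ℍ[ℝ]).im) (q' := (y' : ℍ[ℝ]).im) (Quaternion.re_im _) (Quaternion.re_im _)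
    (Quaternion.re_im _) (Quaternion.re_im _) (by rw [hsq, hsq, hx]) (by rw [hsq, hsq, hy])
    (by rw [hmul, hmul, hxy, hx, hy]) (hcomm hne) (hcomm hne')
  have hn : ‖g‖ ≠ 0 := norm_ne_zero_iff.2 hg
  have hun : (‖g‖⁻¹ • g) ∈ unitary ℍ[ℝ] := by
    have h : ‖g‖⁻¹ * ‖g‖⁻¹ * Quaternion.normSq g = 1 := by
      rw [Quaternion.normSq_eq_norm_mul_self]; field_simp
    rw [Unitary.mem_iff, Quaternion.star_smul, smul_mul_smul_comm, smul_mul_smul_comm, Quaternion.star_mul_self,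
      Quaternion.self_mul_star, ← Quaternion.coe_smul, smul_eq_mul, h]
    exact ⟨rfl, rfl⟩
  have key : ∀ {z z' : SU2}, (z : ℍ[ℝ]).re = (z' : ℍ[ℝ]).re →
      g * (z : ℍ[ℝ]).im = (z' : ℍ[ℝ]).im * g → z' = ⟨_, hun⟩ * z * (⟨_, hun⟩ : SU2)⁻¹ :=
    fun {z z'} hz h => by
      rw [eq_mul_inv_iff_mul_eq]
      refine Subtype.ext ?_
      change (z' : ℍ[ℝ]) * (‖g‖⁻¹ • g) = (‖g‖⁻¹ • g) * z
      rw [mul_smul_comm, smul_mul_assoc, split z, split z', mul_add, h, add_mul, hz,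
        Quaternion.coe_commutes]
  exact ⟨⟨_, hun⟩, key hx h1, key hy h2⟩

/-! ### The irreducible representations of the torus link -/

/-- The Chebyshev recursion, from q² = 2 cos(θ) q - 1. It reduces commuting with a power to
commuting with q. -/
theorem SU2.sin_smul_pow (q : SU2) {θ : ℝ} (hq : (q : ℍ[ℝ]).re = Real.cos θ) (n : ℕ) :
    Real.sin θ • (q : ℍ[ℝ]) ^ n =
      Real.sin (n * θ) • (q : ℍ[ℝ]) - Real.sin ((n - 1) * θ) • (1 : ℍ[ℝ]) := by
  induction n with
  | zero => simp
  | succ n ih =>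
    rw [pow_succ, ← smul_mul_assoc, ih, sub_mul, smul_mul_assoc, smul_mul_assoc, SU2.mul_self, hq,
      one_mul, smul_sub, smul_smul, sub_right_comm, ← sub_smul]
    have h1 : Real.sin (n * θ) * (2 * Real.cos θ) - Real.sin ((n - 1) * θ) =
        Real.sin ((n + 1 : ℕ) * θ) := by
      push_cast
      rw [sub_mul, add_mul, one_mul, Real.sin_sub, Real.sin_add]; ring
    rw [h1]
    push_cast
    rw [add_sub_cancel_right]

theorem SU2.exists_angle {q x : SU2} (h : q * x ≠ x * q) :
    ∃ θ ∈ Set.Ioo 0 Real.pi, (q : ℍ[ℝ]).re = Real.cos θ := by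
  have hs := q.sum_sq
  have hlt : (q : ℍ[ℝ]).re ^ 2 < 1 := by
    by_contra hge
    have h0 : imCoords q 0 = 0 ∧ imCoords q 1 = 0 ∧ imCoords q 2 = 0 := by
      refine ⟨?_, ?_, ?_⟩ <;> refine pow_eq_zero_iff two_ne_zero |>.1 (le_antisymm ?_ (sq_nonneg _))
        <;> nlinarith [sq_nonneg (imCoords q 0), sq_nonneg (imCoords q 1), sq_nonneg (imCoords q 2)]
    have hq : (q : ℍ[ℝ]) = ((q : ℍ[ℝ]).re : ℝ) := by
      ext
      · simp
      · simpa [imCoords] using h0.1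
      · simpa [imCoords] using h0.2.1
      · simpa [imCoords] using h0.2.2
    refine h (Subtype.ext ?_)
    rw [Submonoid.coe_mul, Submonoid.coe_mul, hq, Quaternion.coe_commutes]
  obtain ⟨h1, h2⟩ := abs_lt.1 ((sq_lt_one_iff_abs_lt_one _).1 hlt)
  exact ⟨Real.arccos (q : ℍ[ℝ]).re, ⟨Real.arccos_pos.2 h2,
    lt_of_le_of_ne (Real.arccos_le_pi _) fun h => absurd (Real.arccos_eq_pi.1 h) (not_le.2 h1)⟩,
    (Real.cos_arccos h1.le h2.le).symm⟩

theorem SU2.commute_pow_iff {q x : SU2} (h : q * x ≠ x * q) {θ : ℝ} (hθ : θ ∈ Set.Ioo 0 Real.pi)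
    (hq : (q : ℍ[ℝ]).re = Real.cos θ) (n : ℕ) :
    q ^ n * x = x * q ^ n ↔ Real.sin (n * θ) = 0 := by
  have hs : Real.sin θ ≠ 0 := (Real.sin_pos_of_pos_of_lt_pi hθ.1 hθ.2).ne'
  have h1 : Real.sin θ • ((q : ℍ[ℝ]) ^ n * x - x * (q : ℍ[ℝ]) ^ n) =
      Real.sin (n * θ) • ((q : ℍ[ℝ]) * x - x * q) := by
    rw [smul_sub, ← smul_mul_assoc, ← mul_smul_comm, SU2.sin_smul_pow q hq, sub_mul, mul_sub,
      smul_mul_assoc, smul_mul_assoc, mul_smul_comm, mul_smul_comm, one_mul, mul_one, smul_sub]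
    abel
  have h2 : (q : ℍ[ℝ]) * x - x * q ≠ 0 := fun h0 => h (Subtype.ext (sub_eq_zero.1 h0))
  rw [Subtype.ext_iff]
  push_cast
  rw [← sub_eq_zero, ← smul_eq_zero_iff_right hs, h1, smul_eq_zero_iff_left h2]

theorem sin_nat_mul_eq_zero_iff {ℓ : ℕ} (hℓ : 0 < ℓ) {θ : ℝ} (hθ : θ ∈ Set.Ioo 0 Real.pi) :
    Real.sin (ℓ * θ) = 0 ↔ ∃ m : ℕ, 1 ≤ m ∧ m ≤ ℓ - 1 ∧ θ = Real.pi * m / ℓ := by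
  have hℓ' : (0 : ℝ) < ℓ := Nat.cast_pos.2 hℓ
  constructor
  · intro h
    obtain ⟨n, hn⟩ := Real.sin_eq_zero_iff.1 h
    have h0 : (0 : ℝ) < n := by
      have : 0 < (n : ℝ) * Real.pi := by rw [hn]; exact mul_pos hℓ' hθ.1
      exact pos_of_mul_pos_left this Real.pi_pos.le
    have h1 : (n : ℝ) < ℓ := by
      have : (n : ℝ) * Real.pi < ℓ * Real.pi := by rw [hn]; exact mul_lt_mul_of_pos_left hθ.2 hℓ'
      exact lt_of_mul_lt_mul_right this Real.pi_pos.le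
    have h0' : 0 < n := by exact_mod_cast h0
    lift n to ℕ using h0'.le
    have h1' : n < ℓ := by exact_mod_cast h1
    refine ⟨n, by omega, by omega, ?_⟩
    rw [eq_div_iff hℓ'.ne', mul_comm θ, ← hn, Int.cast_natCast, mul_comm]
  · rintro ⟨m, -, -, rfl⟩
    rw [mul_div_cancel₀ _ hℓ'.ne', mul_comm]
    exact Real.sin_nat_mul_pi m

theorem pi_mul_div_mem_Ioo {ℓ m : ℕ} (h1 : 0 < m) (h2 : m < ℓ) :
    Real.pi * m / ℓ ∈ Set.Ioo 0 Real.pi := by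
  have hm : (0 : ℝ) < m := Nat.cast_pos.2 h1
  have hℓ : (0 : ℝ) < ℓ := Nat.cast_pos.2 (h1.trans h2)
  have h2' : (m : ℝ) < ℓ := Nat.cast_lt.2 h2
  refine ⟨div_pos (mul_pos Real.pi_pos hm) hℓ, ?_⟩
  rw [div_lt_iff₀ hℓ]
  exact mul_lt_mul_of_pos_left h2' Real.pi_pos

/-- The irreducible pairs in `R_2` fixed by the braid `σ ^ (2 ℓ)` are those whose product has the
eigenvalues `exp (± π i m / ℓ)` with `0 < m < ℓ`. -/
theorem fixed_iff {ℓ : ℕ} (hℓ : 0 < ℓ) {X : Fin 2 → SU2} (hirr : X 0 * X 1 ≠ X 1 * X 0) :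
    braidAct SU2 (σ (0 : Fin 1) ^ (2 * ℓ)) X = X ↔
      ∃ m : ℕ, 1 ≤ m ∧ m ≤ ℓ - 1 ∧
        ((X 0 * X 1 : SU2) : ℍ[ℝ]).re = Real.cos (Real.pi * m / ℓ) := by
  have h0 : (X 0 * X 1) * X 0 ≠ X 0 * (X 0 * X 1) := fun h =>
    hirr (mul_left_cancel ((mul_assoc _ _ _).symm.trans h)).symm
  have h1 : (X 0 * X 1) * X 1 ≠ X 1 * (X 0 * X 1) := fun h =>
    hirr (mul_right_cancel (h.trans (mul_assoc _ _ _).symm))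
  obtain ⟨θ, hθ, hre⟩ := SU2.exists_angle h0
  have e : braidAct SU2 (σ (0 : Fin 1) ^ (2 * ℓ)) X = X ↔ Real.sin (ℓ * θ) = 0 := by
    rw [braidAct_twist, funext_iff, Fin.forall_fin_two, mul_inv_eq_iff_eq_mul,
      mul_inv_eq_iff_eq_mul, SU2.commute_pow_iff h0 hθ hre, SU2.commute_pow_iff h1 hθ hre, and_self]
  rw [e, sin_nat_mul_eq_zero_iff hℓ hθ, hre]
  refine exists_congr fun m => and_congr_right fun hm => and_congr_right fun hm' => ?_
  have := pi_mul_div_mem_Ioo (ℓ := ℓ) hm (by omega)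
  exact ⟨fun h => by rw [h], fun h =>
    Real.injOn_cos ⟨hθ.1.le, hθ.2.le⟩ ⟨this.1.le, this.2.le⟩ h⟩

/-- The real part of xy differs from cos α₁ cos α₂ by the inner product of the imaginary parts,
whose norms are sin α₁ and sin α₂; apply Cauchy–Schwarz. -/
theorem SU2.re_mul_mem_Icc {x y : SU2} {α₁ α₂ : ℝ} (h₁ : α₁ ∈ Set.Ioo 0 Real.pi)
    (h₂ : α₂ ∈ Set.Ioo 0 Real.pi) (hx : (x : ℍ[ℝ]).re = Real.cos α₁)
    (hy : (y : ℍ[ℝ]).re = Real.cos α₂) :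
    ((x * y : SU2) : ℍ[ℝ]).re ∈ Set.Icc (Real.cos (α₁ + α₂)) (Real.cos (α₁ - α₂)) := by
  have hs1 := Real.sin_pos_of_pos_of_lt_pi h₁.1 h₁.2
  have hs2 := Real.sin_pos_of_pos_of_lt_pi h₂.1 h₂.2
  have hx2 := x.sum_sq
  have hy2 := y.sum_sq
  simp only [imCoords, LinearMap.coe_mk, AddHom.coe_mk, hx, hy, Matrix.cons_val_zero,
    Matrix.cons_val_one, Matrix.cons_val] at hx2 hy2
  have e1 := Real.sin_sq_add_cos_sq α₁
  have e2 := Real.sin_sq_add_cos_sq α₂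
  rw [Submonoid.coe_mul, Quaternion.re_mul, hx, hy, Real.cos_add, Real.cos_sub]
  generalize (x : ℍ[ℝ]).imI = a at *
  generalize (x : ℍ[ℝ]).imJ = b at *
  generalize (x : ℍ[ℝ]).imK = c at *
  generalize (y : ℍ[ℝ]).imI = a' at *
  generalize (y : ℍ[ℝ]).imJ = b' at *
  generalize (y : ℍ[ℝ]).imK = c' at *
  have h : (a * a' + b * b' + c * c') ^ 2 ≤ (Real.sin α₁ * Real.sin α₂) ^ 2 := by
    have e : (Real.sin α₁ * Real.sin α₂) ^ 2 =
        (a ^ 2 + b ^ 2 + c ^ 2) * (a' ^ 2 + b' ^ 2 + c' ^ 2) := by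
      rw [mul_pow, show Real.sin α₁ ^ 2 = a ^ 2 + b ^ 2 + c ^ 2 by linarith,
        show Real.sin α₂ ^ 2 = a' ^ 2 + b' ^ 2 + c' ^ 2 by linarith]
    rw [e]
    nlinarith [sq_nonneg (a * b' - b * a'), sq_nonneg (a * c' - c * a'),
      sq_nonneg (b * c' - c * b')]
  obtain ⟨l, r⟩ := abs_le.1 (abs_le_of_sq_le_sq h (mul_pos hs1 hs2).le)
  constructor <;> linarith

theorem SU2.exists_coords {a b c d : ℝ} (h : a ^ 2 + b ^ 2 + c ^ 2 + d ^ 2 = 1) :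
    ∃ q : SU2, (q : ℍ[ℝ]).re = a ∧ (q : ℍ[ℝ]).imI = b ∧ (q : ℍ[ℝ]).imJ = c ∧
      (q : ℍ[ℝ]).imK = d := by
  let q : ℍ[ℝ] := ⟨a, b, c, d⟩
  have hq : Quaternion.normSq q = 1 := (Quaternion.normSq_def' q).trans h
  refine ⟨⟨q, ?_⟩, rfl, rfl, rfl, rfl⟩
  rw [Unitary.mem_iff, Quaternion.star_mul_self, Quaternion.self_mul_star, hq]
  exact ⟨rfl, rfl⟩

/-- Let the imaginary part of x point along i and that of y lie in the plane of i and j, with angle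
of cosine k. The value of k is solved from t, and t being interior gives |k| < 1, so the two
directions are not parallel. -/
theorem SU2.exists_pair {α₁ α₂ t : ℝ} (h₁ : α₁ ∈ Set.Ioo 0 Real.pi)
    (h₂ : α₂ ∈ Set.Ioo 0 Real.pi) (ht : t ∈ Set.Ioo (Real.cos (α₁ + α₂)) (Real.cos (α₁ - α₂))) :
    ∃ x y : SU2, (x : ℍ[ℝ]).re = Real.cos α₁ ∧ (y : ℍ[ℝ]).re = Real.cos α₂ ∧
      ((x * y : SU2) : ℍ[ℝ]).re = t ∧ x * y ≠ y * x := by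
  have hs1 := Real.sin_pos_of_pos_of_lt_pi h₁.1 h₁.2
  have hs2 := Real.sin_pos_of_pos_of_lt_pi h₂.1 h₂.2
  rw [Real.cos_add, Real.cos_sub] at ht
  have e1 := Real.sin_sq_add_cos_sq α₁
  have e2 := Real.sin_sq_add_cos_sq α₂
  set k : ℝ := (Real.cos α₁ * Real.cos α₂ - t) / (Real.sin α₁ * Real.sin α₂) with hk
  have hk' : Real.sin α₁ * Real.sin α₂ * k = Real.cos α₁ * Real.cos α₂ - t := by
    rw [hk]; field_simp
  have hk1 : k < 1 := by rw [hk, div_lt_one (mul_pos hs1 hs2)]; linarith [ht.1]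
  have hk2 : -1 < k := by rw [hk, lt_div_iff₀ (mul_pos hs1 hs2)]; linarith [ht.2]
  have hpos : 0 < 1 - k ^ 2 := by nlinarith
  have hsq : Real.sqrt (1 - k ^ 2) ^ 2 = 1 - k ^ 2 := Real.sq_sqrt hpos.le
  have hsq0 := Real.sqrt_pos.2 hpos
  set w : ℝ := Real.sqrt (1 - k ^ 2)
  obtain ⟨x, x0, x1, x2, x3⟩ := SU2.exists_coords (a := Real.cos α₁) (b := Real.sin α₁) (c := 0)
    (d := 0) (by linarith)
  obtain ⟨y, y0, y1, y2, y3⟩ := SU2.exists_coords (a := Real.cos α₂) (b := Real.sin α₂ * k)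
    (c := Real.sin α₂ * w) (d := 0) (by linear_combination e2 + Real.sin α₂ ^ 2 * hsq)
  refine ⟨x, y, x0, y0, ?_, fun h => ?_⟩
  · rw [Submonoid.coe_mul, Quaternion.re_mul, x0, x1, x2, x3, y0, y1, y2, y3]
    linarith
  · have := congrArg (fun z : SU2 => (z : ℍ[ℝ]).imK) h
    simp only [Submonoid.coe_mul, Quaternion.imK_mul, x0, x1, x2, x3, y0, y1, y2, y3] at this
    nlinarith [mul_pos hs1 (mul_pos hs2 hsq0)]

/-- In (0, 2π) equality of cosines leaves only s = πm/ℓ and s = π(2ℓ-m)/ℓ, which accounts for the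
two excluded ranges of indices. -/
theorem cos_ne_of_ne {ℓ : ℕ} {s : ℝ} (hs : s ∈ Set.Ioo 0 (2 * Real.pi))
    (h : ∀ m : ℕ, (0 < m ∧ m < ℓ) ∨ (ℓ < m ∧ m < 2 * ℓ) → s ≠ Real.pi * m / ℓ) {m : ℕ}
    (h1 : 0 < m) (h2 : m < ℓ) : Real.cos s ≠ Real.cos (Real.pi * m / ℓ) := by
  intro he
  obtain ⟨hy0, hy1⟩ := pi_mul_div_mem_Ioo h1 h2
  have hπ := Real.pi_pos
  have hℓ : (ℓ : ℝ) ≠ 0 := Nat.cast_ne_zero.2 (by omega)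
  obtain ⟨k, hk | hk⟩ := Real.cos_eq_cos_iff.1 he
  · have ha : (-1 : ℝ) < k := by
      by_contra hc
      nlinarith [hs.1, hs.2]
    have hb : (k : ℝ) < 1 := by
      by_contra hc
      nlinarith [hs.1, hs.2]
    have : k = 0 := by
      have ha' : -1 < k := by exact_mod_cast ha
      have hb' : k < 1 := by exact_mod_cast hb
      omega
    rw [this] at hk
    exact h m (Or.inl ⟨h1, h2⟩) (by rw [hk]; simp)
  · have ha : (0 : ℝ) < k := by
      by_contra hc
      nlinarith [hs.1, hs.2]
    have hb : (k : ℝ) < 2 := by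
      by_contra hc
      nlinarith [hs.1, hs.2]
    have : k = 1 := by
      have ha' : 0 < k := by exact_mod_cast ha
      have hb' : k < 2 := by exact_mod_cast hb
      omega
    rw [this] at hk
    refine h (2 * ℓ - m) (Or.inr ⟨by omega, by omega⟩) ?_
    rw [Nat.cast_sub (by omega)]
    push_cast
    rw [mul_sub, sub_div, hk]
    field_simp
    push_cast
    ring

/-- The real part of X₀X₁ is an injective invariant of the classes of fixed pairs, and its values
are the admissible cos(πm/ℓ), distinct for distinct m. -/
theorem hasPositivePoints_torusBraid {ℓ : ℕ} (hℓ : 0 < ℓ) {α₁ α₂ : ℝ}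
    (hα₁ : α₁ ∈ Set.Ioo 0 Real.pi) (hα₂ : α₂ ∈ Set.Ioo 0 Real.pi)
    (hroot : ∀ m : ℕ, (0 < m ∧ m < ℓ) ∨ (ℓ < m ∧ m < 2 * ℓ) →
      α₁ + α₂ ≠ Real.pi * m / ℓ ∧ α₁ - α₂ + Real.pi ≠ Real.pi * m / ℓ) :
    HasPositivePoints ![α₁, α₂] {m : ℕ | 1 ≤ m ∧ m ≤ ℓ - 1 ∧
        Real.cos (Real.pi * m / ℓ) ∈
          Set.Icc (Real.cos (α₁ + α₂)) (Real.cos (α₁ - α₂))}.ncard (torusBraid ℓ) := by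
  set S : Set ℕ := {m : ℕ | 1 ≤ m ∧ m ≤ ℓ - 1 ∧ Real.cos (Real.pi * m / ℓ) ∈
    Set.Icc (Real.cos (α₁ + α₂)) (Real.cos (α₁ - α₂))} with hS
  have hSfin : S.Finite := (Set.finite_Icc 1 (ℓ - 1)).subset fun m hm => ⟨hm.1, hm.2.1⟩
  let T := FixedIrr ![α₁, α₂] (torusBraid ℓ).color (torusBraid ℓ).braid
  have hne : ∀ X : T, (X.1 0 : SU2) * X.1 1 ≠ X.1 1 * X.1 0 := fun X => by
    obtain ⟨i, j, hij⟩ := X.2.2.2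
    change Fin 2 at i j
    fin_cases i <;> fin_cases j <;> first | exact absurd rfl hij | exact hij | exact hij.symm
  have hre0 : ∀ X : T, ((X.1 0 : SU2) : ℍ[ℝ]).re = Real.cos α₁ := fun X => by
    have := X.2.1 0
    exact mul_left_cancel₀ two_ne_zero this
  have hre1 : ∀ X : T, ((X.1 1 : SU2) : ℍ[ℝ]).re = Real.cos α₂ := fun X => by
    have := X.2.1 1
    exact mul_left_cancel₀ two_ne_zero this
  let f : Quotient (fixedSetoid ![α₁, α₂] (torusBraid ℓ).color (torusBraid ℓ).braid) → ℝ :=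
    Quotient.lift (fun X : T => ((X.1 0 * X.1 1 : SU2) : ℍ[ℝ]).re) (by
      rintro X Y ⟨g, hg⟩
      have : Y.1 0 * Y.1 1 = g * (X.1 0 * X.1 1) * g⁻¹ := by rw [hg]; group
      simp only [this, re_coe_conj])
  have hf : Function.Injective f := by
    rintro ⟨X⟩ ⟨Y⟩ h
    obtain ⟨g, h1, h2⟩ := SU2.exists_conj_pair ((hre0 X).trans (hre0 Y).symm)
      ((hre1 X).trans (hre1 Y).symm) h (hne X) (hne Y)
    exact Quotient.sound ⟨g, funext (Fin.forall_fin_two.2 ⟨h1, h2⟩)⟩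
  have hrange : Set.range f = (fun m : ℕ => Real.cos (Real.pi * m / ℓ)) '' S := by
    ext t
    constructor
    · rintro ⟨⟨X⟩, rfl⟩
      obtain ⟨m, h1, h2, h3⟩ := (fixed_iff hℓ (hne X)).1 X.2.2.1
      refine ⟨m, ⟨h1, h2, ?_⟩, h3.symm⟩
      rw [← h3]
      exact SU2.re_mul_mem_Icc hα₁ hα₂ (hre0 X) (hre1 X)
    · rintro ⟨m, ⟨h1, h2, h3, h4⟩, rfl⟩
      have ha : Real.cos (α₁ + α₂) ≠ Real.cos (Real.pi * m / ℓ) :=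
        cos_ne_of_ne ⟨by linarith [hα₁.1, hα₂.1], by linarith [hα₁.2, hα₂.2]⟩
          (fun m hm => (hroot m hm).1) h1 (by omega)
      -- The shift by π moves α₁ - α₂ into (0, 2π) and changes the sign of both cosines, replacing m
      -- by ℓ - m.
      have hb : Real.cos (α₁ - α₂) ≠ Real.cos (Real.pi * m / ℓ) := by
        have := cos_ne_of_ne (s := α₁ - α₂ + Real.pi) ⟨by linarith [hα₁.1, hα₂.2],
          by linarith [hα₁.2, hα₂.1]⟩ (fun m hm => (hroot m hm).2) (m := ℓ - m) (by omega)
          (by omega)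
        rw [Real.cos_add_pi, Nat.cast_sub (by omega), mul_sub, sub_div,
          mul_div_cancel_right₀ _ (Nat.cast_ne_zero.2 hℓ.ne'), Real.cos_pi_sub] at this
        exact fun h => this (by rw [h])
      obtain ⟨x, y, hx, hy, hxy, hxy'⟩ :=
        SU2.exists_pair hα₁ hα₂ ⟨lt_of_le_of_ne h3 ha, lt_of_le_of_ne h4 hb.symm⟩
      refine ⟨⟦⟨(![x, y] : Fin 2 → SU2), Fin.forall_fin_two.2 ⟨?_, ?_⟩,
        (fixed_iff hℓ (X := ![x, y]) hxy').2 ⟨m, h1, h2, hxy⟩, 0, 1, hxy'⟩⟧, hxy⟩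
      · exact congrArg (2 * ·) hx
      · exact congrArg (2 * ·) hy
  have hinj : Set.InjOn (fun m : ℕ => Real.cos (Real.pi * m / ℓ)) S := by
    intro m hm m' hm' h
    have h1 := pi_mul_div_mem_Ioo (ℓ := ℓ) hm.1 (by have := hm.1; have := hm.2.1; omega)
    have h2 := pi_mul_div_mem_Ioo (ℓ := ℓ) hm'.1 (by have := hm'.1; have := hm'.2.1; omega)
    have := Real.injOn_cos ⟨h1.1.le, h1.2.le⟩ ⟨h2.1.le, h2.2.le⟩ h
    rw [div_left_inj' (Nat.cast_ne_zero.2 hℓ.ne'), mul_right_inj' Real.pi_ne_zero] at this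
    exact_mod_cast this
  refine ⟨fun X => hasSign_twist hℓ X.2.2.1 X.2.2.2, ?_, ?_⟩
  · have : Finite (Set.range f) := by
      rw [hrange]; exact (hSfin.image _).to_subtype
    exact Finite.of_injective_finite_range hf
  · rw [← Nat.card_range_of_injective hf, hrange, Nat.card_coe_set_eq, hinj.ncard_image]

/-! ### The Alexander polynomial of the torus link -/

theorem evalTorus_single {μ : ℕ} (ω : Fin μ → Circle) (k : Fin μ) :
    evalTorus ω (AddMonoidAlgebra.single (Pi.single k 1) 1) = ω k := by
  rw [evalTorus, AddMonoidAlgebra.lift_single, one_smul]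
  change ((∏ i, ω i ^ (Pi.single k 1 : Fin μ → ℤ) i : Circle) : ℂ) = _
  rw [Finset.prod_eq_single k]
  · simp
  · intro i _ hi
    rw [Pi.single_eq_of_ne hi, zpow_zero]
  · simp

theorem evalTorus_affinePerm {μ : ℕ} (ω : Fin μ → Circle) (k : Fin μ) (d x : Laurent μ) :
    evalTorus ω (affinePerm k d x) = ω k * evalTorus ω x + evalTorus ω d := by
  have h : affinePerm k d x = AddMonoidAlgebra.single (Pi.single k 1) 1 * x + d := rfl
  rw [h, map_add, map_mul, evalTorus_single]

theorem evalTorus_pow {μ : ℕ} (ω : Fin μ → Circle) (P : Equiv.Perm (Laurent μ)) (τ D : ℂ)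
    (h : ∀ y, evalTorus ω (P y) = τ * evalTorus ω y + D) (n : ℕ) (y : Laurent μ) :
    evalTorus ω ((P ^ n) y) = τ ^ n * evalTorus ω y + (∑ k ∈ Finset.range n, τ ^ k) * D := by
  induction n with
  | zero => simp
  | succ n ih =>
    rw [pow_succ', Equiv.Perm.mul_apply, h, ih, Finset.sum_range_succ']
    simp only [pow_succ', ← Finset.mul_sum]
    ring

/-- For w = x₀x₁ the product rule gives ∂(wⁿx₀w⁻ⁿ) = (1 - ω₀) ∂(wⁿ), and ∂(wⁿ) is a geometric sum
times ω₀. -/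
theorem evalTorus_foxDeriv_twist (ω : Fin 2 → Circle) (n : ℕ) :
    evalTorus ω (foxDeriv (id : Fin 2 → Fin 2) 1
      ((FreeGroup.of 0 * FreeGroup.of 1) ^ n * FreeGroup.of 0 *
        ((FreeGroup.of 0 * FreeGroup.of 1) ^ n)⁻¹)) =
      (1 - ω 0) * ω 0 * ∑ k ∈ Finset.range n, ((ω 0 : ℂ) * ω 1) ^ k := by
  set P : Equiv.Perm (Laurent 2) := affinePerm 0 0 * affinePerm 1 1 with hP
  have h : ∀ y, evalTorus ω (P y) = (ω 0 * ω 1 : ℂ) * evalTorus ω y + ω 0 := fun y => by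
    rw [hP, Equiv.Perm.mul_apply, evalTorus_affinePerm, evalTorus_affinePerm, map_zero, map_one]
    ring
  have hn := evalTorus_pow ω P _ _ h n
  rw [foxDeriv]
  simp only [map_mul, map_inv, map_pow, FreeGroup.lift_apply_of, id, zero_ne_one, if_true, if_false]
  rw [← hP, Equiv.Perm.mul_apply, Equiv.Perm.mul_apply, hn, evalTorus_affinePerm,
    map_zero (evalTorus ω)]
  -- The value of the inverse word is obtained from the identity Pⁿ(P⁻ⁿ 0) = 0.
  have h0 := hn ((P ^ n)⁻¹ 0)
  rw [← Equiv.Perm.mul_apply, mul_inv_cancel, Equiv.Perm.one_apply, map_zero] at h0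
  linear_combination (ω 0 : ℂ) * -h0

/-- A zero of Δ is a zero of every minor it divides. The minor used is the single entry in row 0,
column 1. -/
theorem evalTorus_ne_zero_of_isAlexanderPolynomial {ℓ : ℕ} {Δ : Laurent 2}
    (hΔ : IsAlexanderPolynomial (torusBraid ℓ) Δ) (ω : Fin 2 → Circle) (h0 : ω 0 ≠ 1)
    (h : ∑ k ∈ Finset.range ℓ, ((ω 0 : ℂ) * ω 1) ^ k ≠ 0) : evalTorus ω Δ ≠ 0 := by
  intro hz
  have h1 := map_dvd (evalTorus ω) (hΔ.1 (1 : Fin 2) (0 : Fin 2))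
  rw [hz, zero_dvd_iff] at h1
  have h2 : ((alexanderMatrix (torusBraid ℓ)).submatrix (Fin.succAbove (1 : Fin 2))
      (Fin.succAbove (0 : Fin 2))).det = foxDeriv (id : Fin 2 → Fin 2) 1
      ((FreeGroup.of 0 * FreeGroup.of 1) ^ ℓ * FreeGroup.of 0 *
        ((FreeGroup.of 0 * FreeGroup.of 1) ^ ℓ)⁻¹) := by
    refine (Matrix.det_fin_one _).trans ?_
    change foxDeriv (id : Fin 2 → Fin 2) 1
      (braidAct (FreeGroup (Fin 2)) (σ (0 : Fin 1) ^ (2 * ℓ)) FreeGroup.of 0) - 0 = _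
    rw [sub_zero, braidAct_twist]
  have h3 : evalTorus ω (foxDeriv (id : Fin 2 → Fin 2) 1
      ((FreeGroup.of 0 * FreeGroup.of 1) ^ ℓ * FreeGroup.of 0 *
        ((FreeGroup.of 0 * FreeGroup.of 1) ^ ℓ)⁻¹)) = 0 := by
    rw [← h2]; exact h1
  rw [evalTorus_foxDeriv_twist] at h3
  have h4 : (1 - ω 0 : ℂ) ≠ 0 := sub_ne_zero.2 fun h => h0 (Circle.ext h.symm)
  exact mul_ne_zero (mul_ne_zero h4 (Circle.coe_ne_zero _)) h h3

/-- A zero of the sum is an ℓ-th root of unity, hence equal to 1 by hypothesis, where the sum is ℓ.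
-/
theorem geom_sum_ne_zero {ℓ : ℕ} (hℓ : 0 < ℓ) {τ : ℂ} (h : τ ^ ℓ = 1 → τ = 1) :
    ∑ k ∈ Finset.range ℓ, τ ^ k ≠ 0 := by
  intro h0
  have h1 := geom_sum_mul τ ℓ
  rw [h0, zero_mul, eq_comm, sub_eq_zero] at h1
  rw [h h1] at h0
  simp [hℓ.ne'] at h0

/-- An ℓ-th root of unity forces s = πn/ℓ with 0 < n < 2ℓ. Only n = ℓ is not excluded, and there
exp(2πi) = 1. -/
theorem circle_exp_pow_eq_one {ℓ : ℕ} (hℓ : 0 < ℓ) {s : ℝ} (hs : s ∈ Set.Ioo 0 (2 * Real.pi))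
    (h : ∀ m : ℕ, (0 < m ∧ m < ℓ) ∨ (ℓ < m ∧ m < 2 * ℓ) → s ≠ Real.pi * m / ℓ)
    (he : Circle.exp (2 * s) ^ ℓ = 1) : Circle.exp (2 * s) = 1 := by
  have hℓ' : (0 : ℝ) < ℓ := Nat.cast_pos.2 hℓ
  rw [← Circle.exp_nsmul, Circle.exp_eq_one] at he
  obtain ⟨n, hn⟩ := he
  rw [nsmul_eq_mul] at hn
  have hn' : (n : ℝ) * Real.pi = ℓ * s := by linarith
  have h0 : (0 : ℝ) < n := by
    have : 0 < (n : ℝ) * Real.pi := by rw [hn']; exact mul_pos hℓ' hs.1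
    exact pos_of_mul_pos_left this Real.pi_pos.le
  have h1 : (n : ℝ) < 2 * ℓ := by
    have : (n : ℝ) * Real.pi < 2 * ℓ * Real.pi := by
      rw [hn']; nlinarith [mul_lt_mul_of_pos_left hs.2 hℓ']
    exact lt_of_mul_lt_mul_right this Real.pi_pos.le
  have h0' : 0 < n := by exact_mod_cast h0
  lift n to ℕ using h0'.le
  have h0'' : 0 < n := by exact_mod_cast h0'
  have h1' : n < 2 * ℓ := by exact_mod_cast h1
  have hsn : s = Real.pi * n / ℓ := by
    rw [eq_div_iff hℓ'.ne', mul_comm s, ← hn', Int.cast_natCast, mul_comm]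
  rcases lt_trichotomy n ℓ with hlt | rfl | hgt
  · exact absurd hsn (h n (Or.inl ⟨h0'', hlt⟩))
  · rw [hsn, mul_div_cancel_right₀ _ hℓ'.ne', Circle.exp_two_pi]
  · exact absurd hsn (h n (Or.inr ⟨hgt, h1'⟩))

theorem circle_exp_ne_one {α : ℝ} (hα : α ∈ Set.Ioo 0 Real.pi) : Circle.exp (2 * α) ≠ 1 := by
  rw [Ne, Circle.exp_eq_one]
  rintro ⟨n, hn⟩
  have hn' : α = n * Real.pi := by linarith
  have h0 : (0 : ℝ) < n := pos_of_mul_pos_left (hn' ▸ hα.1) Real.pi_pos.le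
  have h1 : (n : ℝ) < 1 := by
    have : (n : ℝ) * Real.pi < 1 * Real.pi := by rw [← hn', one_mul]; exact hα.2
    exact lt_of_mul_lt_mul_right this Real.pi_pos.le
  have h0' : 0 < n := by exact_mod_cast h0
  have h1' : n < 1 := by exact_mod_cast h1
  omega

theorem evalTorus_alexander_ne_zero {ℓ : ℕ} (hℓ : 0 < ℓ) {α₁ α₂ : ℝ}
    (hα₁ : α₁ ∈ Set.Ioo 0 Real.pi) (hα₂ : α₂ ∈ Set.Ioo 0 Real.pi)
    (hroot : ∀ m : ℕ, (0 < m ∧ m < ℓ) ∨ (ℓ < m ∧ m < 2 * ℓ) →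
      α₁ + α₂ ≠ Real.pi * m / ℓ ∧ α₁ - α₂ + Real.pi ≠ Real.pi * m / ℓ)
    {Δ : Laurent 2} (hΔ : IsAlexanderPolynomial (torusBraid ℓ) Δ) (ε₁ ε₂ : ℤˣ) :
    evalTorus ![Circle.exp (2 * α₁) ^ (ε₁ : ℤ), Circle.exp (2 * α₂) ^ (ε₂ : ℤ)] Δ ≠ 0 := by
  have hadd : Circle.exp (2 * (α₁ + α₂)) = Circle.exp (2 * α₁) * Circle.exp (2 * α₂) := by
    rw [mul_add, Circle.exp_add]
  have hsub : Circle.exp (2 * (α₁ - α₂ + Real.pi)) =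
      Circle.exp (2 * α₁) * (Circle.exp (2 * α₂))⁻¹ := by
    rw [mul_add, mul_sub, Circle.exp_add, Circle.exp_sub, Circle.exp_two_pi, mul_one, div_eq_mul_inv]
  have h1 := circle_exp_pow_eq_one hℓ (s := α₁ + α₂) ⟨by linarith [hα₁.1, hα₂.1],
    by linarith [hα₁.2, hα₂.2]⟩ fun m hm => (hroot m hm).1
  have h2 := circle_exp_pow_eq_one hℓ (s := α₁ - α₂ + Real.pi) ⟨by linarith [hα₁.1, hα₂.2],
    by linarith [hα₁.2, hα₂.1]⟩ fun m hm => (hroot m hm).2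
  rw [hadd] at h1
  rw [hsub] at h2
  have hω := circle_exp_ne_one hα₁
  have key : ∀ z w : Circle, z ≠ 1 → ((z * w) ^ ℓ = 1 → z * w = 1) → evalTorus ![z, w] Δ ≠ 0 :=
    fun z w hz hzw => evalTorus_ne_zero_of_isAlexanderPolynomial hΔ _ hz
      (geom_sum_ne_zero hℓ fun h => by
        have := hzw (Circle.ext (by simpa using h))
        simpa using congrArg (fun u : Circle => (u : ℂ)) this)
  -- Up to inversion the product of the two coordinates is z₁z₂ or z₁z₂⁻¹, governed by α₁ + α₂ and
  -- by α₁ - α₂ + π.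
  rcases Int.units_eq_one_or ε₁ with rfl | rfl <;> rcases Int.units_eq_one_or ε₂ with rfl | rfl <;>
    simp only [Units.val_one, Units.val_neg, zpow_one, zpow_neg]
  · exact key _ _ hω h1
  · exact key _ _ hω h2
  · refine key _ _ (inv_ne_one.2 hω) fun h => ?_
    have := h2 (by rw [← inv_inj, ← inv_pow, mul_inv, inv_inv, h, inv_one])
    rw [← inv_inj, mul_inv, inv_inv, this, inv_one]
  · refine key _ _ (inv_ne_one.2 hω) fun h => ?_
    rw [← mul_inv, inv_pow, inv_eq_one] at h
    rw [← mul_inv, h1 h, inv_one]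

end BenardConway

end

theorem corollary5p6 (ℓ : ℕ) (hℓ : 0 < ℓ) (α₁ α₂ : ℝ)
    (hα₁ : α₁ ∈ Set.Ioo 0 Real.pi) (hα₂ : α₂ ∈ Set.Ioo 0 Real.pi)
    (hroot : ∀ m : ℕ, (0 < m ∧ m < ℓ) ∨ (ℓ < m ∧ m < 2 * ℓ) →
      α₁ + α₂ ≠ Real.pi * m / ℓ ∧ α₁ - α₂ + Real.pi ≠ Real.pi * m / ℓ) :
    (∀ Δ : BenardConway.Laurent 2,
      BenardConway.IsAlexanderPolynomial (BenardConway.torusBraid ℓ) Δ →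
      ∀ ε₁ ε₂ : ℤˣ,
        BenardConway.evalTorus
          ![Circle.exp (2 * α₁) ^ (ε₁ : ℤ), Circle.exp (2 * α₂) ^ (ε₂ : ℤ)] Δ ≠ 0) ∧
    BenardConway.WellDefined (BenardConway.torusLink ℓ) ![α₁, α₂] ∧
    BenardConway.benardConway (BenardConway.torusLink ℓ) ![α₁, α₂] =
      ({m : ℕ | 1 ≤ m ∧ m ≤ ℓ - 1 ∧
        Real.cos (Real.pi * m / ℓ) ∈
          Set.Icc (Real.cos (α₁ + α₂)) (Real.cos (α₁ - α₂))}.ncard : ℤ) := by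
  have h := BenardConway.hasPositivePoints_torusBraid hℓ hα₁ hα₂ hroot
  exact ⟨fun Δ hΔ => BenardConway.evalTorus_alexander_ne_zero hℓ hα₁ hα₂ hroot hΔ, h.wellDefined,
    h.benardConway_eq⟩
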